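/- Fields are not assumed commutative (a field is a division ring). Let $k$ be a commutative field. **Crossed products.** Let $L$ be a Lie $k$-algebra and $R$ a $k$-algebra. A crossed product $R*U(L)$ is a $k$-algebra containing $R$, with a $k$-linear embedding $x\mapsto\bar x$ of $L$ into it, a $k$-linear action $\delta\colon L\to \mathrm{Der}_k(R)$ and a $k$-bilinear antisymmetric twisting $t\colon L\times L\to R$, such that $\bar xa=a\bar x+\delta_x(a)$ and $\bar x\bar y-\bar y\bar x=\overline{[x,y]}+t(x,y)$ for $x,y\in L$, $a\in R$, and such that for a totally ordered basis of $L$ the standard monomials (the products $\bar x_1\cdots\bar x_r$, $r\ge 0$, of basis elements $x_1\le\dots\le x_r$) form a basis of $R*U(L)$ as a left $R$-module. For a Lie subalgebra $N$ of $L$, $R*U(N)$ is the subring generated by $R$ and the $\bar x$, $x\in N$. A field of fractions of a ring $S$ is an embedding of $S$ into a field that is generated, as a field, by the image of $S$. **Q-bases.** Let $H$ be a residually nilpotent Lie $k$-algebra with an RN-series $H=H_1\supseteq H_2\supseteq\cdots$, that is, a descending sequence of ideals with $[H,H_i]\subseteq H_{i+1}$ and $\bigcap_iH_i=0$. Suppose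 that it has a Q-basis $\mathcal C=\bigcup_{i\ge1}\mathcal C_i$: $\mathcal C$ is a basis of $H$, $\mathcal C_i\subseteq H_i$, and $\mathcal C_i$ gives a basis of $H_i/H_{i+1}$. Fix a canonical ordering of $\mathcal C$: each $\mathcal C_i$ is well-ordered, and the elements of $\mathcal C_{i}$ precede those of $\mathcal C_{j}$ if $i>j$. **The field $K(H)$.** Let $K$ be a field with $k$ as a central subfield, let $K*U(H)$ be a crossed product, and put $R_m=K*U(H_m)$ for $m\ge1$. The set $\mathcal B_m=\bigcup_{i=1}^{m-1}\mathcal C_i$ is well-ordered and gives a basis of $H/H_m$. The ring $R_m((H/H_m))$ is obtained from $R_m$ by adjoining, by transfinite recursion over $u\in\mathcal B_m$, series in $z_u=\bar u^{-1}$: if $A$ is the union of $R_m$ and of the rings obtained at the elements of $\mathcal B_m$ smaller than $u$, then the ring obtained at $u$ is the ring $A((z_u;\delta_u))$ of the series $\sum_{n\ge l}a_nz_u^n$ ($l\in\mathbb Z$, $a_n\in A$), with product determined by $\bar ua=a\bar u+\delta_u(a)$, equivalently $z_ua=\sum_{i\ge0}(-1)^i\delta_u^i(a)z_u^{i+1}$.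 Here, for $x\in H$, $\delta_x$ is the commutator with $\bar x$ on $R_m$, and it is extended to $A((z_u;\delta_u))$ by $\delta_x(z_u)=-z_u[\bar x,\bar u]z_u$ and $\delta_x(\sum a_nz_u^n)=\sum(\delta_x(a_n)z_u^n+a_n\delta_x(z_u^n))$. Then $R_m((H/H_m))$ is the union of $R_m$ and of the rings obtained at all $u\in\mathcal B_m$. For $m<n$ there is a natural embedding $R_m((H/H_m))\hookrightarrow R_n((H/H_n))$; $K((H))$ is the direct limit of these rings, and $K(H)$ is the subfield of $K((H))$ generated by $K*U(H)$. **Theorem.** Let $K*U(H)\hookrightarrow D$ be a field of fractions, and for $m\ge1$ let $D_m$ be the subfield of $D$ generated by $K*U(H_m)$. Suppose that, for every $m\ge1$, the standard monomials in $\bigcup_{i=1}^{m-1}\mathcal C_i$ are left linearly independent over $D_m$. Then $K(H)$ and $D$ are isomorphic fields of fractions of $K*U(H)$: there is a ring isomorphism $K(H)\to D$ that restricts to the identity on $K*U(H)$. -/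

import Mathlib

universe u v w w'

noncomputable section

open Module

/-! Crossed products `R * U(L)`, standard monomials, fields of fractions -/

/-- The standard monomial `x₁^{e₁} x₂^{e₂} ⋯ xᵣ^{eᵣ}`, `x₁ < ⋯ < xᵣ`, with exponents `e`, evaluated at
the family `x` of elements of a ring. -/
def stdMonomial {ι : Type*} [LinearOrder ι] {S : Type*} [Ring S] (x : ι → S) (e : ι →₀ ℕ) : S :=
  ((e.support.sort (· ≤ ·)).map fun i => x i ^ e i).prod

/-- A crossed product structure `S = R * U(L)`: a `k`-algebra `S` containing `R`, a `k`-linear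
embedding `x ↦ x̄` of `L`, an action `δ` of `L` by `k`-linear derivations of `R`, and a `k`-bilinear
antisymmetric twisting `t`. That `S` has the additive structure of `R ⊗ U(L)` means that, for
totally ordered bases of `L`, the standard monomials form a basis of `S` as a left `R`-module. -/
structure CrossedProduct (k : Type v) (R : Type w) (L : Type u) (S : Type w')
    [Field k] [Ring R] [Algebra k R] [LieRing L] [LieAlgebra k L] [Ring S] [Algebra k S] where
  coeff : R →ₐ[k] S
  coeff_injective : Function.Injective coeff
  bar : L →ₗ[k] S
  bar_injective : Function.Injective bar
  δ : L →ₗ[k] R →ₗ[k] R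
  leibniz : ∀ x a c, δ x (a * c) = δ x a * c + a * δ x c
  t : L →ₗ[k] L →ₗ[k] R
  antisymm : ∀ x y, t x y = -t y x
  bar_mul_coeff : ∀ x a, bar x * coeff a = coeff a * bar x + coeff (δ x a)
  bar_comm : ∀ x y, bar x * bar y - bar y * bar x = bar ⁅x, y⁆ + coeff (t x y)
  free : ∀ (ι : Type u) [LinearOrder ι] (b : Basis ι k L), Function.Bijective
    fun a : (ι →₀ ℕ) →₀ R => a.sum fun e r => coeff r * stdMonomial (fun i => bar (b i)) e

/-- `S ↪ D` is a field of fractions: an embedding into a division ring that is generated, as a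
division ring, by the image. -/
structure IsFieldOfFractions {S D : Type*} [Ring S] [DivisionRing D] (ι : S →+* D) : Prop where
  injective : Function.Injective ι
  generates : Subfield.closure (Set.range ι) = ⊤

/-! RN-series and Q-bases; all series are indexed from `0`, so `I 0 = H`. -/

section Series

variable {k : Type v} {K : Type w} {H C : Type u} {S : Type w'}
  [Field k] [DivisionRing K] [Algebra k K] [LieRing H] [LieAlgebra k H] [Ring S] [Algebra k S]

/-- RN-series of a (residually nilpotent) Lie algebra. -/
structure IsRNSeries (I : ℕ → LieIdeal k H) : Prop where
  top : I 0 = ⊤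
  antitone : ∀ i, I (i + 1) ≤ I i
  lie_mem : ∀ i (x y : H), y ∈ I i → ⁅x, y⁆ ∈ I (i + 1)
  iInf : ⨅ i, I i = ⊥

/-- The basis `b` of `H`, whose part `C_i` consists of the `b c` with `lev c = i`, is a Q-basis:
`C_i ⊆ H_i`, and the classes of the elements of `C_i` form a basis of `H_i / H_{i+1}`. -/
structure IsQBasis (I : ℕ → LieIdeal k H) (lev : C → ℕ) (b : Basis C k H) : Prop where
  mem : ∀ c, b c ∈ I (lev c)
  indep : ∀ i, LinearIndependent k
    fun c : {c // lev c = i} => (I (i + 1)).toSubmodule.mkQ (b c)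
  span : ∀ i, Submodule.span k
    (Set.range fun c : {c // lev c = i} => (I (i + 1)).toSubmodule.mkQ (b c)) =
      (I i).toSubmodule.map (I (i + 1)).toSubmodule.mkQ

variable [LinearOrder C]

/-- The order of `C` is a canonical one: each `C_i` is well-ordered, and the elements of `C_i`
precede those of `C_j` for `j < i`. -/
structure IsCanonicalOrder (lev : C → ℕ) : Prop where
  lt_of_lev : ∀ c d, lev d < lev c → c < d
  isWF : ∀ i, {c | lev c = i}.IsWF

theorem IsCanonicalOrder.wf {lev : C → ℕ} (h : IsCanonicalOrder lev) (m : ℕ) :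
    WellFounded fun c d : {c // lev c < m} => c.1 < d.1 := by
  have : {c | lev c < m}.IsWF := by
    induction m with
    | zero => simp
    | succ m ih =>
      have e : {c | lev c < m + 1} = {c | lev c < m} ∪ {c | lev c = m} := by
        ext c; simp only [Set.mem_ofPred_eq, Set.mem_union]; omega
      rw [e]; exact ih.union (h.isWF m)
  exact this

namespace CrossedProduct

variable (P : CrossedProduct k K H S) (I : ℕ → LieIdeal k H) (lev : C → ℕ) (b : Basis C k H)

/-- The subring `K * U(N)` of `K * U(H)`. -/
def sub (N : LieIdeal k H) : Subring S :=
  Subring.closure (Set.range P.coeff ∪ P.bar '' N)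

/-- The standard monomials in the basis `b`, as elements of `K * U(H)`. -/
def mon (e : C →₀ ℕ) : S := stdMonomial (fun c => P.bar (b c)) e

/-! ### The ring of series `K((H))`

The elements of all the rings `K * U(H_m)((H / H_m))` are written as formal sums
`∑ a_e ū^e` with `a_e ∈ K` on the left and `ū^e = ∏ ū_c ^ e_c` (factors in increasing order), where
`ū_c` is the image of `b c` and negative exponents stand for powers of `z_c = ū_c⁻¹`; that is,
as functions of the exponent `e : C →₀ ℤ`. -/

/-- Formal sums `∑ a_e ū^e`. -/
abbrev Formal (_ : CrossedProduct k K H S) (_ : Basis C k H) : Type _ := (C →₀ ℤ) → K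

open scoped Classical in
/-- The expansion of an element of `K * U(H)` in standard monomials. -/
def expand (s : S) : P.Formal b := fun e =>
  if 0 ≤ e then
    Function.surjInv (P.free C b).surjective s (e.mapRange Int.toNat Int.toNat_zero)
  else 0

variable {P b}

/-- `coef j n f = a_n` where `f = ∑ a_n ū_j^n` and `ū_j` does not occur in the `a_n`. -/
def coef (j : C) (n : ℤ) (f : P.Formal b) : P.Formal b := fun e =>
  if e j = 0 then f (e + Finsupp.single j n) else 0

/-- The variable `ū_c` occurs in `f`. -/
def Occurs (f : P.Formal b) (c : C) : Prop := ∃ e, f e ≠ 0 ∧ e c ≠ 0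

variable (P b)

/-- A multiplication on formal sums and, for `x ∈ H`, an operator `δ_x` (the commutator with `x̄`).
-/
structure Ops where
  mul : P.Formal b → P.Formal b → P.Formal b
  der : H → P.Formal b → P.Formal b

/-- The operations on `K * U(H)`, and thus on its subrings `K * U(H_m)`. -/
def baseOps : Ops P b where
  mul f g := P.expand b
    (Function.invFun (P.expand b) f * Function.invFun (P.expand b) g)
  der x f := P.expand b
    (P.bar x * Function.invFun (P.expand b) f - Function.invFun (P.expand b) f * P.bar x)

variable {P b}

/-- From the operations of a ring `A` to those of the ring `A((z; δ_u))` of series `∑ a_n ū^n`,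
`u = b j`, `z = ū⁻¹`, with exponents `n` bounded above. The product is determined by
`ū^n a = ∑_i (n choose i) δ_u^i(a) ū^{n-i}` for `a ∈ A` (for `n = 1` it is `ū a = a ū + δ_u(a)`,
for `n = -1` it is `z a = ∑_i (-1)^i δ_u^i(a) z^{i+1}`). The derivation `δ_x` acts on the coefficients
and, with `δ_x(ū) = [x̄, ū] ∈ A` and `δ_x(z) = - z δ_x(ū) z`, on the powers of `ū` by
`δ_x(ū^n) = ∑_i (n choose i+1) δ_u^i(δ_x(ū)) ū^{n-1-i}`. -/
def Ops.laurent (A : Ops P b) (j : C) : Ops P b where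
  mul f g := fun e => ∑ᶠ q : ℤ × ℕ, Ring.choose q.1 q.2 •
    A.mul (coef j q.1 f) ((A.der (b j))^[q.2] (coef j (e j - q.1 + q.2) g)) (e.erase j)
  der x f := fun e => A.der x (coef j (e j) f) (e.erase j) +
    ∑ᶠ i : ℕ, Ring.choose (e j + 1 + i) (i + 1) •
      A.mul (coef j (e j + 1 + i) f) ((A.der (b j))^[i]
        (P.expand b (P.bar x * P.bar (b j) - P.bar (b j) * P.bar x))) (e.erase j)

/-- `i` is the greatest among the elements of `C_0 ∪ ⋯ ∪ C_{m-1}` that occur in `f` or `g`. -/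
def IsTop (m : ℕ) (f g : P.Formal b) (i : C) : Prop :=
  IsGreatest {c | lev c < m ∧ (Occurs f c ∨ Occurs g c)} i

variable (P b)

open scoped Classical in
/-- The operations on a union of rings, given the operations `G i` of the rings of the series whose
variables in `C_0 ∪ ⋯ ∪ C_{m-1}` are at most `i`, for all `i` with `p i`: the operations of `G i` are
used where `i` is the greatest such variable that occurs in the operands, and those of `K * U(H)`
where there is none. -/
def union (m : ℕ) (p : {c // lev c < m} → Prop) (G : ∀ i, p i → Ops P b) : Ops P b where
  mul f g := if h : ∃ i, p i ∧ IsTop lev m f g i.1 then (G h.choose h.choose_spec.1).mul f g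
    else (baseOps P b).mul f g
  der x f := if h : ∃ i, p i ∧ IsTop lev m f f i.1 then (G h.choose h.choose_spec.1).der x f
    else (baseOps P b).der x f

variable {lev}

/-- With `R_m = K * U(H_m)` and `N_{<j}`, `N_{≤j}` the ideals of `H / H_m` spanned by the elements of
`C_0 ∪ ⋯ ∪ C_{m-1}` that are `< j`, respectively `≤ j`: the operations on `R_m((N_{≤j}))`, by transfinite
recursion on `j`. They are those of the series ring in `z_j` over `R_m((N_{<j}))`, where `R_m((N_{<j}))`
is the union of `R_m` and of the `R_m((N_{≤i}))` with `i < j`. -/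
def opsUpTo (hord : IsCanonicalOrder lev) (m : ℕ) : {c // lev c < m} → Ops P b :=
  (hord.wf m).fix fun j G => (union P lev b m (fun i => i.1 < j.1) G).laurent j.1

/-- The operations on `R_m((H / H_m))`. -/
def ops (hord : IsCanonicalOrder lev) (m : ℕ) : Ops P b :=
  union P lev b m (fun _ => True) fun i _ => opsUpTo P b hord m i

variable (lev)

/-- The elements of `R_m((H / H_m))`: they are obtained from those of `R_m = K * U(H_m)` by forming
series in `z_j`, `j ∈ C_0 ∪ ⋯ ∪ C_{m-1}`, with coefficients that were obtained before and in which
only variables of `C_0 ∪ ⋯ ∪ C_{m-1}` less than `j` occur. -/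
inductive MemSeriesAt (m : ℕ) : P.Formal b → Prop
  | base (s : S) : s ∈ P.sub (I m) → MemSeriesAt m (P.expand b s)
  | laurent (j : C) (f : P.Formal b) : lev j < m →
      (∀ n, MemSeriesAt m (coef j n f)) →
      (∀ n c, lev c < m → Occurs (coef j n f) c → c < j) →
      (∃ N : ℤ, ∀ n, N < n → coef j n f = 0) → MemSeriesAt m f

/-- The elements of `K((H))`, the direct limit (here: the increasing union) of the rings
`R_m((H / H_m))`. -/
def MemSeries (f : P.Formal b) : Prop := ∃ m, MemSeriesAt P I lev b m f

variable {lev}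

/-- The product of `K((H))`: the product of any of the rings `R_m((H / H_m))` which contain both
factors. -/
def seriesMul (hord : IsCanonicalOrder lev) (f g : P.Formal b) : P.Formal b :=
  (ops P b hord (sInf {m | MemSeriesAt P I lev b m f ∧ MemSeriesAt P I lev b m g})).mul f g

/-- The elements of `K(H)`, the subfield of `K((H))` that is generated by `K * U(H)`. -/
inductive MemKH (hord : IsCanonicalOrder lev) : P.Formal b → Prop
  | of (s : S) : MemKH hord (P.expand b s)
  | add {f g : P.Formal b} : MemKH hord f → MemKH hord g → MemKH hord (f + g)
  | neg {f : P.Formal b} : MemKH hord f → MemKH hord (-f)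
  | mul {f g : P.Formal b} : MemKH hord f → MemKH hord g → MemKH hord (seriesMul P I b hord f g)
  | inv {f g : P.Formal b} : MemKH hord f → MemSeries P I lev b g →
      seriesMul P I b hord f g = P.expand b 1 → seriesMul P I b hord g f = P.expand b 1 →
      MemKH hord g

/-- The field `K(H)`. -/
def KH (hord : IsCanonicalOrder lev) : Type _ := {f : P.Formal b // MemKH P I b hord f}

instance (hord : IsCanonicalOrder lev) : Add (KH P I b hord) :=
  ⟨fun f g => ⟨f.1 + g.1, f.2.add g.2⟩⟩

instance (hord : IsCanonicalOrder lev) : Mul (KH P I b hord) :=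
  ⟨fun f g => ⟨seriesMul P I b hord f.1 g.1, f.2.mul g.2⟩⟩

/-- The embedding of `K * U(H)` in `K(H)`. -/
def toKH (hord : IsCanonicalOrder lev) (s : S) : KH P I b hord := ⟨P.expand b s, .of s⟩

end CrossedProduct

end Series

end

/-!
Write `S = K * U(H)`, `L = K((H))`, and let `D` be a field of fractions of `S`, with embedding
`ι : S → D`. The isomorphism of `K(H)` with `D` is obtained by comparing both inside `D ⊗_S L`.

**The ring `K((H))`.** Elements of all the rings in sight are formal sums, that is, functions from
exponents to `K`. A set of formal sums is *good* for given operations (`IsGood`) if it is a ring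
acted on by `H` through derivations in the way `S` is. Over a good ring `A` the series `∑ aₙ ūⁿ` in
one more variable form a good ring (`IsGood.laurent`). This rests on the calculus of series in
`u⁻¹` over a ring with a derivation: multiplication by `uⁿ` on the left commutes with right
multiplications (`SkewLaurent.twist_mul`), identities that hold for monomials hold for series by
continuity (`SkewLaurent.eq_zero_of_monomials`), and a derivation is determined by its values on
the coefficients and on `u` (`SkewLaurent.derivation_eq_zero`). By transfinite induction each ring
of the tower `R_m((H / H_m))` is good (`isGood_le`), and so is their direct limit `K((H))`
(`isGood_series`). A series is invertible if its leading coefficient is; passing to leading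
coefficients repeatedly one arrives at an element of `K * U(H_m)`, which only involves finitely
many variables and becomes a series in those when `m` increases, so that its leading coefficients
end in `K`. Hence `K((H))` is a division ring (`MemSeriesAt.hasInv`, `exists_mul_eq_one`).

**`1 ⊗ 1 ≠ 0` in `D ⊗_S L`.** Tensor products commute with unions, so one may replace `L` by
`M = R_m((H / H_m))`. Let `Q` be the subring of `D` generated by `S` and the subfield `D_m` that
`R_m = K * U(H_m)` generates. Adjoining the variables of level less than `m` to `D_m` one at a
time, one sees that `Q` is a left Ore domain: at each step the ring consists of polynomials in the
new variable, and two of these have a common left multiple since the spaces of polynomials of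
bounded degree are too small for their left multiples to be independent (`exists_common_multiple`,
`isLeftOre_top`). So `D` consists of left fractions of `Q` (`mem_fractions_subringOf`). The ring
`Q` is spanned over `D_m` by the standard monomials in the variables of level less than `m`, and
these are independent by assumption. Therefore, for `f` in `M`, the coefficient in `R_m` of the
element `s f` at a given monomial is the value at `ι s` of a `D_m`-linear form (`exists_form`). For
`f = 1` these forms are the coordinates on `Q`, so that `q ⊗ 1 ≠ 0` in `Q ⊗_S M` for every nonzero
`q`, and clearing denominators gives `1 ⊗ 1 ≠ 0` in `D ⊗_S M` (`single_one_notMem_span_of_forms`).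
Equivalently, there is a left `S`-linear map `ψ : L → D` with `ψ 1 = 1`
(`exists_series_functional`).

**The isomorphism.** The pairs `(d, f)` in `D × L` with `1 ⊗ f = d ⊗ 1` form a subring `corr`,
since right multiplications of `L` act on `D ⊗_S L`. It contains the pairs `(ι s, s)`, and because
of `ψ` it contains no `(d, f)` in which just one of the two is zero and it is closed under
inverses. As `D` and `K(H)` are generated by `S` as fields, `corr` restricts to the graph of a
bijection `K(H) → D`, which is the required isomorphism (`exists_ringEquiv`).
-/

/-! ### Series in `u⁻¹` over a ring with a derivation -/

namespace SkewLaurent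

variable {A : Type*} [Ring A]

/-- `f : ℤ → A`, read as the series `∑ f n uⁿ`, has degree at most `p`. -/
def BddDeg (p : ℤ) (f : ℤ → A) : Prop := ∀ n, p < n → f n = 0

theorem BddDeg.mono {p q : ℤ} {f : ℤ → A} (h : BddDeg p f) (hpq : p ≤ q) : BddDeg q f :=
  fun n hn => h n (by omega)

theorem BddDeg.add {p : ℤ} {f g : ℤ → A} (hf : BddDeg p f) (hg : BddDeg p g) :
    BddDeg p (f + g) := fun n hn => by simp [hf n hn, hg n hn]

theorem BddDeg.sub {p : ℤ} {f g : ℤ → A} (hf : BddDeg p f) (hg : BddDeg p g) :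
    BddDeg p (f - g) := fun n hn => by simp [hf n hn, hg n hn]

theorem BddDeg.neg {p : ℤ} {f : ℤ → A} (hf : BddDeg p f) : BddDeg p (-f) :=
  fun n hn => by simp [hf n hn]

theorem bddDeg_single (n : ℤ) (a : A) : BddDeg n (Pi.single n a : ℤ → A) :=
  fun m hm => by simp [hm.ne']

theorem BddDeg.comp {p : ℤ} {f : ℤ → A} (hf : BddDeg p f) {φ : A → A} (hφ : φ 0 = 0) :
    BddDeg p fun n => φ (f n) := fun n hn => by simp [hf n hn, hφ]

/-- An additive operator on series which lowers degrees up to a constant, and which kills all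
monomials, is zero. -/
theorem eq_zero_of_monomials (Φ : (ℤ → A) → ℤ → A) (c : ℤ)
    (hadd : ∀ p f g, BddDeg p f → BddDeg p g → Φ (f + g) = Φ f + Φ g)
    (hs : ∀ n a, Φ (Pi.single n a) = 0)
    (hb : ∀ p f, BddDeg p f → BddDeg (p + c) (Φ f)) {p : ℤ} {f : ℤ → A} (hf : BddDeg p f) :
    Φ f = 0 := by
  have key : ∀ N : ℕ, ∃ g, BddDeg (p - N) g ∧ Φ f = Φ g := by
    intro N
    induction N with
    | zero => exact ⟨f, by simpa using hf, rfl⟩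
    | succ N ih =>
      obtain ⟨g, hg, e⟩ := ih
      have h1 : BddDeg (p - N) (g - Pi.single (p - N) (g (p - N))) :=
        hg.sub (bddDeg_single _ _)
      refine ⟨g - Pi.single (p - N) (g (p - N)), ?_, ?_⟩
      · intro n hn
        rcases eq_or_ne n (p - N) with rfl | h
        · simp
        · exact h1 n (by push_cast at hn; omega)
      · have := hadd _ _ _ h1 (bddDeg_single (p - N) (g (p - N)))
        rw [hs, sub_add_cancel, add_zero] at this
        rw [e, this]
  funext k
  obtain ⟨g, hg, e⟩ := key (p + c - k + 1).toNat
  rw [e]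
  exact hb _ _ hg k (by omega)

variable (δ : A →+ A)

/-- The series `uⁿ g`. -/
noncomputable def twist (n : ℤ) (g : ℤ → A) : ℤ → A :=
  fun k => ∑ᶠ i : ℕ, Ring.choose n i • δ^[i] (g (k - n + i))

/-- The product of series, determined by `u a = a u + δ a`. -/
noncomputable def mul (f g : ℤ → A) : ℤ → A :=
  fun k => ∑ᶠ q : ℤ × ℕ, Ring.choose q.1 q.2 • (f q.1 * δ^[q.2] (g (k - q.1 + q.2)))

/-- The derivation of the ring of series which extends the derivation `d` of the ring of
coefficients and maps `u` to `w`. -/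
noncomputable def ext (d : A →+ A) (w : A) (f : ℤ → A) : ℤ → A :=
  fun k => d (f k) + ∑ᶠ i : ℕ, Ring.choose (k + 1 + i) (i + 1) • (f (k + 1 + i) * δ^[i] w)

/-- The series `u g`. -/
def up (g : ℤ → A) : ℤ → A := fun k => g (k - 1) + δ (g k)

variable {δ}

theorem twist_eq_sum {r : ℤ} {g : ℤ → A} (hg : BddDeg r g) {n k : ℤ} {N : ℕ}
    (h : r < k - n + N) :
    twist δ n g k = ∑ i ∈ Finset.range N, Ring.choose n i • δ^[i] (g (k - n + i)) := by
  refine finsum_eq_sum_of_support_subset _ fun i hi => ?_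
  by_contra hN
  refine hi ?_
  have : N ≤ i := by simpa using hN
  simp only
  rw [hg _ (by omega), iterate_map_zero, smul_zero]

theorem mul_eq_sum {p r : ℤ} {f g : ℤ → A} (hf : BddDeg p f) (hg : BddDeg r g) {k lo hi : ℤ}
    (hlo : lo ≤ k - r) (hhi : p ≤ hi) :
    mul δ f g k = ∑ n ∈ Finset.Icc lo hi, f n * twist δ n g k := by
  have e : ∀ n ∈ Finset.Icc lo hi, f n * twist δ n g k =
      ∑ i ∈ Finset.range (hi + r - k + 1).toNat,
        Ring.choose n i • (f n * δ^[i] (g (k - n + i))) := by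
    intro n hn
    rw [Finset.mem_Icc] at hn
    rw [twist_eq_sum hg (N := (hi + r - k + 1).toNat) (by omega), Finset.mul_sum]
    simp only [mul_smul_comm]
  rw [Finset.sum_congr rfl e, ← Finset.sum_product']
  refine finsum_eq_sum_of_support_subset _ fun q hq => ?_
  by_contra hN
  refine hq ?_
  simp only
  by_cases h1 : p < q.1
  · rw [hf _ h1, zero_mul, smul_zero]
  · rw [hg, iterate_map_zero, mul_zero, smul_zero]
    by_contra h2
    refine hN ?_
    simp only [Finset.coe_product, Set.mem_prod, Finset.coe_Icc, Set.mem_Icc, Finset.coe_range,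
      Set.mem_Iio]
    omega

theorem BddDeg.twist {r : ℤ} {g : ℤ → A} (hg : BddDeg r g) (n : ℤ) :
    BddDeg (r + n) (twist δ n g) := fun k hk => by
  rw [twist_eq_sum hg (N := 0) (by push_cast; omega)]; simp

theorem BddDeg.mul {p r : ℤ} {f g : ℤ → A} (hf : BddDeg p f) (hg : BddDeg r g) :
    BddDeg (p + r) (mul δ f g) := fun k hk => by
  rw [mul_eq_sum hf hg le_rfl le_rfl, Finset.Icc_eq_empty (by omega)]; simp

theorem twist_add {r : ℤ} {f g : ℤ → A} (hf : BddDeg r f) (hg : BddDeg r g) (n : ℤ) :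
    twist δ n (f + g) = twist δ n f + twist δ n g := by
  funext k
  have h : r < k - n + ((r - k + n + 1).toNat : ℕ) := by omega
  rw [Pi.add_apply, twist_eq_sum hf h, twist_eq_sum hg h, twist_eq_sum (hf.add hg) h,
    ← Finset.sum_add_distrib]
  simp [iterate_map_add]

theorem mul_add_right {p r : ℤ} {f g h : ℤ → A} (hf : BddDeg p f) (hg : BddDeg r g)
    (hh : BddDeg r h) : mul δ f (g + h) = mul δ f g + mul δ f h := by
  funext k
  rw [Pi.add_apply, mul_eq_sum hf hg le_rfl le_rfl, mul_eq_sum hf hh le_rfl le_rfl,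
    mul_eq_sum hf (hg.add hh) le_rfl le_rfl, ← Finset.sum_add_distrib]
  simp [twist_add hg hh, mul_add]

theorem mul_add_left {p r : ℤ} {f g h : ℤ → A} (hf : BddDeg p f) (hg : BddDeg p g)
    (hh : BddDeg r h) : mul δ (f + g) h = mul δ f h + mul δ g h := by
  funext k
  rw [Pi.add_apply, mul_eq_sum hf hh le_rfl le_rfl, mul_eq_sum hg hh le_rfl le_rfl,
    mul_eq_sum (hf.add hg) hh le_rfl le_rfl, ← Finset.sum_add_distrib]
  simp [add_mul]

theorem twist_zero (g : ℤ → A) : twist δ 0 g = g := by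
  funext k
  rw [twist, finsum_eq_single _ 0]
  · simp
  · intro i hi
    rw [Ring.choose_zero_pos _ (Nat.pos_of_ne_zero hi), zero_smul]

theorem BddDeg.up {r : ℤ} {g : ℤ → A} (hg : BddDeg r g) : BddDeg (r + 1) (up δ g) :=
  fun k hk => by simp [SkewLaurent.up, hg k (by omega), hg (k - 1) (by omega)]

/-- `u (uⁿ g) = uⁿ⁺¹ g`, by Pascal's rule for generalized binomial coefficients. -/
theorem twist_succ {r : ℤ} {g : ℤ → A} (hg : BddDeg r g) (n : ℤ) :
    twist δ (n + 1) g = up δ (twist δ n g) := by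
  funext k
  set N := (r - k + n + 2).toNat with hN
  have h1 := twist_eq_sum (δ := δ) hg (n := n + 1) (k := k) (N := N + 1) (by push_cast; omega)
  have h2 := twist_eq_sum (δ := δ) hg (n := n) (k := k - 1) (N := N + 1) (by push_cast; omega)
  have h3 := twist_eq_sum (δ := δ) hg (n := n) (k := k) (N := N) (by omega)
  rw [up, h1, h2, h3, Finset.sum_range_succ', Finset.sum_range_succ', map_sum,
    add_right_comm, ← Finset.sum_add_distrib]
  congr 1
  · refine Finset.sum_congr rfl fun i _ => ?_
    rw [Ring.choose_succ_succ, add_smul, map_zsmul, ← Function.iterate_succ_apply' (f := δ)]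
    rw [show k - 1 - n + ((i + 1 : ℕ) : ℤ) = k - n + i by push_cast; ring,
      show k - (n + 1) + ((i + 1 : ℕ) : ℤ) = k - n + i by push_cast; ring, add_comm]
  · simp only [Ring.choose_zero_right]
    congr 4
    ring

theorem twist_one {r : ℤ} {g : ℤ → A} (hg : BddDeg r g) : twist δ 1 g = up δ g := by
  rw [← zero_add (1 : ℤ), twist_succ hg, twist_zero]

theorem up_add (f g : ℤ → A) : up δ (f + g) = up δ f + up δ g := by
  funext k; simp only [up, Pi.add_apply, map_add]; abel

/-- Multiplication by `u` is injective. Hence an identity for `u ^ (n + 1)` implies that for `u ^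
n`, and inductions on exponents extend to negative ones. -/
theorem up_injective {r s : ℤ} {f g : ℤ → A} (hf : BddDeg r f) (hg : BddDeg s g)
    (h : up δ f = up δ g) : f = g := by
  have hb : BddDeg (max r s) (f - g) :=
    (hf.mono (le_max_left _ _)).sub (hg.mono (le_max_right _ _))
  have e : ∀ k, (f - g) (k - 1) = - δ ((f - g) k) := fun k => by
    have := congrFun h k
    simp only [up] at this
    rw [Pi.sub_apply, Pi.sub_apply, map_sub, sub_eq_iff_eq_add, neg_sub, sub_add_eq_add_sub,
      eq_sub_iff_add_eq, this, add_comm]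
  have key : ∀ N : ℕ, (f - g) (max r s + 1 - N) = 0 := by
    intro N
    induction N with
    | zero => exact hb _ (by simp)
    | succ N ih =>
      rw [Nat.cast_succ, ← sub_sub, e, ih, map_zero, neg_zero]
  have : f - g = 0 := by
    funext k
    by_cases hk : max r s < k
    · exact hb k hk
    · have := key (max r s + 1 - k).toNat
      rwa [Int.toNat_of_nonneg (by omega), sub_sub_cancel] at this
  exact sub_eq_zero.1 this

/-- Multiplication by a coefficient is applied coefficientwise. -/
theorem mul_smul_left (a : A) {p r : ℤ} {f g : ℤ → A} (hf : BddDeg p f) (hg : BddDeg r g) :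
    mul δ (a • f) g = a • mul δ f g := by
  funext k
  have : BddDeg p (a • f) := hf.comp (φ := fun x => a * x) (mul_zero a)
  rw [Pi.smul_apply, mul_eq_sum hf hg le_rfl le_rfl, mul_eq_sum this hg le_rfl le_rfl,
    Finset.smul_sum]
  simp [mul_assoc]

theorem single_mul (n : ℤ) (a : A) {r : ℤ} {g : ℤ → A} (hg : BddDeg r g) :
    mul δ (Pi.single n a) g = a • twist δ n g := by
  funext k
  rw [mul_eq_sum (bddDeg_single n a) hg (min_le_left _ n) le_rfl,
    Finset.sum_eq_single_of_mem n (by simp)]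
  · simp
  · intro m _ hm; simp [hm]

theorem up_mul (hδ : ∀ a c, δ (a * c) = δ a * c + a * δ c) {p r : ℤ} {f g : ℤ → A}
    (hf : BddDeg p f) (hg : BddDeg r g) : mul δ (up δ f) g = up δ (mul δ f g) := by
  funext k
  have e1 := mul_eq_sum (δ := δ) (hf.up (δ := δ)) hg (k := k) (lo := k - r) (hi := p + 1)
    le_rfl le_rfl
  have e2 := mul_eq_sum (δ := δ) hf hg (k := k - 1) (lo := k - r - 1) (hi := p) (by omega) le_rfl
  have e3 := mul_eq_sum (δ := δ) hf hg (k := k) (lo := k - r - 1) (hi := p + 1)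
    (by omega) (by omega)
  have e4 : ∑ n ∈ Finset.Icc (k - r) (p + 1), f (n - 1) * twist δ n g k =
      ∑ n ∈ Finset.Icc (k - r - 1) p, f n * twist δ (n + 1) g k := by
    refine Finset.sum_bij' (fun n _ => n - 1) (fun n _ => n + 1) ?_ ?_ ?_ ?_ ?_
    all_goals simp
  have e5 := mul_eq_sum (δ := δ) (hf.comp δ.map_zero) hg (k := k) (lo := k - r) (hi := p + 1)
    le_rfl (by omega)
  have e6 := mul_eq_sum (δ := δ) (hf.comp δ.map_zero) hg (k := k) (lo := k - r - 1) (hi := p)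
    (by omega) (by omega)
  have e7 := mul_eq_sum (δ := δ) hf hg (k := k) (lo := k - r - 1) (hi := p)
    (by omega) le_rfl
  have e8 : ∑ n ∈ Finset.Icc (k - r) (p + 1), up δ f n * twist δ n g k =
      ∑ n ∈ Finset.Icc (k - r) (p + 1), f (n - 1) * twist δ n g k +
      ∑ n ∈ Finset.Icc (k - r) (p + 1), δ (f n) * twist δ n g k := by
    rw [← Finset.sum_add_distrib]
    simp only [up, add_mul]
  rw [e1, e8, e4, ← e5, e6, up, e2, e7, map_sum, ← Finset.sum_add_distrib,
    ← Finset.sum_add_distrib]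
  refine Finset.sum_congr rfl fun n _ => ?_
  rw [twist_succ hg, up, hδ, mul_add]
  abel

/-- Left multiplication by `u ^ n` commutes with right multiplications. -/
theorem twist_mul (hδ : ∀ a c, δ (a * c) = δ a * c + a * δ c) {p r : ℤ} {f g : ℤ → A}
    (hf : BddDeg p f) (hg : BddDeg r g) (n : ℤ) :
    mul δ (twist δ n f) g = twist δ n (mul δ f g) := by
  induction n with
  | zero => simp only [twist_zero]
  | succ i ih => rw [twist_succ hf, up_mul hδ (hf.twist _) hg, ih, twist_succ (hf.mul hg)]
  | pred i ih =>
    refine up_injective (δ := δ) ((hf.twist _).mul hg) ((hf.mul hg).twist _) ?_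
    rw [← up_mul hδ (hf.twist _) hg, ← twist_succ hf, ← twist_succ (hf.mul hg), sub_add_cancel, ih]

/-- Both sides are additive and continuous in `f`, so that `f` may be taken to be a monomial. -/
theorem mul_assoc' (hδ : ∀ a c, δ (a * c) = δ a * c + a * δ c) {p q r : ℤ} {f g h : ℤ → A}
    (hf : BddDeg p f) (hg : BddDeg q g) (hh : BddDeg r h) :
    mul δ (mul δ f g) h = mul δ f (mul δ g h) := by
  refine sub_eq_zero.1 (eq_zero_of_monomials
    (fun f => mul δ (mul δ f g) h - mul δ f (mul δ g h)) (q + r) ?_ ?_ ?_ hf)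
  · intro p f f' hf hf'
    rw [mul_add_left hf hf' hg, mul_add_left (hf.mul hg) (hf'.mul hg) hh,
      mul_add_left hf hf' (hg.mul hh)]
    abel
  · intro n a
    rw [single_mul n a hg, single_mul n a (hg.mul hh), mul_smul_left a (hg.twist n) hh,
      twist_mul hδ hg hh, sub_self]
  · intro p f hf
    rw [← add_assoc]
    refine ((hf.mul hg).mul hh).sub ?_
    rw [add_assoc]
    exact hf.mul (hg.mul hh)

theorem map_one_eq_zero (hδ : ∀ a c, δ (a * c) = δ a * c + a * δ c) : δ 1 = 0 := by
  simpa using hδ 1 1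

theorem one_mul' {r : ℤ} {g : ℤ → A} (hg : BddDeg r g) : mul δ (Pi.single 0 1) g = g := by
  rw [single_mul _ _ hg, twist_zero, one_smul]

theorem up_single (n : ℤ) (a : A) :
    up δ (Pi.single n a) = Pi.single (n + 1) a + Pi.single n (δ a) := by
  funext k
  simp only [up, Pi.add_apply, Pi.single_apply]
  congr 1
  · simp only [sub_eq_iff_eq_add]
  · split_ifs <;> simp

/-- Elements which `δ` kills commute with `u`. -/
theorem twist_single {a : A} (ha : δ a = 0) (n m : ℤ) :
    twist δ n (Pi.single m a) = Pi.single (m + n) a := by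
  have hb := fun m => bddDeg_single m a
  have e : ∀ m, up δ (Pi.single m a) = Pi.single (m + 1) a := fun m => by
    rw [up_single, ha, Pi.single_zero, add_zero]
  induction n with
  | zero => rw [twist_zero, add_zero]
  | succ i ih => rw [twist_succ (hb m), ih, e, add_assoc]
  | pred i ih =>
    refine up_injective (δ := δ) ((hb m).twist _) (hb _) ?_
    rw [← twist_succ (hb m), e, sub_add_cancel, ih]
    congr 1; ring

theorem mul_one' (hδ : ∀ a c, δ (a * c) = δ a * c + a * δ c) {r : ℤ} {g : ℤ → A}
    (hg : BddDeg r g) : mul δ g (Pi.single 0 1) = g := by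
  refine sub_eq_zero.1 (eq_zero_of_monomials
    (fun g => mul δ g (Pi.single 0 1) - g) 0 ?_ ?_ ?_ hg)
  · intro p f f' hf hf'
    rw [mul_add_left hf hf' (bddDeg_single 0 _)]
    abel
  · intro n a
    rw [single_mul n a (bddDeg_single 0 _), twist_single (map_one_eq_zero hδ), ← Pi.single_smul]
    simp
  · intro p f hf
    exact (hf.mul (bddDeg_single 0 _)).sub (hf.mono (by omega))

/-- The leading coefficient of a product. -/
theorem mul_top {p r : ℤ} {f g : ℤ → A} (hf : BddDeg p f) (hg : BddDeg r g) :
    mul δ f g (p + r) = f p * g r := by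
  rw [mul_eq_sum hf hg le_rfl le_rfl, add_sub_cancel_right, Finset.Icc_self, Finset.sum_singleton,
    twist_eq_sum hg (N := 1) (by push_cast; omega)]
  simp

theorem eq_of_bddDeg {f g : ℤ → A} (h : ∀ N : ℕ, BddDeg (-N) (f - g)) : f = g := by
  refine sub_eq_zero.1 (funext fun k => ?_)
  exact h (-k + 1).toNat k (by omega)

/-- The geometric series inverts a series `1 - x` for `x` of negative degree. -/
theorem exists_right_inv {f : ℤ → A} (hf : BddDeg (-1) (f - Pi.single 0 1)) :
    ∃ g, BddDeg (-1) (g - Pi.single 0 1) ∧ mul δ f g = Pi.single 0 1 := by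
  set x := Pi.single 0 1 - f with hx
  have hxb : BddDeg (-1) x := by rw [hx, ← neg_sub]; exact hf.neg
  have h1 : BddDeg 0 (Pi.single 0 1 : ℤ → A) := bddDeg_single 0 _
  have hfb : BddDeg 0 f := by
    rw [← sub_add_cancel f (Pi.single 0 1)]
    exact (hf.mono (by omega)).add h1
  let X : ℕ → ℤ → A := fun n => (mul δ x)^[n] (Pi.single 0 1)
  have hX : ∀ n : ℕ, BddDeg (-n) (X n) := fun n => by
    induction n with
    | zero => simpa [X] using h1
    | succ n ih =>
      have := hxb.mul (δ := δ) ih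
      simp only [X, Function.iterate_succ_apply'] at this ⊢
      exact this.mono (by push_cast; omega)
  let y : ℤ → A := fun k => ∑ n ∈ Finset.range (-k + 1).toNat, X n k
  -- up to degree `-P`, `y` is the `P`-th partial sum of the geometric series
  have hy : ∀ P : ℕ, BddDeg (-P) (y - ∑ n ∈ Finset.range P, X n) := fun P k hk => by
    have hle : (-k + 1).toNat ≤ P := by omega
    rw [Pi.sub_apply, Finset.sum_apply, sub_eq_zero]
    refine Finset.sum_subset (Finset.range_mono hle) fun n _ hn => hX n k ?_
    simp only [Finset.mem_range, not_lt] at hn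
    omega
  have hS : ∀ P : ℕ, BddDeg 0 (∑ n ∈ Finset.range P, X n) := fun P k hk => by
    rw [Finset.sum_apply]
    exact Finset.sum_eq_zero fun n _ => hX n k (by omega)
  have hfS : ∀ P : ℕ, mul δ f (∑ n ∈ Finset.range P, X n) = Pi.single 0 1 - X P := fun P => by
    induction P with
    | zero => funext k; simp [X, mul]
    | succ P ih =>
      have e1 : mul δ f (X P) + X (P + 1) = X P := by
        have : X (P + 1) = mul δ x (X P) := Function.iterate_succ_apply' _ _ _
        rw [this, ← mul_add_left hfb (hxb.mono (by omega)) (hX P), hx, add_sub_cancel,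
          one_mul' (hX P)]
      rw [Finset.sum_range_succ, mul_add_right hfb (hS P) ((hX P).mono (by omega)), ih,
        sub_add, ← eq_sub_iff_add_eq'.2 e1]
  have hyb : BddDeg 0 y := by simpa using hy 0
  refine ⟨y, ?_, eq_of_bddDeg fun P => ?_⟩
  · simpa [X] using hy 1
  · have e : mul δ f y - Pi.single 0 1 =
        mul δ f (y - ∑ n ∈ Finset.range P, X n) - X P := by
      have := mul_add_right (δ := δ) hfb ((hy P).mono (by omega)) (hS P)
      rw [sub_add_cancel, hfS] at this
      rw [this]; abel
    rw [e]
    exact ((hfb.mul (hy P)).mono (by omega)).sub (hX P)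

/-- A series whose leading coefficient is invertible is invertible. -/
theorem exists_inv (hδ : ∀ a c, δ (a * c) = δ a * c + a * δ c) {p : ℤ} {f : ℤ → A}
    (hf : BddDeg p f) {a : A} (h1 : f p * a = 1) (h2 : a * f p = 1) :
    ∃ (q : ℤ) (g : ℤ → A), BddDeg q g ∧ mul δ f g = Pi.single 0 1 ∧
      mul δ g f = Pi.single 0 1 := by
  have hone : BddDeg 0 (Pi.single 0 1 : ℤ → A) := bddDeg_single 0 _
  have bd : ∀ {x : ℤ → A}, BddDeg 0 x → x 0 = 1 → BddDeg (-1) (x - Pi.single 0 1) := by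
    intro x hx h0 k hk
    rcases (show 0 ≤ k by omega).eq_or_lt with rfl | h
    · simp [h0]
    · simp [hx k h, h.ne']
  have bd' : ∀ {x : ℤ → A}, BddDeg (-1) (x - Pi.single 0 1) → BddDeg 0 x := by
    intro x hx
    rw [← sub_add_cancel x (Pi.single 0 1)]
    exact (hx.mono (by omega)).add hone
  have right : ∀ {x : ℤ → A}, BddDeg (-1) (x - Pi.single 0 1) → ∃ y, BddDeg 0 y ∧
      mul δ x y = Pi.single 0 1 ∧ mul δ y x = Pi.single 0 1 := by
    intro x hx
    obtain ⟨y, hy, e⟩ := exists_right_inv (δ := δ) hx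
    obtain ⟨z, hz, e'⟩ := exists_right_inv (δ := δ) hy
    have : z = x := by
      rw [← one_mul' (δ := δ) (bd' hz), ← e, mul_assoc' hδ (bd' hx) (bd' hy) (bd' hz), e',
        mul_one' hδ (bd' hx)]
    exact ⟨y, bd' hy, e, this ▸ e'⟩
  set g₀ : ℤ → A := twist δ (-p) (Pi.single 0 a) with hg₀
  have hg₀b : BddDeg (-p) g₀ := ((bddDeg_single 0 a).twist (-p)).mono (by omega)
  have hg₀t : g₀ (-p) = a := by
    rw [hg₀, twist_eq_sum (bddDeg_single 0 a) (N := 1) (by push_cast; omega)]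
    simp
  have b1 : BddDeg 0 (mul δ f g₀) := (hf.mul hg₀b).mono (by omega)
  have b2 : BddDeg 0 (mul δ g₀ f) := (hg₀b.mul hf).mono (by omega)
  have t1 := mul_top (δ := δ) hf hg₀b
  have t2 := mul_top (δ := δ) hg₀b hf
  rw [hg₀t, add_neg_cancel, h1] at t1
  rw [hg₀t, neg_add_cancel, h2] at t2
  obtain ⟨y, hy, e, -⟩ := right (bd b1 t1)
  obtain ⟨y', hy', -, e'⟩ := right (bd b2 t2)
  rw [mul_assoc' hδ hf hg₀b hy] at e
  rw [← mul_assoc' hδ hy' hg₀b hf] at e'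
  have : mul δ y' g₀ = mul δ g₀ y := by
    rw [← mul_one' hδ (hy'.mul hg₀b), ← e, ← mul_assoc' hδ (hy'.mul hg₀b) hf (hg₀b.mul hy), e',
      one_mul' (hg₀b.mul hy)]
  exact ⟨_, _, hg₀b.mul hy, e, this ▸ e'⟩

end SkewLaurent
/-! ### Derivations of the ring of series -/

namespace SkewLaurent

variable {A : Type*} [Ring A] {δ : A →+ A}

section Derivation

variable {d : A →+ A} {w : A}

theorem ext_eq_sum {p : ℤ} {f : ℤ → A} (hf : BddDeg p f) {k : ℤ} {N : ℕ} (h : p < k + 1 + N) :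
    ext δ d w f k = d (f k) + ∑ i ∈ Finset.range N,
      Ring.choose (k + 1 + i) (i + 1) • (f (k + 1 + i) * δ^[i] w) := by
  rw [ext]
  congr 1
  refine finsum_eq_sum_of_support_subset _ fun i hi => ?_
  by_contra hN
  refine hi ?_
  have : N ≤ i := by simpa using hN
  simp only
  rw [hf _ (by omega), zero_mul, smul_zero]

theorem BddDeg.ext {p : ℤ} {f : ℤ → A} (hf : BddDeg p f) : BddDeg p (ext δ d w f) :=
  fun k hk => by
    rw [ext_eq_sum hf (N := 0) (by push_cast; omega), hf k hk]; simp

theorem ext_add {p : ℤ} {f g : ℤ → A} (hf : BddDeg p f) (hg : BddDeg p g) :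
    ext δ d w (f + g) = ext δ d w f + ext δ d w g := by
  funext k
  have h : p < k + 1 + ((p - k).toNat : ℕ) := by omega
  rw [Pi.add_apply, ext_eq_sum hf h, ext_eq_sum hg h, ext_eq_sum (hf.add hg) h,
    add_add_add_comm, ← Finset.sum_add_distrib]
  simp [add_mul]

theorem BddDeg.smul {p : ℤ} {f : ℤ → A} (hf : BddDeg p f) (a : A) : BddDeg p (a • f) :=
  hf.comp (φ := fun x => a * x) (mul_zero a)

theorem ext_smul (hd : ∀ a c, d (a * c) = d a * c + a * d c) (a : A) {p : ℤ} {f : ℤ → A}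
    (hf : BddDeg p f) : ext δ d w (a • f) = a • ext δ d w f + d a • f := by
  funext k
  have h : p < k + 1 + ((p - k).toNat : ℕ) := by omega
  rw [Pi.add_apply, Pi.smul_apply, ext_eq_sum hf h, ext_eq_sum (hf.smul a) h]
  simp only [Pi.smul_apply, smul_eq_mul, hd, mul_add, Finset.mul_sum, mul_assoc, mul_smul_comm]
  abel

/-- The extended derivation maps `u f` to `w f + u (ext f)`. -/
theorem ext_up (hδ : ∀ a c, δ (a * c) = δ a * c + a * δ c)
    (hw : ∀ a, d (δ a) - δ (d a) = w * a - a * w) {p : ℤ} {f : ℤ → A} (hf : BddDeg p f) :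
    ext δ d w (up δ f) = w • f + up δ (ext δ d w f) := by
  funext k
  set N := (p - k + 2).toNat with hN
  have h1 := ext_eq_sum (δ := δ) (d := d) (w := w) (hf.up (δ := δ)) (k := k) (N := N) (by omega)
  have h2 := ext_eq_sum (δ := δ) (d := d) (w := w) hf (k := k - 1) (N := N + 1)
    (by push_cast; omega)
  have h3 := ext_eq_sum (δ := δ) (d := d) (w := w) hf (k := k) (N := N) (by omega)
  rw [Pi.add_apply, up, h1, h2, h3, up, map_add, map_add, map_sum]
  have e1 : ∀ i : ℕ, Ring.choose (k + 1 + i) (i + 1) • (up δ f (k + 1 + i) * δ^[i] w) +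
      Ring.choose (k + 1 + i) (i + 1) • (f (k + 1 + i) * δ^[i + 1] w) =
      Ring.choose (k + 1 + i) (i + 1) • (f (k + i) * δ^[i] w) +
      δ (Ring.choose (k + 1 + i) (i + 1) • (f (k + 1 + i) * δ^[i] w)) := by
    intro i
    rw [up, map_zsmul, hδ, ← smul_add, ← smul_add, ← Function.iterate_succ_apply' (f := δ),
      show k + 1 + (i : ℤ) - 1 = k + i by ring, add_mul, add_assoc (f _ * _)]
  have e2 : ∀ i : ℕ, Ring.choose (k + 1 + i) (i + 1) • (f (k + i) * δ^[i] w) =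
      Ring.choose (k + i) i • (f (k + i) * δ^[i] w) +
      Ring.choose (k + i) (i + 1) • (f (k + i) * δ^[i] w) := by
    intro i
    rw [show k + 1 + (i : ℤ) = k + i + 1 by ring, Ring.choose_succ_succ, add_smul]
  have s1 : ∑ i ∈ Finset.range N, Ring.choose (k + i) i • (f (k + i) * δ^[i] w) =
      f k * w + ∑ i ∈ Finset.range N,
        Ring.choose (k + 1 + i) (i + 1) • (f (k + 1 + i) * δ^[i + 1] w) := by
    have z : Ring.choose (k + (N : ℤ)) N • (f (k + N) * δ^[N] w) = 0 := by
      rw [hf _ (by omega), zero_mul, smul_zero]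
    rw [← add_zero (∑ i ∈ Finset.range N, _), ← z, ← Finset.sum_range_succ
      (fun i : ℕ => Ring.choose (k + (i : ℤ)) i • (f (k + i) * δ^[i] w)), Finset.sum_range_succ']
    simp only [Nat.cast_zero, add_zero, Ring.choose_zero_right, one_smul, Function.iterate_zero,
      id_eq, Nat.cast_succ]
    rw [add_comm]
    congr 1
    refine Finset.sum_congr rfl fun i _ => ?_
    rw [show k + ((i : ℤ) + 1) = k + 1 + i by ring]
  have s2 : ∑ i ∈ Finset.range (N + 1),
      Ring.choose (k - 1 + 1 + i) (i + 1) • (f (k - 1 + 1 + i) * δ^[i] w) =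
      ∑ i ∈ Finset.range N, Ring.choose (k + i) (i + 1) • (f (k + i) * δ^[i] w) := by
    rw [Finset.sum_range_succ, sub_add_cancel, hf (k + N) (by omega), zero_mul, smul_zero,
      add_zero]
  have s3 : ∑ i ∈ Finset.range N, Ring.choose (k + 1 + i) (i + 1) • (up δ f (k + 1 + i) * δ^[i] w) =
      f k * w + ∑ i ∈ Finset.range N, Ring.choose (k + i) (i + 1) • (f (k + i) * δ^[i] w) +
      ∑ i ∈ Finset.range N,
        δ (Ring.choose (k + 1 + i) (i + 1) • (f (k + 1 + i) * δ^[i] w)) := by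
    have := Finset.sum_congr (rfl : Finset.range N = _) fun i _ => e1 i
    rw [Finset.sum_add_distrib, Finset.sum_add_distrib,
      Finset.sum_congr rfl fun i _ => e2 i, Finset.sum_add_distrib, s1] at this
    rw [← add_right_cancel_iff (a := ∑ i ∈ Finset.range N,
        Ring.choose (k + 1 + i) (i + 1) • (f (k + 1 + i) * δ^[i + 1] w)), this]
    abel
  rw [s2, s3, Pi.smul_apply, smul_eq_mul, sub_eq_iff_eq_add.1 (hw (f k))]
  abel

/-- Leibniz' rule for the extended derivation. -/
theorem ext_mul (hδ : ∀ a c, δ (a * c) = δ a * c + a * δ c)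
    (hd : ∀ a c, d (a * c) = d a * c + a * d c)
    (hw : ∀ a, d (δ a) - δ (d a) = w * a - a * w) {p r : ℤ} {f g : ℤ → A}
    (hf : BddDeg p f) (hg : BddDeg r g) :
    ext δ d w (mul δ f g) = mul δ (ext δ d w f) g + mul δ f (ext δ d w g) := by
  have one : ∀ n, BddDeg n (Pi.single n 1 : ℤ → A) := fun n => bddDeg_single n 1
  have d1 := map_one_eq_zero hd
  have upone : ∀ n, up δ (Pi.single n 1) = Pi.single (n + 1) 1 := fun n => by
    rw [up_single, map_one_eq_zero hδ, Pi.single_zero, add_zero]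
  have pow : ∀ n : ℤ, ext δ d w (twist δ n g) =
      mul δ (ext δ d w (Pi.single n 1)) g + twist δ n (ext δ d w g) := by
    -- the identities for `n` and `n + 1` are equivalent
    have step : ∀ n : ℤ, ext δ d w (twist δ (n + 1) g) -
        (mul δ (ext δ d w (Pi.single (n + 1) 1)) g + twist δ (n + 1) (ext δ d w g)) =
        up δ (ext δ d w (twist δ n g)) -
          up δ (mul δ (ext δ d w (Pi.single n 1)) g + twist δ n (ext δ d w g)) := by
      intro n
      rw [twist_succ hg, ext_up hδ hw (hg.twist n), ← upone, ext_up hδ hw (one n),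
        mul_add_left (((one n).smul w).mono (Int.le_add_one le_rfl)) (one n).ext.up hg,
        mul_smul_left w (one n) hg, up_mul hδ (one n).ext hg, twist_succ hg.ext, up_add,
        single_mul n 1 hg, one_smul]
      abel
    intro n
    induction n with
    | zero =>
      have : ext δ d w (Pi.single 0 1) = 0 := by
        funext k
        rw [ext, finsum_eq_zero_of_forall_eq_zero]
        · rw [Pi.single_apply]; split_ifs <;> simp [d1]
        · intro i
          rcases eq_or_ne (k + 1 + i) 0 with h | h
          · rw [h, Ring.choose_zero_succ, zero_smul]
          · rw [Pi.single_eq_of_ne h, zero_mul, smul_zero]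
      have z : mul δ 0 g = 0 := by funext k; simp [mul]
      rw [twist_zero, twist_zero, this, z, zero_add]
    | succ i ih =>
      rw [← sub_eq_zero, step, ih, sub_self]
    | pred i ih =>
      have b1 : BddDeg (max (r + (-i - 1)) (-i - 1 + r))
          (mul δ (ext δ d w (Pi.single (-i - 1) 1)) g + twist δ (-i - 1) (ext δ d w g)) :=
        (((one _).ext.mul hg).mono (by omega)).add ((hg.ext.twist _).mono (by omega))
      refine up_injective (δ := δ) (hg.twist _).ext b1 ?_
      have := step (-i - 1)
      rw [sub_add_cancel, ih, sub_self] at this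
      exact (sub_eq_zero.1 this.symm)
  refine sub_eq_zero.1 (eq_zero_of_monomials (fun f => ext δ d w (mul δ f g) -
    (mul δ (ext δ d w f) g + mul δ f (ext δ d w g))) r ?_ ?_ ?_ hf)
  · intro p f f' hf hf'
    rw [mul_add_left hf hf' hg, ext_add (hf.mul hg) (hf'.mul hg), ext_add hf hf',
      mul_add_left hf.ext hf'.ext hg, mul_add_left hf hf' hg.ext]
    abel
  · intro n a
    have e : (Pi.single n a : ℤ → A) = a • Pi.single n 1 := by
      rw [← Pi.single_smul, smul_eq_mul, mul_one]
    rw [single_mul n a hg, single_mul n a hg.ext, ext_smul hd a (hg.twist n), pow, e,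
      ext_smul hd a (one n), mul_add_left ((one n).ext.smul a) ((one n).smul _) hg,
      mul_smul_left a (one n).ext hg, mul_smul_left _ (one n) hg, single_mul n 1 hg, one_smul,
      smul_add]
    abel
  · intro p f hf
    exact (hf.mul hg).ext.sub ((hf.ext.mul hg).add (hf.mul hg.ext))

/-- Extended derivations map a coefficient to its derivative. -/
theorem ext_single_zero (a : A) : ext δ d w (Pi.single 0 a) = Pi.single 0 (d a) := by
  funext k
  rw [ext, finsum_eq_zero_of_forall_eq_zero]
  · rw [Pi.single_apply, Pi.single_apply]; split_ifs <;> simp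
  · intro i
    rcases eq_or_ne (k + 1 + i) 0 with h | h
    · rw [h, Ring.choose_zero_succ, zero_smul]
    · rw [Pi.single_eq_of_ne h, zero_mul, smul_zero]

theorem ext_single_one (hδ : ∀ a c, δ (a * c) = δ a * c + a * δ c)
    (hd : ∀ a c, d (a * c) = d a * c + a * d c)
    (hw : ∀ a, d (δ a) - δ (d a) = w * a - a * w) :
    ext δ d w (Pi.single 1 1) = Pi.single 0 w := by
  have e : up δ (Pi.single 0 1) = Pi.single 1 1 := by
    rw [up_single, map_one_eq_zero hδ, Pi.single_zero, add_zero, zero_add]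
  rw [← e, ext_up hδ hw (bddDeg_single 0 1), ext_single_zero, map_one_eq_zero hd,
    Pi.single_zero]
  funext k
  simp [up, Pi.single_apply]

end Derivation

/-- A derivation of the ring of series which does not raise degrees, and which kills the
coefficients and `u`, is zero. -/
theorem derivation_eq_zero (hδ : ∀ a c, δ (a * c) = δ a * c + a * δ c)
    (Λ : (ℤ → A) → ℤ → A) (c : ℤ)
    (hadd : ∀ p f g, BddDeg p f → BddDeg p g → Λ (f + g) = Λ f + Λ g)
    (hb : ∀ p f, BddDeg p f → BddDeg (p + c) (Λ f))
    (hmul : ∀ p r f g, BddDeg p f → BddDeg r g → Λ (mul δ f g) = mul δ (Λ f) g + mul δ f (Λ g))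
    (h0 : ∀ a, Λ (Pi.single 0 a) = 0) (h1 : Λ (Pi.single 1 1) = 0) {p : ℤ} {f : ℤ → A}
    (hf : BddDeg p f) : Λ f = 0 := by
  have z : ∀ g, mul δ 0 g = 0 := fun g => by funext k; simp [mul]
  have one : ∀ n, BddDeg n (Pi.single n 1 : ℤ → A) := fun n => bddDeg_single n 1
  have upone : ∀ n, up δ (Pi.single n 1) = Pi.single (n + 1) 1 := fun n => by
    rw [up_single, map_one_eq_zero hδ, Pi.single_zero, add_zero]
  have hup : ∀ n : ℤ, Λ (Pi.single (n + 1) 1) = up δ (Λ (Pi.single n 1)) := fun n => by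
    rw [← upone, ← twist_one (one n), ← one_smul A (twist δ 1 _), ← single_mul 1 1 (one n),
      hmul _ _ _ _ (one 1) (one n), h1, z, zero_add, single_mul 1 1 (hb _ _ (one n)), one_smul,
      twist_one (hb _ _ (one n))]
  have pow : ∀ n : ℤ, Λ (Pi.single n 1) = 0 := by
    have u0 : up δ (0 : ℤ → A) = 0 := by funext k; simp [up]
    intro n
    induction n with
    | zero => exact h0 1
    | succ i ih => rw [hup, ih, u0]
    | pred i ih =>
      have := hup (-i - 1)
      rw [sub_add_cancel, ih] at this
      refine up_injective (δ := δ) (hb _ _ (one _)) (s := 0) (fun _ _ => rfl) ?_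
      rw [← this, u0]
  refine eq_zero_of_monomials Λ c hadd (fun n a => ?_) hb hf
  have e : (Pi.single n a : ℤ → A) = mul δ (Pi.single 0 a) (Pi.single n 1) := by
    rw [single_mul 0 a (one n), twist_zero, ← Pi.single_smul, smul_eq_mul, mul_one]
  rw [e, hmul _ _ _ _ (bddDeg_single 0 a) (one n), h0, z, pow, zero_add]
  funext k
  simp [mul]

theorem finite_support_mul {p r : ℤ} {f g : ℤ → A} (hf : BddDeg p f) (hg : BddDeg r g) (k : ℤ) :
    (Function.support fun q : ℤ × ℕ =>
      Ring.choose q.1 q.2 • (f q.1 * δ^[q.2] (g (k - q.1 + q.2)))).Finite := by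
  refine (Finset.Icc (k - r) p ×ˢ Finset.range (p + r - k + 1).toNat).finite_toSet.subset
    fun q hq => ?_
  by_contra hN
  refine hq ?_
  simp only
  by_cases h1 : p < q.1
  · rw [hf _ h1, zero_mul, smul_zero]
  · rw [hg, iterate_map_zero, mul_zero, smul_zero]
    by_contra h2
    refine hN ?_
    simp only [Finset.coe_product, Set.mem_prod, Finset.coe_Icc, Set.mem_Icc, Finset.coe_range,
      Set.mem_Iio]
    omega

theorem finite_support_ext {p : ℤ} {f : ℤ → A} (hf : BddDeg p f) (w : A) (k : ℤ) :
    (Function.support fun i : ℕ =>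
      Ring.choose (k + 1 + i) (i + 1) • (f (k + 1 + i) * δ^[i] w)).Finite := by
  refine (Finset.range (p - k).toNat).finite_toSet.subset fun i hi => ?_
  by_contra hN
  refine hi ?_
  have : (p - k).toNat ≤ i := by simpa using hN
  simp only
  rw [hf _ (by omega), zero_mul, smul_zero]

theorem mul_neg_left (f g : ℤ → A) : mul δ (-f) g = -mul δ f g := by
  funext k
  simp only [mul, Pi.neg_apply, neg_mul, smul_neg]
  rw [finsum_neg_distrib]

theorem mul_neg_right (f g : ℤ → A) : mul δ f (-g) = -mul δ f g := by
  funext k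
  simp only [mul, Pi.neg_apply, iterate_map_neg, mul_neg, smul_neg]
  rw [finsum_neg_distrib]

/-- Coefficients that commute with everything, and that `δ` kills, are central in the ring of
series. -/
theorem mul_smul_right {a : A} (ha : ∀ x, a * x = x * a) (hδ : ∀ a c, δ (a * c) = δ a * c + a * δ c)
    (h0 : δ a = 0) {p r : ℤ} {f g : ℤ → A} (hf : BddDeg p f) (hg : BddDeg r g) :
    mul δ f (a • g) = a • mul δ f g := by
  have hi : ∀ (i : ℕ) (x : A), δ^[i] (a * x) = a * δ^[i] x := fun i x => by
    induction i generalizing x with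
    | zero => rfl
    | succ i ih => simp only [Function.iterate_succ_apply, hδ, h0, zero_mul, zero_add, ih]
  funext k
  rw [Pi.smul_apply, mul_eq_sum hf hg le_rfl le_rfl, mul_eq_sum hf (hg.smul a) le_rfl le_rfl,
    Finset.smul_sum]
  refine Finset.sum_congr rfl fun n _ => ?_
  have e : twist δ n (a • g) k = a * twist δ n g k := by
    rw [twist_eq_sum hg (N := (r - k + n + 1).toNat) (by omega),
      twist_eq_sum (hg.smul a) (N := (r - k + n + 1).toNat) (by omega), Finset.mul_sum]
    refine Finset.sum_congr rfl fun i _ => ?_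
    rw [Pi.smul_apply, smul_eq_mul, hi, mul_smul_comm]
  rw [e, ← mul_assoc, ← ha, smul_eq_mul, mul_assoc]

section Derivation

variable {d d₁ d₂ d₃ : A →+ A} {w w₁ w₂ w₃ : A}

theorem ext_add_left {p : ℤ} {f : ℤ → A} (hf : BddDeg p f) (h : ∀ a, d₃ a = d₁ a + d₂ a)
    (hw : w₃ = w₁ + w₂) : ext δ d₃ w₃ f = ext δ d₁ w₁ f + ext δ d₂ w₂ f := by
  funext k
  have hN : p < k + 1 + ((p - k).toNat : ℕ) := by omega
  rw [Pi.add_apply, ext_eq_sum hf hN, ext_eq_sum hf hN, ext_eq_sum hf hN, h, hw,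
    add_add_add_comm, ← Finset.sum_add_distrib]
  simp [iterate_map_add, mul_add]

theorem ext_smul_left {a : A} (ha : ∀ x, a * x = x * a)
    (hδ : ∀ a c, δ (a * c) = δ a * c + a * δ c) (h0 : δ a = 0) {p : ℤ} {f : ℤ → A}
    (hf : BddDeg p f) (h : ∀ x, d₁ x = a * d x) (hw : w₁ = a * w) :
    ext δ d₁ w₁ f = a • ext δ d w f := by
  have hi : ∀ (i : ℕ) (x : A), δ^[i] (a * x) = a * δ^[i] x := fun i x => by
    induction i generalizing x with
    | zero => rfl
    | succ i ih => simp only [Function.iterate_succ_apply, hδ, h0, zero_mul, zero_add, ih]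
  funext k
  have hN : p < k + 1 + ((p - k).toNat : ℕ) := by omega
  rw [Pi.smul_apply, ext_eq_sum hf hN, ext_eq_sum hf hN, h, hw, smul_add, Finset.smul_sum]
  congr 1
  refine Finset.sum_congr rfl fun i _ => ?_
  rw [hi, ← mul_assoc, ← ha, smul_eq_mul, mul_smul_comm, mul_assoc]

/-- The commutator with a series is a derivation. -/
theorem commutator_mul (hδ : ∀ a c, δ (a * c) = δ a * c + a * δ c) {p q r : ℤ} {y f g : ℤ → A}
    (hy : BddDeg p y) (hf : BddDeg q f) (hg : BddDeg r g) :
    mul δ y (mul δ f g) - mul δ (mul δ f g) y =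
      mul δ (mul δ y f - mul δ f y) g + mul δ f (mul δ y g - mul δ g y) := by
  have b1 : BddDeg (p + q) (-mul δ f y) := ((hf.mul hy).mono (by omega)).neg
  have b2 : BddDeg (p + r) (-mul δ g y) := ((hg.mul hy).mono (by omega)).neg
  rw [sub_eq_add_neg (mul δ y f), sub_eq_add_neg (mul δ y g), mul_add_left (hy.mul hf) b1 hg,
    mul_add_right hf (hy.mul hg) b2, mul_neg_left, mul_neg_right, mul_assoc' hδ hy hf hg,
    mul_assoc' hδ hf hy hg, mul_assoc' hδ hf hg hy]
  abel

theorem commutator_add {p q : ℤ} {y f g : ℤ → A} (hy : BddDeg p y) (hf : BddDeg q f)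
    (hg : BddDeg q g) : mul δ y (f + g) - mul δ (f + g) y =
      (mul δ y f - mul δ f y) + (mul δ y g - mul δ g y) := by
  rw [mul_add_right hy hf hg, mul_add_left hf hg hy]
  abel

theorem BddDeg.commutator {p q : ℤ} {y f : ℤ → A} (hy : BddDeg p y) (hf : BddDeg q f) :
    BddDeg (q + p) (SkewLaurent.mul δ y f - SkewLaurent.mul δ f y) :=
  ((hy.mul hf).mono (by omega)).sub (hf.mul hy)

/-- An extended derivation which agrees with the commutator with a series `y` on the coefficients
and on `u` is this commutator. -/
theorem ext_eq_commutator (hδ : ∀ a c, δ (a * c) = δ a * c + a * δ c)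
    (hd : ∀ a c, d (a * c) = d a * c + a * d c)
    (hw : ∀ a, d (δ a) - δ (d a) = w * a - a * w) {q : ℤ} {y : ℤ → A} (hy : BddDeg q y)
    (h0 : ∀ a, Pi.single 0 (d a) = mul δ y (Pi.single 0 a) - mul δ (Pi.single 0 a) y)
    (h1 : Pi.single 0 w = mul δ y (Pi.single 1 1) - mul δ (Pi.single 1 1) y)
    {p : ℤ} {f : ℤ → A} (hf : BddDeg p f) :
    ext δ d w f = mul δ y f - mul δ f y := by
  refine sub_eq_zero.1 (derivation_eq_zero hδ
    (fun f => ext δ d w f - (mul δ y f - mul δ f y)) (max 0 q) ?_ ?_ ?_ ?_ ?_ hf)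
  · intro p f g hf hg
    rw [ext_add hf hg, commutator_add hy hf hg]
    abel
  · intro p f hf
    exact (hf.ext.mono (by omega)).sub ((hy.commutator hf).mono (by omega))
  · intro p r f g hf hg
    have b1 := (hy.commutator (δ := δ) hf).neg.mono (q := max p (p + q)) (by omega)
    have b2 := (hy.commutator (δ := δ) hg).neg.mono (q := max r (r + q)) (by omega)
    rw [ext_mul hδ hd hw hf hg, commutator_mul hδ hy hf hg, sub_eq_add_neg (ext δ d w f),
      sub_eq_add_neg (ext δ d w g), mul_add_left (hf.ext.mono (by omega)) b1 hg,
      mul_add_right hf (hg.ext.mono (by omega)) b2, mul_neg_left, mul_neg_right]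
    abel
  · intro a
    rw [ext_single_zero, h0, sub_self]
  · rw [ext_single_one hδ hd hw, h1, sub_self]

/-- Commutators of extended derivations. -/
theorem ext_comm (hδ : ∀ a c, δ (a * c) = δ a * c + a * δ c)
    (hd₁ : ∀ a c, d₁ (a * c) = d₁ a * c + a * d₁ c)
    (hw₁ : ∀ a, d₁ (δ a) - δ (d₁ a) = w₁ * a - a * w₁)
    (hd₂ : ∀ a c, d₂ (a * c) = d₂ a * c + a * d₂ c)
    (hw₂ : ∀ a, d₂ (δ a) - δ (d₂ a) = w₂ * a - a * w₂)
    (hd₃ : ∀ a c, d₃ (a * c) = d₃ a * c + a * d₃ c)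
    (hw₃ : ∀ a, d₃ (δ a) - δ (d₃ a) = w₃ * a - a * w₃) {t : A}
    (h0 : ∀ a, d₁ (d₂ a) - d₂ (d₁ a) = d₃ a + (t * a - a * t))
    (h1 : d₁ w₂ - d₂ w₁ = w₃ - δ t) {p : ℤ} {f : ℤ → A} (hf : BddDeg p f) :
    ext δ d₁ w₁ (ext δ d₂ w₂ f) - ext δ d₂ w₂ (ext δ d₁ w₁ f) =
      ext δ d₃ w₃ f + (mul δ (Pi.single 0 t) f - mul δ f (Pi.single 0 t)) := by
  have ht : BddDeg 0 (Pi.single 0 t : ℤ → A) := bddDeg_single 0 t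
  have hE : ∀ {p f}, BddDeg p f → BddDeg p (ext δ d₃ w₃ f +
      (mul δ (Pi.single 0 t) f - mul δ f (Pi.single 0 t))) := fun hf =>
    hf.ext.add ((ht.commutator hf).mono (by omega))
  have hB : ∀ {p f}, BddDeg p f → BddDeg p
      (ext δ d₁ w₁ (ext δ d₂ w₂ f) - ext δ d₂ w₂ (ext δ d₁ w₁ f)) := fun hf =>
    hf.ext.ext.sub hf.ext.ext
  refine sub_eq_zero.1 (derivation_eq_zero hδ (fun f =>
    (ext δ d₁ w₁ (ext δ d₂ w₂ f) - ext δ d₂ w₂ (ext δ d₁ w₁ f)) -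
      (ext δ d₃ w₃ f + (mul δ (Pi.single 0 t) f - mul δ f (Pi.single 0 t)))) 0
    ?_ ?_ ?_ ?_ ?_ hf)
  · intro p f g hf hg
    rw [ext_add hf hg, ext_add hf hg, ext_add hf hg, ext_add hf.ext hg.ext,
      ext_add hf.ext hg.ext, commutator_add ht hf hg]
    abel
  · intro p f hf
    rw [add_zero]
    exact (hB hf).sub (hE hf)
  · intro p r f g hf hg
    have e1 : ext δ d₁ w₁ (ext δ d₂ w₂ (mul δ f g)) - ext δ d₂ w₂ (ext δ d₁ w₁ (mul δ f g)) =
        mul δ (ext δ d₁ w₁ (ext δ d₂ w₂ f) - ext δ d₂ w₂ (ext δ d₁ w₁ f)) g +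
        mul δ f (ext δ d₁ w₁ (ext δ d₂ w₂ g) - ext δ d₂ w₂ (ext δ d₁ w₁ g)) := by
      rw [ext_mul hδ hd₂ hw₂ hf hg, ext_mul hδ hd₁ hw₁ hf hg,
        ext_add (hf.ext.mul hg) (hf.mul hg.ext), ext_add (hf.ext.mul hg) (hf.mul hg.ext),
        ext_mul hδ hd₁ hw₁ hf.ext hg, ext_mul hδ hd₁ hw₁ hf hg.ext,
        ext_mul hδ hd₂ hw₂ hf.ext hg, ext_mul hδ hd₂ hw₂ hf hg.ext,
        sub_eq_add_neg (ext δ d₁ w₁ (ext δ d₂ w₂ f)), sub_eq_add_neg (ext δ d₁ w₁ (ext δ d₂ w₂ g)),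
        mul_add_left hf.ext.ext hf.ext.ext.neg hg, mul_add_right hf hg.ext.ext hg.ext.ext.neg,
        mul_neg_left, mul_neg_right]
      abel
    have e2 : ext δ d₃ w₃ (mul δ f g) +
        (mul δ (Pi.single 0 t) (mul δ f g) - mul δ (mul δ f g) (Pi.single 0 t)) =
        mul δ (ext δ d₃ w₃ f + (mul δ (Pi.single 0 t) f - mul δ f (Pi.single 0 t))) g +
        mul δ f (ext δ d₃ w₃ g + (mul δ (Pi.single 0 t) g - mul δ g (Pi.single 0 t))) := by
      rw [ext_mul hδ hd₃ hw₃ hf hg, commutator_mul hδ ht hf hg,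
        mul_add_left hf.ext ((ht.commutator hf).mono (by omega)) hg,
        mul_add_right hf hg.ext ((ht.commutator hg).mono (by omega))]
      abel
    rw [e1, e2, sub_eq_add_neg (ext δ d₁ w₁ (ext δ d₂ w₂ f) - _),
      sub_eq_add_neg (ext δ d₁ w₁ (ext δ d₂ w₂ g) - _), mul_add_left (hB hf) (hE hf).neg hg,
      mul_add_right hf (hB hg) (hE hg).neg, mul_neg_left, mul_neg_right]
    abel
  · intro a
    rw [ext_single_zero, ext_single_zero, ext_single_zero, ext_single_zero, ext_single_zero,
      single_mul 0 t (bddDeg_single 0 a), single_mul 0 a ht, twist_zero, twist_zero,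
      ← Pi.single_smul, ← Pi.single_smul, ← Pi.single_sub, ← Pi.single_sub, ← Pi.single_add,
      ← Pi.single_sub, h0, smul_eq_mul, smul_eq_mul, sub_self, Pi.single_zero]
  · rw [ext_single_one hδ hd₁ hw₁, ext_single_one hδ hd₂ hw₂, ext_single_one hδ hd₃ hw₃,
      ext_single_zero, ext_single_zero, single_mul 0 t (bddDeg_single 1 1), twist_zero,
      single_mul 1 1 ht, one_smul, twist_one ht, up_single, ← Pi.single_smul, smul_eq_mul,
      mul_one, zero_add, sub_add_cancel_left, ← Pi.single_neg, ← Pi.single_add, ← Pi.single_sub,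
      ← Pi.single_sub, h1, ← sub_eq_add_neg, sub_self, Pi.single_zero]

end Derivation

end SkewLaurent
noncomputable section

open Module

/-! ### Standard monomials and expansions -/

theorem stdMonomial_zero {ι S : Type*} [LinearOrder ι] [Ring S] (x : ι → S) :
    stdMonomial x 0 = 1 := by
  simp [stdMonomial]

theorem stdMonomial_single {ι S : Type*} [LinearOrder ι] [Ring S] (x : ι → S) (c : ι) (n : ℕ) :
    stdMonomial x (Finsupp.single c n) = x c ^ n := by
  rcases eq_or_ne n 0 with rfl | hn
  · simp [stdMonomial_zero]
  · simp [stdMonomial, Finsupp.support_single, hn]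

theorem stdMonomial_add {ι S : Type*} [LinearOrder ι] [Ring S] (x : ι → S) {e₁ e₂ : ι →₀ ℕ}
    (h : ∀ c ∈ e₁.support, ∀ d ∈ e₂.support, c < d) :
    stdMonomial x (e₁ + e₂) = stdMonomial x e₁ * stdMonomial x e₂ := by
  have hd : Disjoint e₁.support e₂.support :=
    Finset.disjoint_left.2 fun c h1 h2 => lt_irrefl c (h c h1 c h2)
  have hs : (e₁ + e₂).support.sort (· ≤ ·) =
      e₁.support.sort (· ≤ ·) ++ e₂.support.sort (· ≤ ·) := by
    refine List.Perm.eq_of_pairwise' (r := (· ≤ ·)) (Finset.pairwise_sort _ _) ?_ ?_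
    · rw [List.pairwise_append]
      exact ⟨Finset.pairwise_sort _ _, Finset.pairwise_sort _ _, fun c hc d hd =>
        (h c ((Finset.mem_sort _).1 hc) d ((Finset.mem_sort _).1 hd)).le⟩
    · rw [← Multiset.coe_eq_coe, ← Multiset.coe_add, Finset.sort_eq, Finset.sort_eq,
        Finset.sort_eq, Finsupp.support_add_eq hd, ← Finset.disjUnion_eq_union _ _ hd,
        Finset.disjUnion_val]
  rw [stdMonomial, hs, List.map_append, List.prod_append, stdMonomial, stdMonomial]
  congr 2
  · refine List.map_congr_left fun c hc => ?_
    rw [Finset.mem_sort] at hc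
    rw [Finsupp.add_apply, Finsupp.notMem_support_iff.1 (Finset.disjoint_left.1 hd hc), add_zero]
  · refine List.map_congr_left fun c hc => ?_
    rw [Finset.mem_sort] at hc
    rw [Finsupp.add_apply, Finsupp.notMem_support_iff.1 (Finset.disjoint_right.1 hd hc), zero_add]

namespace CrossedProduct

section

variable {C : Type*}

/-- Natural exponents as integral ones. -/
def natExp (e : C →₀ ℕ) : C →₀ ℤ := e.mapRange Nat.cast Nat.cast_zero

@[simp] theorem natExp_apply (e : C →₀ ℕ) (c : C) : natExp e c = e c := rfl

theorem natExp_add (e e' : C →₀ ℕ) : natExp (e + e') = natExp e + natExp e' := by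
  ext c; simp

theorem natExp_single (c : C) (n : ℕ) : natExp (Finsupp.single c n) = Finsupp.single c (n : ℤ) := by
  simp [natExp]

theorem natExp_injective : Function.Injective (natExp : (C →₀ ℕ) → C →₀ ℤ) := fun e e' h => by
  ext c
  have := DFunLike.congr_fun h c
  simpa using this

/-- The exponents in the variables `V` of degree at most `n`. -/
def expLE (V : Set C) (n : ℕ) : Set (C →₀ ℕ) := {e | (∀ c ∈ e.support, c ∈ V) ∧ e.degree ≤ n}

theorem expLE_mono {V : Set C} {n m : ℕ} (h : n ≤ m) : expLE V n ⊆ expLE V m :=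
  fun _ he => ⟨he.1, he.2.trans h⟩

end

variable {k : Type v} {K : Type w} {H C : Type u} {S : Type w'}
  [Field k] [DivisionRing K] [Algebra k K] [LieRing H] [LieAlgebra k H] [Ring S] [Algebra k S]
  [LinearOrder C] (P : CrossedProduct k K H S) (b : Basis C k H)

/-- The linear combination of standard monomials with the given left coefficients. -/
def eval : ((C →₀ ℕ) →₀ K) →+ S :=
  Finsupp.liftAddHom fun e => (AddMonoidHom.mulRight (P.mon b e)).comp
    (P.coeff : K →+* S).toAddMonoidHom

/-- The coordinates of an element of `K * U(H)` in the basis of standard monomials. -/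
def coord : S ≃+ ((C →₀ ℕ) →₀ K) :=
  (AddEquiv.ofBijective (P.eval b) (P.free C b)).symm

theorem coord_mon (a : K) (e : C →₀ ℕ) :
    P.coord b (P.coeff a * P.mon b e) = Finsupp.single e a := by
  rw [coord, AddEquiv.symm_apply_eq]
  simp [eval]

theorem surjInv_eq (s : S) : Function.surjInv (P.free C b).surjective s = P.coord b s := by
  rw [coord, AddEquiv.eq_symm_apply]
  exact Function.surjInv_eq (P.free C b).surjective s

theorem expand_apply (s : S) (e : C →₀ ℤ) [Decidable (0 ≤ e)] : P.expand b s e =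
    if 0 ≤ e then P.coord b s (e.mapRange Int.toNat Int.toNat_zero) else 0 := by
  rw [expand, surjInv_eq]
  congr

theorem expand_natExp (s : S) (e : C →₀ ℕ) : P.expand b s (natExp e) = P.coord b s e := by
  classical
  rw [expand_apply, if_pos]
  · congr 1
    ext c; simp
  · intro c; simp

theorem expand_ne_zero {s : S} {e : C →₀ ℤ} (h : P.expand b s e ≠ 0) :
    ∃ e', e = natExp e' ∧ P.coord b s e' ≠ 0 := by
  classical
  rw [expand_apply] at h
  split_ifs at h with h0
  · refine ⟨_, ?_, h⟩
    ext c
    have := h0 c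
    simp only [Finsupp.coe_zero, Pi.zero_apply] at this
    simp [this]
  · exact absurd rfl h

theorem expand_injective : Function.Injective (P.expand b) := fun s s' h => by
  refine (P.coord b).injective (Finsupp.ext fun e => ?_)
  rw [← expand_natExp, ← expand_natExp, h]

theorem expand_add (s s' : S) : P.expand b (s + s') = P.expand b s + P.expand b s' := by
  classical
  funext e
  rw [Pi.add_apply, expand_apply, expand_apply, expand_apply, map_add]
  split_ifs <;> simp

/-- The expansion in standard monomials as an additive map. -/
def expandHom : S →+ P.Formal b where
  toFun := P.expand b
  map_zero' := by
    have := expand_add P b 0 0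
    rwa [add_zero, left_eq_add] at this
  map_add' := P.expand_add b

theorem expand_zero : P.expand b 0 = 0 := (P.expandHom b).map_zero

theorem expand_neg (s : S) : P.expand b (-s) = -P.expand b s := (P.expandHom b).map_neg s

theorem expand_sub (s s' : S) : P.expand b (s - s') = P.expand b s - P.expand b s' :=
  (P.expandHom b).map_sub s s'

theorem expand_mon (a : K) (e : C →₀ ℕ) :
    P.expand b (P.coeff a * P.mon b e) = Pi.single (natExp e) a := by
  funext e'
  by_cases h : P.expand b (P.coeff a * P.mon b e) e' = 0
  · rcases eq_or_ne e' (natExp e) with rfl | h'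
    · rw [expand_natExp, coord_mon, Finsupp.single_eq_same] at h
      simp [h, expand_natExp]
    · rw [h, Pi.single_eq_of_ne h']
  · obtain ⟨e'', rfl, h'⟩ := P.expand_ne_zero b h
    rw [expand_natExp, coord_mon, Finsupp.single_apply, Pi.single_apply]
    simp only [natExp_injective.eq_iff, eq_comm]

/-- The combinations of the standard monomials with exponents in `E`. -/
def monSpan (E : Set (C →₀ ℕ)) : AddSubgroup S where
  carrier := {s | ∀ e, P.coord b s e ≠ 0 → e ∈ E}
  zero_mem' := by intro e he; simp at he
  add_mem' := by
    intro s s' hs hs' e he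
    rw [map_add, Finsupp.add_apply] at he
    by_cases h : P.coord b s e = 0
    · exact hs' e (by simpa [h] using he)
    · exact hs e h
  neg_mem' := by
    intro s hs e he
    exact hs e (by simpa using he)

variable {b}

theorem mon_mem_monSpan {E : Set (C →₀ ℕ)} {e : C →₀ ℕ} (he : e ∈ E) (a : K) :
    P.coeff a * P.mon b e ∈ P.monSpan b E := by
  intro e' he'
  rw [coord_mon, Finsupp.single_apply] at he'
  split_ifs at he' with h
  · exact h ▸ he
  · exact absurd rfl he'

theorem monSpan_mono {E E' : Set (C →₀ ℕ)} (h : E ⊆ E') : P.monSpan b E ≤ P.monSpan b E' :=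
  fun _ hs e he => h (hs e he)

/-- Additive properties of combinations of standard monomials need only be checked on the terms. -/
theorem monSpan_le {E : Set (C →₀ ℕ)} {Y : AddSubgroup S}
    (h : ∀ e ∈ E, ∀ a, P.coeff a * P.mon b e ∈ Y) : P.monSpan b E ≤ Y := by
  intro s hs
  have e : s = (P.coord b s).sum fun e a => P.coeff a * P.mon b e :=
    ((P.coord b).symm_apply_apply s).symm
  rw [e]
  exact Y.sum_mem fun e he => h e (hs e (Finsupp.mem_support_iff.1 he)) _

theorem mem_monSpan_univ (s : S) : s ∈ P.monSpan b Set.univ := fun _ _ => trivial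

theorem coeff_mul_mem_monSpan {E : Set (C →₀ ℕ)} (a : K) {s : S} (hs : s ∈ P.monSpan b E) :
    P.coeff a * s ∈ P.monSpan b E := by
  refine P.monSpan_le (Y := (P.monSpan b E).comap (AddMonoidHom.mulLeft (P.coeff a))) ?_ hs
  intro e he a'
  rw [AddSubgroup.mem_comap, AddMonoidHom.coe_mulLeft, ← mul_assoc, ← map_mul]
  exact P.mon_mem_monSpan he _

theorem smul_mem_monSpan {E : Set (C →₀ ℕ)} (α : k) {s : S} (hs : s ∈ P.monSpan b E) :
    α • s ∈ P.monSpan b E := by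
  rw [Algebra.smul_def, ← P.coeff.commutes]
  exact P.coeff_mul_mem_monSpan _ hs

theorem mon_zero : P.mon b 0 = 1 := stdMonomial_zero _

theorem mon_single (c : C) (n : ℕ) : P.mon b (Finsupp.single c n) = P.bar (b c) ^ n :=
  stdMonomial_single _ c n

theorem mon_add {e₁ e₂ : C →₀ ℕ} (h : ∀ c ∈ e₁.support, ∀ d ∈ e₂.support, c < d) :
    P.mon b (e₁ + e₂) = P.mon b e₁ * P.mon b e₂ :=
  stdMonomial_add _ h

theorem expand_coeff (a : K) : P.expand b (P.coeff a) = Pi.single 0 a := by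
  have := P.expand_mon b a 0
  rw [mon_zero, mul_one] at this
  rw [this]; congr 1

theorem expand_one : P.expand b 1 = Pi.single 0 1 := by
  rw [← map_one P.coeff, expand_coeff]

theorem expand_smul (α : k) (s : S) : P.expand b (α • s) = α • P.expand b s := by
  have h : s ∈ P.monSpan b Set.univ := P.mem_monSpan_univ s
  let Y : AddSubgroup S :=
    { carrier := {s | P.expand b (α • s) = α • P.expand b s}
      zero_mem' := by simp [expand_zero]
      add_mem' := by
        intro x y hx hy
        simp only [Set.mem_ofPred_eq] at *
        rw [smul_add, expand_add, expand_add, hx, hy, smul_add]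
      neg_mem' := by
        intro x hx
        simp only [Set.mem_ofPred_eq] at *
        rw [smul_neg, expand_neg, expand_neg, hx, smul_neg] }
  refine P.monSpan_le (Y := Y) ?_ h
  intro e _ a
  change P.expand b (α • _) = α • _
  rw [← smul_mul_assoc, ← map_smul, expand_mon, expand_mon, Pi.single_smul]

/-- The elements of `K * U(H)` in which only variables from `V` occur. -/
def inVars (b : Basis C k H) (V : Set C) : AddSubgroup S :=
  P.monSpan b {e | ∀ c ∈ e.support, c ∈ V}

theorem mem_inVars_iff {V : Set C} {s : S} :
    s ∈ P.inVars b V ↔ ∀ c, Occurs (P.expand b s) c → c ∈ V := by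
  constructor
  · rintro h c ⟨e, he, hc⟩
    obtain ⟨e', rfl, he'⟩ := P.expand_ne_zero b he
    exact h e' he' c (by simpa using hc)
  · intro h e he c hc
    refine h c ⟨natExp e, ?_, by simpa using hc⟩
    rwa [expand_natExp]

/-! ### Straightening -/

/-- A variable times a standard monomial in greater or equal variables is a standard monomial. -/
theorem bar_mul_mon {c : C} {e : C →₀ ℕ} (h : ∀ d ∈ e.support, c ≤ d) :
    P.bar (b c) * P.mon b e = P.mon b (Finsupp.single c 1 + e) := by
  have e1 : e = Finsupp.single c (e c) + e.erase c := (Finsupp.single_add_erase c e).symm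
  have lt : ∀ n : ℕ, ∀ x ∈ (Finsupp.single c n).support, ∀ d ∈ (e.erase c).support, x < d := by
    intro n x hx d hd
    rw [Finsupp.mem_support_single] at hx
    rw [Finsupp.support_erase, Finset.mem_erase] at hd
    rw [hx.1]
    exact lt_of_le_of_ne (h d hd.2) hd.1.symm
  conv_lhs => rw [e1, P.mon_add (lt _), mon_single, ← mul_assoc, ← pow_succ', ← mon_single,
    ← P.mon_add (lt _)]
  conv_rhs => rw [e1, ← add_assoc, ← Finsupp.single_add, add_comm 1]

section Straighten

variable {V : Set C}

theorem bar_mul_coeff_mul (x : H) (a : K) (s : S) :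
    P.bar x * (P.coeff a * s) = P.coeff a * (P.bar x * s) + P.coeff (P.δ x a) * s := by
  rw [← mul_assoc, P.bar_mul_coeff, add_mul, mul_assoc]

theorem bar_mul_mem_of_mon {c : C} {n : ℕ}
    (h : ∀ e ∈ expLE V n, P.bar (b c) * P.mon b e ∈ P.monSpan b (expLE V (n + 1))) {s : S}
    (hs : s ∈ P.monSpan b (expLE V n)) :
    P.bar (b c) * s ∈ P.monSpan b (expLE V (n + 1)) := by
  refine P.monSpan_le (Y := (P.monSpan b _).comap (AddMonoidHom.mulLeft (P.bar (b c)))) ?_ hs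
  intro e he a
  rw [AddSubgroup.mem_comap, AddMonoidHom.coe_mulLeft, bar_mul_coeff_mul]
  exact add_mem (P.coeff_mul_mem_monSpan _ (h e he))
    (P.mon_mem_monSpan (expLE_mono n.le_succ he) _)

theorem bar_mul_mem_of_span {E : Set (C →₀ ℕ)} {s : S} (h : ∀ c ∈ V, P.bar (b c) * s ∈
    P.monSpan b E) {x : H} (hx : x ∈ Submodule.span k (b '' V)) :
    P.bar x * s ∈ P.monSpan b E := by
  induction hx using Submodule.span_induction with
  | mem x hx => obtain ⟨c, hc, rfl⟩ := hx; exact h c hc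
  | zero => simp [zero_mem]
  | add x y _ _ h1 h2 => rw [map_add, add_mul]; exact add_mem h1 h2
  | smul α x _ h1 => rw [map_smul, smul_mul_assoc]; exact P.smul_mem_monSpan α h1

theorem single_add_mem_expLE {c : C} (hc : c ∈ V) {e : C →₀ ℕ} {n : ℕ} (he : e ∈ expLE V n) :
    Finsupp.single c 1 + e ∈ expLE V (n + 1) := by
  refine ⟨fun d hd => ?_, ?_⟩
  · by_cases h : d = c
    · exact h ▸ hc
    · refine he.1 d ?_
      simp only [Finsupp.mem_support_iff, Finsupp.add_apply, Finsupp.single_apply,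
        if_neg (Ne.symm h), zero_add] at hd ⊢
      exact hd
  · rw [map_add, Finsupp.degree_single, add_comm]
    exact Nat.add_le_add_right he.2 1

/-- The leading term of the product of a variable and a standard monomial. -/
theorem bar_mul_mon_sub_mem (hV : ∀ c ∈ V, ∀ d ∈ V, ⁅b c, b d⁆ ∈ Submodule.span k (b '' V))
    (n : ℕ) : ∀ e ∈ expLE V n, ∀ c ∈ V,
      P.bar (b c) * P.mon b e - P.mon b (Finsupp.single c 1 + e) ∈ P.monSpan b (expLE V n) := by
  induction n with
  | zero =>
    rintro e ⟨-, he⟩ c _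
    have : e = 0 := (Finsupp.degree_eq_zero_iff e).1 (Nat.le_zero.1 he)
    subst this
    rw [P.bar_mul_mon (by simp), sub_self]
    exact zero_mem _
  | succ n ih =>
    -- left multiplication by a variable on elements of degree at most `n`
    have hbar : ∀ c ∈ V, ∀ s ∈ P.monSpan b (expLE V n),
        P.bar (b c) * s ∈ P.monSpan b (expLE V (n + 1)) := fun c hc s hs => by
      refine P.bar_mul_mem_of_mon (fun e he => ?_) hs
      have h1 := P.monSpan_mono (expLE_mono n.le_succ) (ih e he c hc)
      have h2 := P.mon_mem_monSpan (b := b) (single_add_mem_expLE hc he) 1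
      rw [map_one, one_mul] at h2
      have := add_mem h1 h2
      rwa [sub_add_cancel] at this
    intro e he c hc
    by_cases hmin : ∀ d ∈ e.support, c ≤ d
    · rw [P.bar_mul_mon hmin, sub_self]; exact zero_mem _
    push Not at hmin
    obtain ⟨d₀, hd₀, hd₀c⟩ := hmin
    have hne : e.support.Nonempty := ⟨d₀, hd₀⟩
    obtain ⟨d, hdm, hdmin⟩ : ∃ d ∈ e.support, ∀ x ∈ e.support, d ≤ x :=
      ⟨e.support.min' hne, Finset.min'_mem _ _, fun x hx => Finset.min'_le _ _ hx⟩
    have hdc : d < c := (hdmin _ hd₀).trans_lt hd₀c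
    have hdV : d ∈ V := he.1 d hdm
    obtain ⟨e', rfl⟩ : ∃ e', e = Finsupp.single d 1 + e' := by
      refine ⟨e - Finsupp.single d 1, (add_tsub_cancel_of_le ?_).symm⟩
      rw [Finsupp.single_le_iff]
      exact Nat.one_le_iff_ne_zero.2 (Finsupp.mem_support_iff.1 hdm)
    have hsub : ∀ x ∈ e'.support, x ∈ (Finsupp.single d 1 + e').support := fun x hx => by
      simp only [Finsupp.mem_support_iff, Finsupp.add_apply] at hx ⊢
      omega
    have he' : e' ∈ expLE V n := by
      refine ⟨fun x hx => he.1 x (hsub x hx), ?_⟩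
      have := he.2
      rw [map_add, Finsupp.degree_single] at this
      omega
    have hle : ∀ x ∈ e'.support, d ≤ x := fun x hx => hdmin x (hsub x hx)
    have hle' : ∀ x ∈ (Finsupp.single c 1 + e').support, d ≤ x := fun x hx => by
      by_cases h : x = c
      · exact h ▸ hdc.le
      · refine hle x ?_
        simp only [Finsupp.mem_support_iff, Finsupp.add_apply, Finsupp.single_apply,
          if_neg (Ne.symm h), zero_add] at hx ⊢
        exact hx
    have hcomm : P.bar (b c) * P.bar (b d) = P.bar (b d) * P.bar (b c) +
        (P.bar ⁅b c, b d⁆ + P.coeff (P.t (b c) (b d))) := by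
      rw [← P.bar_comm]; abel
    have e1 : P.bar (b c) * P.mon b (Finsupp.single d 1 + e') -
        P.mon b (Finsupp.single c 1 + (Finsupp.single d 1 + e')) =
        P.bar (b d) * (P.bar (b c) * P.mon b e' - P.mon b (Finsupp.single c 1 + e')) +
        (P.bar ⁅b c, b d⁆ * P.mon b e' + P.coeff (P.t (b c) (b d)) * P.mon b e') := by
      rw [← P.bar_mul_mon hle, mul_sub, P.bar_mul_mon hle', ← mul_assoc, hcomm,
        add_left_comm (Finsupp.single c 1)]
      simp only [add_mul, mul_assoc]
      abel
    have hmon : P.mon b e' ∈ P.monSpan b (expLE V n) := by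
      simpa using P.mon_mem_monSpan (b := b) he' 1
    rw [e1]
    refine add_mem (hbar d hdV _ (ih e' he' c hc)) (add_mem ?_ ?_)
    · exact P.bar_mul_mem_of_span (fun x hx => hbar x hx _ hmon) (hV c hc d hdV)
    · exact P.coeff_mul_mem_monSpan _ (P.monSpan_mono (expLE_mono n.le_succ) hmon)

/-- If the `b c`, `c ∈ V`, span a Lie subalgebra, then the combinations of the standard monomials in
the variables `V` are stable under left multiplication by it. -/
theorem bar_mul_mem_inVars (hV : ∀ c ∈ V, ∀ d ∈ V, ⁅b c, b d⁆ ∈ Submodule.span k (b '' V))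
    {x : H} (hx : x ∈ Submodule.span k (b '' V)) {s : S} (hs : s ∈ P.inVars b V) :
    P.bar x * s ∈ P.inVars b V := by
  have key : ∀ e : C →₀ ℕ, (∀ c ∈ e.support, c ∈ V) → P.bar x * P.mon b e ∈ P.inVars b V := by
    intro e he
    refine P.bar_mul_mem_of_span (fun c hc => ?_) hx
    have he' : e ∈ expLE V e.degree := ⟨he, le_rfl⟩
    have h1 := P.bar_mul_mon_sub_mem hV e.degree e he' c hc
    have h2 := P.mon_mem_monSpan (b := b) (single_add_mem_expLE hc he') 1
    rw [map_one, one_mul] at h2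
    have := add_mem (P.monSpan_mono (expLE_mono (Nat.le_succ _)) h1) h2
    rw [sub_add_cancel] at this
    exact P.monSpan_mono (fun e he => he.1) this
  refine P.monSpan_le (Y := (P.inVars b V).comap (AddMonoidHom.mulLeft (P.bar x))) ?_ hs
  intro e he a
  rw [AddSubgroup.mem_comap, AddMonoidHom.coe_mulLeft, bar_mul_coeff_mul]
  exact add_mem (P.coeff_mul_mem_monSpan _ (key e he)) (P.mon_mem_monSpan he _)

end Straighten

end CrossedProduct

end
noncomputable section

open Module

/-! ### Q-bases -/

section QBasis

variable {k : Type v} {H C : Type u} [Field k] [LieRing H] [LieAlgebra k H]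
  {I : ℕ → LieIdeal k H} {lev : C → ℕ} {b : Basis C k H}

theorem IsRNSeries.le_of_le (hI : IsRNSeries I) {m n : ℕ} (h : m ≤ n) : I n ≤ I m :=
  antitone_nat_of_succ_le hI.antitone h

/-- The terms of the RN-series are spanned by parts of the Q-basis. -/
theorem IsQBasis.mem_iff (hI : IsRNSeries I) (hb : IsQBasis I lev b) {m : ℕ} {x : H} :
    x ∈ I m ↔ ∀ c ∈ (b.repr x).support, m ≤ lev c := by
  have hsum : ∀ x : H, x = ∑ c ∈ (b.repr x).support, b.repr x c • b c := fun x =>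
    (b.linearCombination_repr x).symm
  constructor
  · -- if basis elements of level less than `m` occurred in `x`, then those of the least such level
    -- would be linearly dependent modulo the next term of the series
    intro hx
    by_contra! hc
    classical
    have hex : ∃ l, ∃ c ∈ (b.repr x).support, lev c = l := by
      obtain ⟨c, hc, -⟩ := hc; exact ⟨_, c, hc, rfl⟩
    obtain ⟨c₀, hc₀, hl₀⟩ := Nat.find_spec hex
    set l := Nat.find hex with hl
    have hmin : ∀ c ∈ (b.repr x).support, l ≤ lev c := fun c hc => Nat.find_min' hex ⟨c, hc, rfl⟩
    have hlm : l + 1 ≤ m := by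
      obtain ⟨c, hc, hcm⟩ := hc
      exact (hmin c hc).trans_lt hcm
    have hx' : x ∈ I (l + 1) := hI.le_of_le hlm hx
    let T := (b.repr x).support.filter fun c => lev c = l
    let T' := (b.repr x).support.filter fun c => ¬ lev c = l
    have h2 : ∑ c ∈ T', b.repr x c • b c ∈ I (l + 1) := by
      refine sum_mem fun c hc => (I (l + 1)).toSubmodule.smul_mem _ ?_
      rw [Finset.mem_filter] at hc
      have := hmin c hc.1
      exact hI.le_of_le (by omega : l + 1 ≤ lev c) (hb.mem c)
    have h1 : ∑ c ∈ T, b.repr x c • b c ∈ I (l + 1) := by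
      have e : ∑ c ∈ T, b.repr x c • b c = x - ∑ c ∈ T', b.repr x c • b c := by
        rw [eq_sub_iff_add_eq, Finset.sum_filter_add_sum_filter_not]
        exact (hsum x).symm
      rw [e]
      exact sub_mem hx' h2
    have hli := linearIndependent_iff'.1 (hb.indep l) (T.subtype fun c => lev c = l)
      (fun c => b.repr x c.1) ?_ ⟨c₀, hl₀⟩ (by simpa [T] using ⟨by simpa using hc₀, hl₀⟩)
    · exact (Finsupp.mem_support_iff.1 hc₀) hli
    · have e := Finset.sum_subtype_of_mem (s := T) (p := fun c => lev c = l)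
        (fun c => b.repr x c • (I (l + 1)).toSubmodule.mkQ (b c))
        (fun c hc => (Finset.mem_filter.1 hc).2)
      refine e.trans ?_
      simp only [← map_smul, ← map_sum]
      rw [Submodule.mkQ_apply, Submodule.Quotient.mk_eq_zero]
      exact h1
  · intro h
    rw [hsum x]
    exact sum_mem fun c hc => (I m).toSubmodule.smul_mem _ (hI.le_of_le (h c hc) (hb.mem c))

theorem IsQBasis.mem_span (hI : IsRNSeries I) (hb : IsQBasis I lev b) {m : ℕ} {x : H}
    (hx : x ∈ I m) : x ∈ Submodule.span k (b '' {c | m ≤ lev c}) := by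
  have := (hb.mem_iff hI).1 hx
  rw [← b.linearCombination_repr x, Finsupp.linearCombination_apply]
  exact Submodule.sum_mem _ fun c hc =>
    Submodule.smul_mem _ _ (Submodule.subset_span ⟨c, this c hc, rfl⟩)

theorem IsQBasis.basis_mem_iff (hI : IsRNSeries I) (hb : IsQBasis I lev b) {m : ℕ} {c : C} :
    b c ∈ I m ↔ m ≤ lev c := by
  rw [hb.mem_iff hI]
  simp

end QBasis

namespace CrossedProduct

variable {k : Type v} {K : Type w} {H C : Type u} {S : Type w'}
  [Field k] [DivisionRing K] [Algebra k K] [LieRing H] [LieAlgebra k H] [Ring S] [Algebra k S]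
  {P : CrossedProduct k K H S} {I : ℕ → LieIdeal k H} {lev : C → ℕ}
  {b : Basis C k H}

theorem coeff_mem_sub (N : LieIdeal k H) (a : K) : P.coeff a ∈ P.sub N :=
  Subring.subset_closure (Or.inl ⟨a, rfl⟩)

theorem bar_mem_sub {N : LieIdeal k H} {x : H} (hx : x ∈ N) : P.bar x ∈ P.sub N :=
  Subring.subset_closure (Or.inr ⟨x, hx, rfl⟩)

theorem commutator_eq (x y : H) :
    P.bar x * P.bar y - P.bar y * P.bar x = P.bar ⁅x, y⁆ + P.coeff (P.t x y) := P.bar_comm x y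

/-- Brackets with `b j` only involve basis elements of higher level than `b j`. -/
theorem lie_mem_span (hI : IsRNSeries I) (hb : IsQBasis I lev b) (x : H) (j : C) :
    ⁅x, b j⁆ ∈ Submodule.span k (b '' {c | lev j < lev c}) :=
  hb.mem_span hI (hI.lie_mem _ _ _ (hb.mem j))

/-- `K * U(N)` is stable under commutators with `x̄`. -/
theorem commutator_mem_sub {N : LieIdeal k H} (x : H) {s : S} (hs : s ∈ P.sub N) :
    P.bar x * s - s * P.bar x ∈ P.sub N := by
  induction hs using Subring.closure_induction with
  | mem s hs =>
    rcases hs with ⟨a, rfl⟩ | ⟨y, hy, rfl⟩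
    · rw [P.bar_mul_coeff, add_sub_cancel_left]; exact coeff_mem_sub _ _
    · rw [commutator_eq]
      exact add_mem (bar_mem_sub (lie_mem_right k H N _ _ hy)) (coeff_mem_sub _ _)
  | zero => simp [zero_mem]
  | one => simp [zero_mem]
  | add s t _ _ h1 h2 =>
    have := add_mem h1 h2
    rwa [show P.bar x * s - s * P.bar x + (P.bar x * t - t * P.bar x) =
      P.bar x * (s + t) - (s + t) * P.bar x by noncomm_ring] at this
  | neg s _ h =>
    have := neg_mem h
    rwa [show -(P.bar x * s - s * P.bar x) = P.bar x * -s - -s * P.bar x by noncomm_ring] at this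
  | mul s t hs ht h1 h2 =>
    have := add_mem (Subring.mul_mem _ h1 ht) (Subring.mul_mem _ hs h2)
    rwa [show (P.bar x * s - s * P.bar x) * t + s * (P.bar x * t - t * P.bar x) =
      P.bar x * (s * t) - s * t * P.bar x by noncomm_ring] at this

/-! ### Coefficients with respect to the powers of a variable -/

theorem coef_add (j : C) (n : ℤ) (f g : P.Formal b) :
    coef j n (f + g) = coef j n f + coef j n g := by
  funext e
  simp only [coef, Pi.add_apply]
  split_ifs <;> simp

theorem coef_smul (j : C) (n : ℤ) (α : k) (f : P.Formal b) :
    coef j n (α • f) = α • coef j n f := by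
  funext e
  simp only [coef, Pi.smul_apply]
  split_ifs <;> simp

theorem coef_zero (j : C) (n : ℤ) : coef j n (0 : P.Formal b) = 0 := by
  funext e
  simp [coef]

theorem apply_eq_coef (j : C) (f : P.Formal b) (e : C →₀ ℤ) :
    f e = coef j (e j) f (e.erase j) := by
  rw [coef, if_pos Finsupp.erase_same, Finsupp.erase_add_single]

theorem ext_coef {j : C} {f g : P.Formal b} (h : ∀ n, coef j n f = coef j n g) : f = g := by
  funext e
  rw [apply_eq_coef j f, apply_eq_coef j g, h]

theorem Occurs.of_coef {j c : C} {n : ℤ} {f : P.Formal b} (h : Occurs (coef j n f) c) :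
    c ≠ j ∧ Occurs f c := by
  obtain ⟨e, he, hc⟩ := h
  rw [coef] at he
  split_ifs at he with h0
  · have hne : c ≠ j := fun h => hc (h ▸ h0)
    refine ⟨hne, _, he, ?_⟩
    rw [Finsupp.add_apply, Finsupp.single_eq_of_ne hne, add_zero]
    exact hc
  · exact absurd rfl he

theorem Occurs.exists_coef {j c : C} {f : P.Formal b} (h : Occurs f c) (hc : c ≠ j) :
    ∃ n, Occurs (coef j n f) c := by
  obtain ⟨e, he, hec⟩ := h
  refine ⟨e j, e.erase j, ?_, ?_⟩
  · rwa [← apply_eq_coef]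
  · rwa [Finsupp.erase_ne hc]

/-- If `ū_j` does not occur in `f`, then `f` is its own constant coefficient. -/
theorem coef_of_not_occurs {j : C} {f : P.Formal b} (h : ¬ Occurs f j) (n : ℤ) :
    coef j n f = if n = 0 then f else 0 := by
  have hf : ∀ e, e j ≠ 0 → f e = 0 := fun e he => by
    by_contra hne; exact h ⟨e, hne, he⟩
  funext e
  rw [coef]
  split_ifs with h1 h2 h2
  · rw [h2, Finsupp.single_zero, add_zero]
  · refine hf _ ?_
    simpa [h1] using h2
  · exact (hf e h1).symm
  · rfl

theorem coef_single [DecidableEq (C →₀ ℤ)] (j : C) (n : ℤ) (e : C →₀ ℤ) (a : K) :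
    coef (P := P) (b := b) j n (Pi.single e a) =
      if e j = n then (Pi.single (e.erase j) a : P.Formal b) else 0 := by
  funext e'
  rw [coef]
  split_ifs with h1 h2 h2
  · by_cases h : e' = e.erase j
    · rw [h, ← h2, Finsupp.erase_add_single, Pi.single_eq_same, Pi.single_eq_same]
    · rw [Pi.single_eq_of_ne h, Pi.single_eq_of_ne]
      rintro rfl
      refine h ?_
      rw [Finsupp.erase_add, Finsupp.erase_single, add_zero, Finsupp.erase_of_notMem_support]
      simpa using h1
  · refine Pi.single_eq_of_ne ?_ _
    rintro rfl
    exact h2 (by simp [h1])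
  · rw [Pi.single_eq_of_ne]
    rintro rfl
    exact h1 Finsupp.erase_same
  · rfl

theorem not_occurs_zero (c : C) : ¬ Occurs (0 : P.Formal b) c := fun ⟨_, he, _⟩ => he rfl

theorem Occurs.of_add {f g : P.Formal b} {c : C} (h : Occurs (f + g) c) :
    Occurs f c ∨ Occurs g c := by
  obtain ⟨e, he, hc⟩ := h
  by_cases hf : f e = 0
  · exact Or.inr ⟨e, by simpa [hf] using he, hc⟩
  · exact Or.inl ⟨e, hf, hc⟩

theorem Occurs.of_smul {α : k} {f : P.Formal b} {c : C} (h : Occurs (α • f) c) : Occurs f c := by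
  obtain ⟨e, he, hc⟩ := h
  refine ⟨e, fun h0 => he ?_, hc⟩
  rw [Pi.smul_apply, h0, smul_zero]

/-- `f ↦ coef j n f` as an additive map. -/
def coefHom (j : C) (n : ℤ) : P.Formal b →+ P.Formal b where
  toFun := coef j n
  map_zero' := coef_zero j n
  map_add' := coef_add j n

/-! ### The subrings `K * U(H_m)` -/

variable [LinearOrder C]

theorem coeff_mem_inVars (V : Set C) (a : K) : P.coeff a ∈ P.inVars b V := by
  have := P.mon_mem_monSpan (b := b) (E := {e | ∀ c ∈ e.support, c ∈ V}) (e := 0) (by simp) a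
  rwa [mon_zero, mul_one] at this

/-- `K * U(H_m)` consists of the elements in which only variables of level at least `m` occur. -/
theorem mem_sub_iff (hI : IsRNSeries I) (hb : IsQBasis I lev b) {m : ℕ} {s : S} :
    s ∈ P.sub (I m) ↔ s ∈ P.inVars b {c | m ≤ lev c} := by
  set V : Set C := {c | m ≤ lev c} with hV'
  have hV : ∀ c ∈ V, ∀ d ∈ V, ⁅b c, b d⁆ ∈ Submodule.span k (b '' V) := fun c _ d hd =>
    hb.mem_span hI (lie_mem_right k H (I m) _ _ ((hb.basis_mem_iff hI).2 hd))
  constructor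
  · intro hs
    -- left multiplication by `s` preserves the span of the standard monomials
    have key : ∀ y ∈ P.inVars b V, s * y ∈ P.inVars b V := by
      induction hs using Subring.closure_induction with
      | mem s hs =>
        rcases hs with ⟨a, rfl⟩ | ⟨x, hx, rfl⟩
        · exact fun y hy => P.coeff_mul_mem_monSpan a hy
        · exact fun y hy => P.bar_mul_mem_inVars hV (hb.mem_span hI hx) hy
      | zero => intro y _; rw [zero_mul]; exact zero_mem _
      | one => intro y hy; rwa [one_mul]
      | add s t _ _ h1 h2 => intro y hy; rw [add_mul]; exact add_mem (h1 y hy) (h2 y hy)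
      | neg s _ h => intro y hy; rw [neg_mul]; exact neg_mem (h y hy)
      | mul s t _ _ h1 h2 => intro y hy; rw [mul_assoc]; exact h1 _ (h2 y hy)
    have := key 1 (by rw [← map_one P.coeff]; exact coeff_mem_inVars V 1)
    rwa [mul_one] at this
  · refine fun hs => P.monSpan_le (Y := (P.sub (I m)).toAddSubgroup) (fun e he a => ?_) hs
    refine (P.sub (I m)).mul_mem (coeff_mem_sub _ a) ?_
    refine (P.sub (I m)).list_prod_mem fun y hy => ?_
    obtain ⟨c, hc, rfl⟩ := List.mem_map.1 hy
    refine (P.sub (I m)).pow_mem (bar_mem_sub ?_) _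
    exact (hb.basis_mem_iff hI).2 (he c ((Finset.mem_sort _).1 hc))

theorem mon_erase_mul_pow {j : C} {e : C →₀ ℕ} (he : ∀ c ∈ e.support, c ≤ j) :
    P.mon b e = P.mon b (e.erase j) * P.bar (b j) ^ e j := by
  rw [← mon_single, ← P.mon_add, Finsupp.erase_add_single]
  intro c hc d hd
  rw [Finsupp.support_erase, Finset.mem_erase] at hc
  rw [Finsupp.mem_support_single] at hd
  rw [hd.1]
  exact lt_of_le_of_ne (he c hc.2) hc.1

/-- Elements in the variables up to `j` are polynomials in `ū_j`, with coefficients in the smaller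
variables. -/
theorem inVars_le_induction {j : C} {Y : AddSubgroup S}
    (h : ∀ s ∈ P.inVars b (Set.Iio j), ∀ n : ℕ, s * P.bar (b j) ^ n ∈ Y) :
    P.inVars b (Set.Iic j) ≤ Y := by
  refine P.monSpan_le fun e he a => ?_
  rw [mon_erase_mul_pow he, ← mul_assoc]
  refine h _ (P.mon_mem_monSpan (fun c hc => ?_) a) _
  rw [Finsupp.support_erase, Finset.mem_erase] at hc
  exact lt_of_le_of_ne (he c hc.2) hc.1

/-- Two additive maps on expansions agree if they agree on the terms. -/
theorem expand_eq_of_mon {Φ Ψ : P.Formal b →+ P.Formal b} {φ : S →+ S} {E : Set (C →₀ ℕ)}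
    (h : ∀ e ∈ E, ∀ a, Φ (P.expand b (φ (P.coeff a * P.mon b e))) =
      Ψ (P.expand b (P.coeff a * P.mon b e))) {s : S} (hs : s ∈ P.monSpan b E) :
    Φ (P.expand b (φ s)) = Ψ (P.expand b s) := by
  have := P.monSpan_le (b := b) (E := E)
    (Y := ((Φ.comp ((P.expandHom b).comp φ)) - (Ψ.comp (P.expandHom b))).ker)
    (fun e he a => by
      rw [AddMonoidHom.mem_ker, AddMonoidHom.sub_apply, sub_eq_zero]
      exact h e he a) hs
  rwa [AddMonoidHom.mem_ker, AddMonoidHom.sub_apply, sub_eq_zero] at this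

/-- The coefficients of a polynomial in `ū_j` with one term. -/
theorem coef_expand_mul_pow {j : C} {s : S} (hs : s ∈ P.inVars b (Set.Iio j)) (n : ℤ) (i : ℕ) :
    coef j n (P.expand b (s * P.bar (b j) ^ i)) = if n = i then P.expand b s else 0 := by
  have key : ∀ e : C →₀ ℕ, (∀ c ∈ e.support, c ∈ Set.Iio j) → ∀ a,
      coef j n (P.expand b (P.coeff a * P.mon b e * P.bar (b j) ^ i)) =
        if n = i then P.expand b (P.coeff a * P.mon b e) else 0 := by
    intro e he a
    have hj : e j = 0 := by
      by_contra h
      exact lt_irrefl j (he j (Finsupp.mem_support_iff.2 h))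
    rw [mul_assoc, ← mon_single, ← P.mon_add, expand_mon, expand_mon, coef_single (P := P) (b := b)]
    · rw [natExp_add, natExp_single]
      simp only [Finsupp.add_apply, natExp_apply, hj, Finsupp.single_eq_same, Finsupp.erase_add,
        Finsupp.erase_single, add_zero, Nat.cast_zero, zero_add, eq_comm]
      rw [Finsupp.erase_of_notMem_support (by simp [hj])]
    · intro c hc d hd
      rw [Finsupp.mem_support_single] at hd
      rw [hd.1]; exact he c hc
  have := expand_eq_of_mon (Φ := coefHom j n) (φ := AddMonoidHom.mulRight (P.bar (b j) ^ i))
    (Ψ := if n = i then AddMonoidHom.id _ else 0) (fun e he a => by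
      simp only [AddMonoidHom.coe_mulRight]
      refine (key e he a).trans ?_
      split_ifs <;> rfl) hs
  refine this.trans ?_
  split_ifs <;> rfl

/-- In a standard monomial the variables of level at least `m` precede those of lower level. -/
theorem mon_split (hord : IsCanonicalOrder lev) (m : ℕ) (e : C →₀ ℕ) :
    P.mon b e =
      P.mon b (e.filter fun c => ¬ lev c < m) * P.mon b (e.filter fun c => lev c < m) := by
  rw [← P.mon_add, add_comm, Finsupp.filter_add_filter_not]
  intro c hc d hd
  rw [Finsupp.support_filter, Finset.mem_filter] at hc hd
  exact hord.lt_of_lev _ _ (by omega)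

/-- `K * U(H)` is spanned over `K * U(H_m)` by the standard monomials in the variables of level less
than `m`. -/
theorem sub_mon_induction (hI : IsRNSeries I) (hb : IsQBasis I lev b)
    (hord : IsCanonicalOrder lev) (m : ℕ) {Y : AddSubgroup S}
    (h : ∀ r ∈ P.sub (I m), ∀ e : C →₀ ℕ, (∀ c ∈ e.support, lev c < m) → r * P.mon b e ∈ Y)
    (s : S) : s ∈ Y := by
  refine P.monSpan_le (fun e _ a => ?_) (P.mem_monSpan_univ (b := b) s)
  rw [mon_split hord m, ← mul_assoc]
  refine h _ ((mem_sub_iff hI hb).2 (P.mon_mem_monSpan (fun c hc => ?_) a)) _ fun c hc => ?_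
  · rw [Finsupp.support_filter, Finset.mem_filter] at hc
    exact not_lt.1 hc.2
  · rw [Finsupp.support_filter, Finset.mem_filter] at hc
    exact hc.2

end CrossedProduct

end
noncomputable section

open Module

namespace CrossedProduct

variable {k : Type v} {K : Type w} {H C : Type u} {S : Type w'}
  [Field k] [DivisionRing K] [Algebra k K] [LieRing H] [LieAlgebra k H] [Ring S] [Algebra k S]
  [LinearOrder C] {P : CrossedProduct k K H S} {b : Basis C k H}

/-! ### Rings of formal sums -/

/-- With the operations `O`, the formal sums in `A` form a `k`-algebra, on which `H` acts by
derivations, so that both the product and the derivations extend those of `K * U(H)`. The elements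
`ū_c`, `c ∈ V`, belong to `A`, and their derivations are inner. -/
structure IsGood (O : Ops P b) (A : Submodule k (P.Formal b)) (V : Set C) : Prop where
  coeff_mem : ∀ a, P.expand b (P.coeff a) ∈ A
  mul_mem : ∀ {f g}, f ∈ A → g ∈ A → O.mul f g ∈ A
  add_mul : ∀ {f g h}, f ∈ A → g ∈ A → h ∈ A → O.mul (f + g) h = O.mul f h + O.mul g h
  mul_add : ∀ {f g h}, f ∈ A → g ∈ A → h ∈ A → O.mul f (g + h) = O.mul f g + O.mul f h
  mul_assoc : ∀ {f g h}, f ∈ A → g ∈ A → h ∈ A → O.mul (O.mul f g) h = O.mul f (O.mul g h)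
  smul_mul : ∀ (α : k) {f g}, f ∈ A → g ∈ A → O.mul (α • f) g = α • O.mul f g
  mul_smul : ∀ (α : k) {f g}, f ∈ A → g ∈ A → O.mul f (α • g) = α • O.mul f g
  one_mul : ∀ {f}, f ∈ A → O.mul (P.expand b 1) f = f
  mul_one : ∀ {f}, f ∈ A → O.mul f (P.expand b 1) = f
  expand_mul : ∀ {s s'}, P.expand b s ∈ A → P.expand b s' ∈ A →
    O.mul (P.expand b s) (P.expand b s') = P.expand b (s * s')
  der_mem : ∀ x {f}, f ∈ A → O.der x f ∈ A
  der_add : ∀ x {f g}, f ∈ A → g ∈ A → O.der x (f + g) = O.der x f + O.der x g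
  der_smul : ∀ x (α : k) {f}, f ∈ A → O.der x (α • f) = α • O.der x f
  der_mul : ∀ x {f g}, f ∈ A → g ∈ A →
    O.der x (O.mul f g) = O.mul (O.der x f) g + O.mul f (O.der x g)
  der_expand : ∀ x {s}, P.expand b s ∈ A →
    O.der x (P.expand b s) = P.expand b (P.bar x * s - s * P.bar x)
  der_add_left : ∀ x y {f}, f ∈ A → O.der (x + y) f = O.der x f + O.der y f
  der_smul_left : ∀ (α : k) x {f}, f ∈ A → O.der (α • x) f = α • O.der x f
  der_comm : ∀ x y {f}, f ∈ A → O.der x (O.der y f) - O.der y (O.der x f) = O.der ⁅x, y⁆ f +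
    (O.mul (P.expand b (P.coeff (P.t x y))) f - O.mul f (P.expand b (P.coeff (P.t x y))))
  bar_mem : ∀ {c}, c ∈ V → P.expand b (P.bar (b c)) ∈ A
  der_bar : ∀ {c}, c ∈ V → ∀ {f}, f ∈ A → O.der (b c) f =
    O.mul (P.expand b (P.bar (b c))) f - O.mul f (P.expand b (P.bar (b c)))

namespace IsGood

variable {O : Ops P b} {A : Submodule k (P.Formal b)} {V : Set C} (h : IsGood O A V)

include h in
theorem one_mem : P.expand b 1 ∈ A := by
  have := h.coeff_mem 1
  rwa [map_one] at this

/-- The ring formed by the elements of `A`. -/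
def Elt (_ : IsGood O A V) : Type _ := A

instance : AddCommGroup h.Elt := inferInstanceAs (AddCommGroup A)

/-- An element of `A` as an element of the ring. -/
def elt {f : P.Formal b} (hf : f ∈ A) : h.Elt := ⟨f, hf⟩

/-- The formal sum underlying an element of the ring. -/
def val : h.Elt →+ P.Formal b := A.subtype.toAddMonoidHom

theorem val_mem (f : h.Elt) : h.val f ∈ A := Subtype.property _

theorem val_injective : Function.Injective h.val := Subtype.val_injective

@[simp] theorem val_elt {f : P.Formal b} (hf : f ∈ A) : h.val (h.elt hf) = f := rfl

instance : Ring h.Elt :=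
  { (inferInstance : AddCommGroup h.Elt) with
    mul := fun f g => h.elt (h.mul_mem (h.val_mem f) (h.val_mem g))
    one := h.elt h.one_mem
    mul_assoc := fun _ _ _ => h.val_injective
      (h.mul_assoc (h.val_mem _) (h.val_mem _) (h.val_mem _))
    one_mul := fun _ => h.val_injective (h.one_mul (h.val_mem _))
    mul_one := fun _ => h.val_injective (h.mul_one (h.val_mem _))
    left_distrib := fun _ _ _ =>
      h.val_injective (h.mul_add (h.val_mem _) (h.val_mem _) (h.val_mem _))
    right_distrib := fun _ _ _ =>
      h.val_injective (h.add_mul (h.val_mem _) (h.val_mem _) (h.val_mem _))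
    zero_mul := fun g => h.val_injective (by
      have := h.smul_mul 0 A.zero_mem (h.val_mem g)
      rwa [zero_smul, zero_smul] at this)
    mul_zero := fun f => h.val_injective (by
      have := h.mul_smul 0 (h.val_mem f) A.zero_mem
      rwa [zero_smul, zero_smul] at this) }

theorem val_mul (f g : h.Elt) : h.val (f * g) = O.mul (h.val f) (h.val g) := rfl

/-- The derivation of the ring given by an element of `H`. -/
def delta (x : H) : h.Elt →+ h.Elt where
  toFun f := h.elt (h.der_mem x (h.val_mem f))
  map_zero' := h.val_injective (by
    have := h.der_smul x 0 A.zero_mem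
    rwa [zero_smul, zero_smul] at this)
  map_add' f g := h.val_injective (h.der_add x (h.val_mem f) (h.val_mem g))

theorem val_delta (x : H) (f : h.Elt) : h.val (h.delta x f) = O.der x (h.val f) := rfl

theorem val_delta_iterate (x : H) (n : ℕ) (f : h.Elt) :
    h.val ((h.delta x)^[n] f) = (O.der x)^[n] (h.val f) := by
  induction n generalizing f with
  | zero => rfl
  | succ n ih => rw [Function.iterate_succ_apply, Function.iterate_succ_apply, ih, val_delta]

theorem delta_mul (x : H) (f g : h.Elt) :
    h.delta x (f * g) = h.delta x f * g + f * h.delta x g :=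
  h.val_injective (h.der_mul x (h.val_mem f) (h.val_mem g))

/-- A scalar as an element of the ring. -/
def scalar (α : k) : h.Elt := h.elt (A.smul_mem α h.one_mem)

theorem val_scalar_mul (α : k) (f : h.Elt) : h.val (h.scalar α * f) = α • h.val f := by
  rw [val_mul, scalar, val_elt, h.smul_mul α h.one_mem (h.val_mem f), h.one_mul (h.val_mem f)]

theorem scalar_comm (α : k) (f : h.Elt) : h.scalar α * f = f * h.scalar α := by
  refine h.val_injective ?_
  rw [val_scalar_mul, val_mul, scalar, val_elt, h.mul_smul α (h.val_mem f) h.one_mem,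
    h.mul_one (h.val_mem f)]

theorem delta_scalar (x : H) (α : k) : h.delta x (h.scalar α) = 0 := by
  refine h.val_injective ?_
  rw [val_delta, scalar, val_elt, h.der_smul x α h.one_mem, h.der_expand x h.one_mem,
    _root_.mul_one, _root_.one_mul, sub_self, expand_zero, smul_zero, map_zero]

include h in
/-- The derivation given by an element of the span of the `b c`, `c ∈ V`, is inner. -/
theorem der_span {x : H} (hx : x ∈ Submodule.span k (b '' V)) :
    P.expand b (P.bar x) ∈ A ∧ ∀ f ∈ A, O.der x f =
      O.mul (P.expand b (P.bar x)) f - O.mul f (P.expand b (P.bar x)) := by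
  induction hx using Submodule.span_induction with
  | mem x hx => obtain ⟨c, hc, rfl⟩ := hx; exact ⟨h.bar_mem hc, fun f hf => h.der_bar hc hf⟩
  | zero =>
    rw [map_zero, expand_zero]
    refine ⟨A.zero_mem, fun f hf => ?_⟩
    have e1 := h.smul_mul 0 A.zero_mem hf
    have e2 := h.mul_smul 0 hf A.zero_mem
    have e3 := h.der_smul_left 0 0 hf
    rw [zero_smul, zero_smul] at e1 e2 e3
    rw [e1, e2, e3, sub_zero]
  | add x y _ _ h1 h2 =>
    rw [map_add, expand_add]
    refine ⟨A.add_mem h1.1 h2.1, fun f hf => ?_⟩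
    rw [h.der_add_left x y hf, h1.2 f hf, h2.2 f hf, h.add_mul h1.1 h2.1 hf,
      h.mul_add hf h1.1 h2.1]
    abel
  | smul α x _ h1 =>
    rw [map_smul, expand_smul]
    refine ⟨A.smul_mem α h1.1, fun f hf => ?_⟩
    rw [h.der_smul_left α x hf, h1.2 f hf, h.smul_mul α h1.1 hf, h.mul_smul α hf h1.1, smul_sub]

include h in
/-- Operations that agree on `A` give the same ring. -/
theorem congr {O' : Ops P b} (hm : ∀ f ∈ A, ∀ g ∈ A, O'.mul f g = O.mul f g)
    (hd : ∀ x, ∀ f ∈ A, O'.der x f = O.der x f) : IsGood O' A V where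
  coeff_mem := h.coeff_mem
  mul_mem hf hg := by rw [hm _ hf _ hg]; exact h.mul_mem hf hg
  add_mul hf hg hh := by
    rw [hm _ (A.add_mem hf hg) _ hh, hm _ hf _ hh, hm _ hg _ hh, h.add_mul hf hg hh]
  mul_add hf hg hh := by
    rw [hm _ hf _ (A.add_mem hg hh), hm _ hf _ hg, hm _ hf _ hh, h.mul_add hf hg hh]
  mul_assoc hf hg hh := by
    rw [hm _ hf _ hg, hm _ hg _ hh, hm _ (h.mul_mem hf hg) _ hh, hm _ hf _ (h.mul_mem hg hh),
      h.mul_assoc hf hg hh]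
  smul_mul α _ _ hf hg := by
    rw [hm _ (A.smul_mem α hf) _ hg, hm _ hf _ hg, h.smul_mul α hf hg]
  mul_smul α _ _ hf hg := by
    rw [hm _ hf _ (A.smul_mem α hg), hm _ hf _ hg, h.mul_smul α hf hg]
  one_mul hf := by rw [hm _ h.one_mem _ hf, h.one_mul hf]
  mul_one hf := by rw [hm _ hf _ h.one_mem, h.mul_one hf]
  expand_mul hs hs' := by rw [hm _ hs _ hs', h.expand_mul hs hs']
  der_mem x _ hf := by rw [hd x _ hf]; exact h.der_mem x hf
  der_add x _ _ hf hg := by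
    rw [hd x _ (A.add_mem hf hg), hd x _ hf, hd x _ hg, h.der_add x hf hg]
  der_smul x α _ hf := by rw [hd x _ (A.smul_mem α hf), hd x _ hf, h.der_smul x α hf]
  der_mul x _ _ hf hg := by
    rw [hm _ hf _ hg, hd x _ (h.mul_mem hf hg), hd x _ hf, hd x _ hg,
      hm _ (h.der_mem x hf) _ hg, hm _ hf _ (h.der_mem x hg), h.der_mul x hf hg]
  der_expand x _ hs := by rw [hd x _ hs, h.der_expand x hs]
  der_add_left x y _ hf := by rw [hd _ _ hf, hd _ _ hf, hd _ _ hf, h.der_add_left x y hf]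
  der_smul_left α x _ hf := by rw [hd _ _ hf, hd _ _ hf, h.der_smul_left α x hf]
  der_comm x y _ hf := by
    rw [hd y _ hf, hd x _ hf, hd x _ (h.der_mem y hf), hd y _ (h.der_mem x hf), hd _ _ hf,
      hm _ (h.coeff_mem _) _ hf, hm _ hf _ (h.coeff_mem _), h.der_comm x y hf]
  bar_mem := h.bar_mem
  der_bar hc _ hf := by
    rw [hd _ _ hf, hm _ (h.bar_mem hc) _ hf, hm _ hf _ (h.bar_mem hc), h.der_bar hc hf]

end IsGood

/-! ### Series in one more variable -/

/-- The formal sums that are series in `ū_j⁻¹` with coefficients in `A`. -/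
def laurentSub (A : Submodule k (P.Formal b)) (j : C) : Submodule k (P.Formal b) where
  carrier := {f | (∀ n, coef j n f ∈ A) ∧ ∃ N : ℤ, ∀ n, N < n → coef j n f = 0}
  zero_mem' := ⟨fun n => by rw [coef_zero]; exact A.zero_mem, 0, fun n _ => coef_zero j n⟩
  add_mem' := by
    rintro f g ⟨hf, N, hN⟩ ⟨hg, M, hM⟩
    refine ⟨fun n => by rw [coef_add]; exact A.add_mem (hf n) (hg n), max N M, fun n hn => ?_⟩
    rw [coef_add, hN n (by omega), hM n (by omega), add_zero]
  smul_mem' := by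
    rintro α f ⟨hf, N, hN⟩
    refine ⟨fun n => by rw [coef_smul]; exact A.smul_mem α (hf n), N, fun n hn => ?_⟩
    rw [coef_smul, hN n hn, smul_zero]

/-- The passage to series depends only on the operations on the ring of coefficients. -/
theorem laurent_congr {O O' : Ops P b} {A : Submodule k (P.Formal b)} {j : C}
    (hA : ∀ f ∈ A, O.der (b j) f ∈ A)
    (hw : ∀ x, P.expand b (P.bar x * P.bar (b j) - P.bar (b j) * P.bar x) ∈ A)
    (hm : ∀ f ∈ A, ∀ g ∈ A, O'.mul f g = O.mul f g)
    (hd : ∀ x, ∀ f ∈ A, O'.der x f = O.der x f) :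
    (∀ f ∈ laurentSub A j, ∀ g ∈ laurentSub A j, (O'.laurent j).mul f g = (O.laurent j).mul f g) ∧
    ∀ x, ∀ f ∈ laurentSub A j, (O'.laurent j).der x f = (O.laurent j).der x f := by
  have it : ∀ n : ℕ, ∀ f ∈ A, (O'.der (b j))^[n] f = (O.der (b j))^[n] f ∧
      (O.der (b j))^[n] f ∈ A := by
    intro n
    induction n with
    | zero => exact fun f hf => ⟨rfl, hf⟩
    | succ n ih =>
      intro f hf
      simp only [Function.iterate_succ_apply]
      rw [hd _ f hf]
      exact ih _ (hA f hf)
  refine ⟨fun f hf g hg => ?_, fun x f hf => ?_⟩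
  · funext e
    simp only [Ops.laurent]
    refine finsum_congr fun q => ?_
    have := it q.2 _ (hg.1 (e j - q.1 + q.2))
    rw [this.1, hm _ (hf.1 _) _ this.2]
  · funext e
    simp only [Ops.laurent]
    rw [hd x _ (hf.1 _)]
    congr 1
    refine finsum_congr fun i => ?_
    have := it i _ (hw x)
    rw [this.1, hm _ (hf.1 _) _ this.2]

namespace IsGood

open SkewLaurent

variable {O : Ops P b} {A : Submodule k (P.Formal b)} {V : Set C} (h : IsGood O A V) (j : C)

open scoped Classical in
/-- The series in `ū_j⁻¹` given by a formal sum. -/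
def lift (f : P.Formal b) : ℤ → h.Elt := fun n =>
  if hf : coef j n f ∈ A then h.elt hf else 0

/-- The formal sum given by a series in `ū_j⁻¹`. -/
def glue (F : ℤ → h.Elt) : P.Formal b := fun e => h.val (F (e j)) (e.erase j)

variable {j}

theorem val_lift {f : P.Formal b} {n : ℤ} (hf : coef j n f ∈ A) :
    h.val (h.lift j f n) = coef j n f := by
  rw [lift, dif_pos hf, val_elt]

theorem val_lift_of_mem {f : P.Formal b} (hf : f ∈ laurentSub A j) (n : ℤ) :
    h.val (h.lift j f n) = coef j n f := h.val_lift (hf.1 n)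

theorem lift_eq {f : P.Formal b} {F : ℤ → h.Elt} (hF : ∀ n, coef j n f = h.val (F n)) :
    h.lift j f = F := by
  funext n
  refine h.val_injective ?_
  rw [val_lift _ (by rw [hF]; exact h.val_mem _), hF]

theorem exists_bddDeg {f : P.Formal b} (hf : f ∈ laurentSub A j) :
    ∃ N, BddDeg N (h.lift j f) := by
  obtain ⟨N, hN⟩ := hf.2
  exact ⟨N, fun n hn => h.val_injective (by rw [h.val_lift_of_mem hf, hN n hn, map_zero])⟩

theorem lift_injective {f g : P.Formal b} (hf : f ∈ laurentSub A j) (hg : g ∈ laurentSub A j)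
    (e : h.lift j f = h.lift j g) : f = g :=
  ext_coef (j := j) fun n => by rw [← h.val_lift_of_mem hf, e, h.val_lift_of_mem hg]

theorem lift_add {f g : P.Formal b} (hf : f ∈ laurentSub A j) (hg : g ∈ laurentSub A j) :
    h.lift j (f + g) = h.lift j f + h.lift j g :=
  h.lift_eq fun n => by
    rw [coef_add, Pi.add_apply, map_add, h.val_lift_of_mem hf, h.val_lift_of_mem hg]

theorem lift_neg {f : P.Formal b} (hf : f ∈ laurentSub A j) : h.lift j (-f) = -h.lift j f := by
  rw [eq_neg_iff_add_eq_zero, ← h.lift_add (neg_mem hf) hf, neg_add_cancel]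
  exact h.lift_eq fun n => by rw [coef_zero, Pi.zero_apply, map_zero]

theorem lift_sub {f g : P.Formal b} (hf : f ∈ laurentSub A j) (hg : g ∈ laurentSub A j) :
    h.lift j (f - g) = h.lift j f - h.lift j g := by
  rw [sub_eq_add_neg, h.lift_add hf (neg_mem hg), h.lift_neg hg, sub_eq_add_neg]

theorem lift_smul (α : k) {f : P.Formal b} (hf : f ∈ laurentSub A j) :
    h.lift j (α • f) = h.scalar α • h.lift j f :=
  h.lift_eq fun n => by
    rw [coef_smul, Pi.smul_apply, smul_eq_mul, val_scalar_mul, h.val_lift_of_mem hf]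

variable (hA : ∀ f ∈ A, ∀ c, Occurs f c → c < j)

section

include hA

theorem not_occurs {f : P.Formal b} (hf : f ∈ A) : ¬ Occurs f j :=
  fun ho => lt_irrefl j (hA f hf j ho)

theorem coef_glue (F : ℤ → h.Elt) (n : ℤ) : coef j n (h.glue j F) = h.val (F n) := by
  funext e
  rw [coef]
  split_ifs with h0
  · rw [glue, Finsupp.add_apply, h0, zero_add, Finsupp.single_eq_same, Finsupp.erase_add,
      Finsupp.erase_single, add_zero, Finsupp.erase_of_notMem_support (by simpa using h0)]
  · by_contra hne
    exact not_occurs hA (h.val_mem (F n)) ⟨e, fun h => hne h.symm, h0⟩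

theorem glue_mem {F : ℤ → h.Elt} {N : ℤ} (hF : BddDeg N F) : h.glue j F ∈ laurentSub A j :=
  ⟨fun n => by rw [h.coef_glue hA]; exact h.val_mem _, N, fun n hn => by
    rw [h.coef_glue hA, hF n hn, map_zero]⟩

theorem lift_glue (F : ℤ → h.Elt) : h.lift j (h.glue j F) = F :=
  h.lift_eq fun n => h.coef_glue hA F n

theorem le_laurentSub : A ≤ laurentSub A j := fun f hf => by
  have := coef_of_not_occurs (not_occurs hA hf)
  refine ⟨fun n => ?_, 0, fun n hn => ?_⟩
  · rw [this]; split_ifs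
    · exact hf
    · exact A.zero_mem
  · rw [this, if_neg hn.ne']

theorem lift_of_mem {f : P.Formal b} (hf : f ∈ A) : h.lift j f = Pi.single 0 (h.elt hf) :=
  h.lift_eq fun n => by
    rw [coef_of_not_occurs (not_occurs hA hf), Pi.single_apply]
    split_ifs
    · rfl
    · exact (map_zero _).symm

omit hA in
/-- The product of formal sums is the product of the corresponding series. -/
theorem laurent_mul_eq {f g : P.Formal b} (hf : f ∈ laurentSub A j) (hg : g ∈ laurentSub A j) :
    (O.laurent j).mul f g = h.glue j (mul (h.delta (b j)) (h.lift j f) (h.lift j g)) := by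
  obtain ⟨N, hN⟩ := h.exists_bddDeg hf
  obtain ⟨M, hM⟩ := h.exists_bddDeg hg
  funext e
  let ev : h.Elt →+ K := (Pi.evalAddMonoidHom (fun _ : C →₀ ℤ => K) (e.erase j)).comp h.val
  have := ev.map_finsum (finite_support_mul (δ := h.delta (b j)) hN hM (e j))
  refine Eq.trans ?_ this.symm
  simp only [Ops.laurent]
  refine finsum_congr fun q => ?_
  rw [map_zsmul]
  congr 1
  change _ = h.val (_ * _) _
  rw [val_mul, val_delta_iterate, h.val_lift_of_mem hf, h.val_lift_of_mem hg]

/-- The commutator of `x̄` and `ū_j`, as an element of the ring. -/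
def comm (hw : ∀ x, P.expand b (P.bar x * P.bar (b j) - P.bar (b j) * P.bar x) ∈ A) (x : H) :
    h.Elt := h.elt (hw x)

variable (hw : ∀ x, P.expand b (P.bar x * P.bar (b j) - P.bar (b j) * P.bar x) ∈ A)

omit hA in
/-- The derivations of formal sums are the extended derivations of series. -/
theorem laurent_der_eq (x : H) {f : P.Formal b} (hf : f ∈ laurentSub A j) :
    (O.laurent j).der x f =
      h.glue j (ext (h.delta (b j)) (h.delta x) (h.comm hw x) (h.lift j f)) := by
  obtain ⟨N, hN⟩ := h.exists_bddDeg hf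
  funext e
  let ev : h.Elt →+ K := (Pi.evalAddMonoidHom (fun _ : C →₀ ℤ => K) (e.erase j)).comp h.val
  have := ev.map_finsum (finite_support_ext (δ := h.delta (b j)) hN (h.comm hw x) (e j))
  have e2 : h.glue j (ext (h.delta (b j)) (h.delta x) (h.comm hw x) (h.lift j f)) e =
    ev (ext (h.delta (b j)) (h.delta x) (h.comm hw x) (h.lift j f) (e j)) := rfl
  rw [e2, ext, map_add, this]
  simp only [Ops.laurent]
  congr 1
  · change _ = h.val (h.delta x (h.lift j f (e j))) (e.erase j)
    rw [val_delta, h.val_lift_of_mem hf]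
  refine finsum_congr fun q => ?_
  rw [map_zsmul]
  congr 1
  change _ = h.val (_ * _) _
  rw [val_mul, val_delta_iterate, h.val_lift_of_mem hf]
  rfl

include h in
theorem laurent_mul_mem {f g : P.Formal b} (hf : f ∈ laurentSub A j) (hg : g ∈ laurentSub A j) :
    (O.laurent j).mul f g ∈ laurentSub A j := by
  obtain ⟨N, hN⟩ := h.exists_bddDeg hf
  obtain ⟨M, hM⟩ := h.exists_bddDeg hg
  rw [h.laurent_mul_eq hf hg]
  exact h.glue_mem hA (hN.mul hM)

theorem lift_mul {f g : P.Formal b} (hf : f ∈ laurentSub A j) (hg : g ∈ laurentSub A j) :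
    h.lift j ((O.laurent j).mul f g) = mul (h.delta (b j)) (h.lift j f) (h.lift j g) := by
  rw [h.laurent_mul_eq hf hg, h.lift_glue hA]

include h hw in
theorem laurent_der_mem (x : H) {f : P.Formal b} (hf : f ∈ laurentSub A j) :
    (O.laurent j).der x f ∈ laurentSub A j := by
  obtain ⟨N, hN⟩ := h.exists_bddDeg hf
  rw [h.laurent_der_eq hw x hf]
  exact h.glue_mem hA hN.ext

theorem lift_der (x : H) {f : P.Formal b} (hf : f ∈ laurentSub A j) :
    h.lift j ((O.laurent j).der x f) =
      ext (h.delta (b j)) (h.delta x) (h.comm hw x) (h.lift j f) := by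
  rw [h.laurent_der_eq hw x hf, h.lift_glue hA]

end

end IsGood

end CrossedProduct

end
noncomputable section

open Module

namespace CrossedProduct

variable {k : Type v} {K : Type w} {H C : Type u} {S : Type w'}
  [Field k] [DivisionRing K] [Algebra k K] [LieRing H] [LieAlgebra k H] [Ring S] [Algebra k S]
  [LinearOrder C] {P : CrossedProduct k K H S} {b : Basis C k H}

namespace IsGood

open SkewLaurent

variable {O : Ops P b} {A : Submodule k (P.Formal b)} {V : Set C} (h : IsGood O A V) {j : C}
  (hA : ∀ f ∈ A, ∀ c, Occurs f c → c < j)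
  (hw : ∀ x, P.expand b (P.bar x * P.bar (b j) - P.bar (b j) * P.bar x) ∈ A)

/-! ### Polynomials among the series -/

include hA

theorem mem_inVars_of_mem {s : S} (hs : P.expand b s ∈ A) : s ∈ P.inVars b (Set.Iio j) :=
  (P.mem_inVars_iff).2 (hA _ hs)

theorem coef_mul_pow {s : S} (hs : P.expand b s ∈ A) (n : ℤ) (i : ℕ) :
    coef j n (P.expand b (s * P.bar (b j) ^ i)) = if n = i then P.expand b s else 0 :=
  coef_expand_mul_pow (mem_inVars_of_mem hA hs) n i

theorem lift_mul_pow {s : S} (hs : P.expand b s ∈ A) (i : ℕ) :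
    h.lift j (P.expand b (s * P.bar (b j) ^ i)) = Pi.single (i : ℤ) (h.elt hs) :=
  h.lift_eq fun n => by
    rw [coef_mul_pow hA hs, Pi.single_apply]
    split_ifs
    · rfl
    · exact (map_zero _).symm

theorem mul_pow_mem {s : S} (hs : P.expand b s ∈ A) (i : ℕ) :
    P.expand b (s * P.bar (b j) ^ i) ∈ laurentSub A j := by
  refine ⟨fun n => ?_, i, fun n hn => ?_⟩
  · rw [coef_mul_pow hA hs]
    split_ifs
    · exact hs
    · exact A.zero_mem
  · rw [coef_mul_pow hA hs, if_neg hn.ne']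

theorem inVars_of_mem_laurentSub {s : S} (hs : P.expand b s ∈ laurentSub A j) :
    s ∈ P.inVars b (Set.Iic j) := by
  refine (P.mem_inVars_iff).2 fun c hc => ?_
  rcases eq_or_ne c j with rfl | hne
  · exact le_rfl
  · obtain ⟨n, hn⟩ := hc.exists_coef hne
    exact (hA _ (hs.1 n) c hn).le

/-- The elements of `K * U(H)` which are series in `ū_j⁻¹` are polynomials in `ū_j`. -/
theorem polynomial_induction {Y : AddSubgroup S}
    (hY : ∀ s, P.expand b s ∈ A → ∀ n : ℕ, s * P.bar (b j) ^ n ∈ Y) {s : S}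
    (hs : P.expand b s ∈ laurentSub A j) : s ∈ Y := by
  let Φ : (ℕ →₀ S) →+ S :=
    Finsupp.liftAddHom fun n => AddMonoidHom.mulRight (P.bar (b j) ^ n)
  let T : AddSubgroup (ℕ →₀ S) :=
    { carrier := {t | ∀ n, t n ∈ P.inVars b (Set.Iio j)}
      zero_mem' := fun n => zero_mem _
      add_mem' := fun h1 h2 n => add_mem (h1 n) (h2 n)
      neg_mem' := fun h1 n => neg_mem (h1 n) }
  obtain ⟨t, ht, rfl⟩ : s ∈ T.map Φ := by
    refine inVars_le_induction (j := j) (Y := T.map Φ) (fun s hs n =>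
      ⟨Finsupp.single n s, fun m => ?_, ?_⟩)
      (inVars_of_mem_laurentSub hA hs)
    · rw [Finsupp.single_apply]
      split_ifs
      · exact hs
      · exact zero_mem _
    · simp [Φ]
  have hΦ : Φ t = ∑ n ∈ t.support, t n * P.bar (b j) ^ n := rfl
  rw [hΦ]
  refine Y.sum_mem fun n hn => hY _ ?_ n
  have e : coef j n (P.expand b (Φ t)) = P.expand b (t n) := by
    rw [hΦ]
    change (coefHom j n) (P.expandHom b _) = _
    rw [map_sum, map_sum, Finset.sum_eq_single_of_mem n hn]
    · exact (coef_expand_mul_pow (ht n) n n).trans (if_pos rfl)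
    · intro i _ hi
      exact (coef_expand_mul_pow (ht i) n i).trans (if_neg (by exact_mod_cast hi.symm))
  rw [← e]
  exact hs.1 n

/-- An additive map on `K * U(H)` corresponds to an operator on series if it does so on the
polynomials with one term. -/
theorem lift_map {φ : S →+ S} {Ψ : (ℤ → h.Elt) → ℤ → h.Elt}
    (hΨ : ∀ p f g, BddDeg p f → BddDeg p g → Ψ (f + g) = Ψ f + Ψ g)
    (hφ : ∀ s (hs : P.expand b s ∈ A) (n : ℕ),
      P.expand b (φ (s * P.bar (b j) ^ n)) ∈ laurentSub A j ∧
      h.lift j (P.expand b (φ (s * P.bar (b j) ^ n))) = Ψ (Pi.single (n : ℤ) (h.elt hs)))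
    {s : S} (hs : P.expand b s ∈ laurentSub A j) : P.expand b (φ s) ∈ laurentSub A j ∧
      h.lift j (P.expand b (φ s)) = Ψ (h.lift j (P.expand b s)) := by
  have hΨ0 : Ψ 0 = 0 := by
    have := hΨ 0 0 0 (fun _ _ => rfl) (fun _ _ => rfl)
    rwa [add_zero, left_eq_add] at this
  let Y : AddSubgroup S :=
    { carrier := {s | P.expand b s ∈ laurentSub A j ∧ P.expand b (φ s) ∈ laurentSub A j ∧
        h.lift j (P.expand b (φ s)) = Ψ (h.lift j (P.expand b s))}
      zero_mem' := by
        refine ⟨?_, ?_, ?_⟩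
        · rw [expand_zero]; exact zero_mem _
        · rw [map_zero, expand_zero]; exact zero_mem _
        · have : h.lift j (0 : P.Formal b) = 0 :=
            h.lift_eq fun n => by rw [coef_zero, Pi.zero_apply, map_zero]
          rw [map_zero, expand_zero, this, hΨ0]
      add_mem' := by
        rintro s t ⟨h1, h2, h3⟩ ⟨h4, h5, h6⟩
        refine ⟨?_, ?_, ?_⟩
        · rw [expand_add]; exact add_mem h1 h4
        · rw [map_add, expand_add]; exact add_mem h2 h5
        · obtain ⟨N, hN⟩ := h.exists_bddDeg h1
          obtain ⟨M, hM⟩ := h.exists_bddDeg h4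
          rw [map_add, expand_add, expand_add, h.lift_add h2 h5, h.lift_add h1 h4, h3, h6,
            hΨ _ _ _ (hN.mono (le_max_left N M)) (hM.mono (le_max_right N M))]
      neg_mem' := by
        rintro s ⟨h1, h2, h3⟩
        refine ⟨?_, ?_, ?_⟩
        · rw [expand_neg]; exact neg_mem h1
        · rw [map_neg, expand_neg]; exact neg_mem h2
        · obtain ⟨N, hN⟩ := h.exists_bddDeg h1
          rw [map_neg, expand_neg, expand_neg, h.lift_neg h2, h.lift_neg h1, h3,
            neg_eq_iff_add_eq_zero, ← hΨ _ _ _ hN hN.neg, add_neg_cancel, hΨ0] }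
  have : s ∈ Y := by
    refine polynomial_induction hA (Y := Y) (fun s hs n =>
      ⟨mul_pow_mem hA hs n, hφ s hs n |>.1, ?_⟩) hs
    rw [(hφ s hs n).2, h.lift_mul_pow hA hs]
  exact this.2

theorem lift_coeff_mul {s s' : S} (hs : P.expand b s ∈ A) (hs' : P.expand b s' ∈ laurentSub A j) :
    P.expand b (s * s') ∈ laurentSub A j ∧
      h.lift j (P.expand b (s * s')) = h.elt hs • h.lift j (P.expand b s') := by
  refine h.lift_map hA (φ := AddMonoidHom.mulLeft s) (Ψ := fun f => h.elt hs • f)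
    (fun p f g _ _ => smul_add _ _ _) (fun s' hs' n => ?_) hs'
  have e : P.expand b (s * s') ∈ A := by
    rw [← h.expand_mul hs hs']; exact h.mul_mem hs hs'
  rw [AddMonoidHom.coe_mulLeft, ← _root_.mul_assoc]
  refine ⟨mul_pow_mem hA e n, ?_⟩
  rw [h.lift_mul_pow hA e, ← Pi.single_smul]
  congr 1
  exact h.val_injective (h.expand_mul hs hs').symm

/-- On expansions, left multiplication by `ū_j` in `K * U(H)` is multiplication by the variable of
the series. -/
theorem lift_bar_mul {s : S} (hs : P.expand b s ∈ laurentSub A j) :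
    P.expand b (P.bar (b j) * s) ∈ laurentSub A j ∧
      h.lift j (P.expand b (P.bar (b j) * s)) =
        up (h.delta (b j)) (h.lift j (P.expand b s)) := by
  refine h.lift_map hA (φ := AddMonoidHom.mulLeft (P.bar (b j))) (Ψ := up (h.delta (b j)))
    (fun p f g _ _ => up_add f g) (fun s hs n => ?_) hs
  have hd := h.der_mem (b j) hs
  rw [h.der_expand (b j) hs] at hd
  have e : P.bar (b j) * (s * P.bar (b j) ^ n) = s * P.bar (b j) ^ (n + 1) +
      (P.bar (b j) * s - s * P.bar (b j)) * P.bar (b j) ^ n := by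
    rw [pow_succ']; noncomm_ring
  rw [AddMonoidHom.coe_mulLeft, e, expand_add]
  refine ⟨add_mem (mul_pow_mem hA hs _) (mul_pow_mem hA hd _), ?_⟩
  rw [h.lift_add (mul_pow_mem hA hs _) (mul_pow_mem hA hd _), h.lift_mul_pow hA hs,
    h.lift_mul_pow hA hd, up_single, Nat.cast_succ]
  congr 2
  exact h.val_injective (h.der_expand (b j) hs).symm

/-- The product of series extends the product of `K * U(H)`. -/
theorem expand_mul_laurent {s s' : S} (hs : P.expand b s ∈ laurentSub A j)
    (hs' : P.expand b s' ∈ laurentSub A j) : P.expand b (s * s') ∈ laurentSub A j ∧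
      h.lift j (P.expand b (s * s')) =
        mul (h.delta (b j)) (h.lift j (P.expand b s)) (h.lift j (P.expand b s')) := by
  obtain ⟨N, hN⟩ := h.exists_bddDeg hs'
  have key : ∀ n : ℕ, P.expand b (P.bar (b j) ^ n * s') ∈ laurentSub A j ∧
      h.lift j (P.expand b (P.bar (b j) ^ n * s')) =
        twist (h.delta (b j)) n (h.lift j (P.expand b s')) := by
    intro n
    induction n with
    | zero => rw [pow_zero, _root_.one_mul]; exact ⟨hs', (twist_zero _).symm⟩
    | succ n ih =>
      rw [pow_succ', _root_.mul_assoc]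
      have := h.lift_bar_mul hA ih.1
      refine ⟨this.1, ?_⟩
      rw [this.2, ih.2, Nat.cast_succ, twist_succ hN]
  refine h.lift_map hA (φ := AddMonoidHom.mulRight s')
    (Ψ := fun f => mul (h.delta (b j)) f (h.lift j (P.expand b s')))
    (fun p f g hf hg => mul_add_left hf hg hN) (fun s hs n => ?_) hs
  rw [AddMonoidHom.coe_mulRight]
  beta_reduce
  rw [_root_.mul_assoc]
  have := h.lift_coeff_mul hA hs (key n).1
  refine ⟨this.1, ?_⟩
  rw [this.2, (key n).2, single_mul _ _ hN]

theorem bar_mem_laurentSub : P.expand b (P.bar (b j)) ∈ laurentSub A j ∧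
    h.lift j (P.expand b (P.bar (b j))) = Pi.single 1 1 := by
  have h1 := mul_pow_mem hA h.one_mem 1
  have h2 := h.lift_mul_pow hA h.one_mem 1
  rw [_root_.one_mul, pow_one] at h1 h2
  exact ⟨h1, h2⟩

theorem lift_one : h.lift j (P.expand b 1) = Pi.single 0 1 := h.lift_of_mem hA h.one_mem

omit hA in
theorem delta_comm (hi : ∀ x, ∀ f ∈ A, O.der x (O.der (b j) f) - O.der (b j) (O.der x f) =
      O.mul (P.expand b (P.bar x * P.bar (b j) - P.bar (b j) * P.bar x)) f -
        O.mul f (P.expand b (P.bar x * P.bar (b j) - P.bar (b j) * P.bar x))) (x : H) (f : h.Elt) :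
    h.delta x (h.delta (b j) f) - h.delta (b j) (h.delta x f) =
      h.comm hw x * f - f * h.comm hw x :=
  h.val_injective (hi x _ (h.val_mem f))

section

variable (hi : ∀ x, ∀ f ∈ A, O.der x (O.der (b j) f) - O.der (b j) (O.der x f) =
      O.mul (P.expand b (P.bar x * P.bar (b j) - P.bar (b j) * P.bar x)) f -
        O.mul f (P.expand b (P.bar x * P.bar (b j) - P.bar (b j) * P.bar x)))

include hi

/-- The extended derivations of series are commutators on `K * U(H)`. -/
theorem expand_der_laurent (x : H) {s : S} (hs : P.expand b s ∈ laurentSub A j) :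
    P.expand b (P.bar x * s - s * P.bar x) ∈ laurentSub A j ∧
      h.lift j (P.expand b (P.bar x * s - s * P.bar x)) =
        ext (h.delta (b j)) (h.delta x) (h.comm hw x) (h.lift j (P.expand b s)) := by
  have hu := h.bar_mem_laurentSub hA
  refine h.lift_map hA (φ := AddMonoidHom.mulLeft (P.bar x) - AddMonoidHom.mulRight (P.bar x))
    (fun p f g hf hg => ext_add hf hg) (fun s hs n => ?_) hs
  rw [← h.lift_mul_pow hA hs]
  change P.expand b (P.bar x * _ - _ * P.bar x) ∈ _ ∧
    h.lift j (P.expand b (P.bar x * _ - _ * P.bar x)) = _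
  induction n with
  | zero =>
    have hd := h.der_mem x hs
    rw [h.der_expand x hs] at hd
    rw [pow_zero, _root_.mul_one]
    refine ⟨le_laurentSub hA hd, ?_⟩
    rw [h.lift_of_mem hA hd, h.lift_of_mem hA hs, ext_single_zero]
    congr 1
    exact h.val_injective (h.der_expand x hs).symm
  | succ n ih =>
    have hn := mul_pow_mem hA hs n
    have hw' := le_laurentSub hA (hw x)
    have e : P.bar x * (s * P.bar (b j) ^ (n + 1)) - s * P.bar (b j) ^ (n + 1) * P.bar x =
        (P.bar x * (s * P.bar (b j) ^ n) - s * P.bar (b j) ^ n * P.bar x) * P.bar (b j) +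
        s * P.bar (b j) ^ n * (P.bar x * P.bar (b j) - P.bar (b j) * P.bar x) := by
      rw [pow_succ]; noncomm_ring
    have h1 := h.expand_mul_laurent hA ih.1 hu.1
    have h2 := h.expand_mul_laurent hA hn hw'
    have h3 := h.expand_mul_laurent hA hn hu.1
    rw [e, expand_add]
    refine ⟨add_mem h1.1 h2.1, ?_⟩
    obtain ⟨N, hN⟩ := h.exists_bddDeg hn
    rw [h.lift_add h1.1 h2.1, h1.2, h2.2, ih.2, pow_succ, ← _root_.mul_assoc, h3.2,
      ext_mul (h.delta_mul _) (h.delta_mul _) (h.delta_comm hw hi x) hN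
        (hu.2 ▸ bddDeg_single 1 1), hu.2,
      ext_single_one (h.delta_mul _) (h.delta_mul _) (h.delta_comm hw hi x),
      h.lift_of_mem hA (hw x)]
    rfl

end

omit hA

include h in
/-- Series in one more variable `ū_j` with coefficients in `A` form a ring again. -/
theorem laurent (hA : ∀ f ∈ A, ∀ c, Occurs f c → c < j)
    (hV : ∀ x : H, ⁅x, b j⁆ ∈ Submodule.span k (b '' V)) :
    IsGood (O.laurent j) (laurentSub A j) (insert j V) := by
  have hw : ∀ x, P.expand b (P.bar x * P.bar (b j) - P.bar (b j) * P.bar x) ∈ A := fun x => by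
    rw [commutator_eq, expand_add]
    exact add_mem (h.der_span (hV x)).1 (h.coeff_mem _)
  have hi : ∀ x, ∀ f ∈ A, O.der x (O.der (b j) f) - O.der (b j) (O.der x f) =
      O.mul (P.expand b (P.bar x * P.bar (b j) - P.bar (b j) * P.bar x)) f -
        O.mul f (P.expand b (P.bar x * P.bar (b j) - P.bar (b j) * P.bar x)) := fun x f hf => by
    have h1 := h.der_span (hV x)
    rw [h.der_comm x (b j) hf, h1.2 f hf, commutator_eq, expand_add,
      h.add_mul h1.1 (h.coeff_mem _) hf, h.mul_add hf h1.1 (h.coeff_mem _)]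
    abel
  have hδ := h.delta_mul (b j)
  have hc := h.delta_comm hw hi
  have hu := h.bar_mem_laurentSub hA
  have hle := le_laurentSub hA
  have mm : ∀ {f g}, f ∈ laurentSub A j → g ∈ laurentSub A j →
      (O.laurent j).mul f g ∈ laurentSub A j := fun hf hg => h.laurent_mul_mem hA hf hg
  have lm : ∀ {f g}, f ∈ laurentSub A j → g ∈ laurentSub A j →
      h.lift j ((O.laurent j).mul f g) = mul (h.delta (b j)) (h.lift j f) (h.lift j g) :=
    fun hf hg => h.lift_mul hA hf hg
  have dm : ∀ x {f}, f ∈ laurentSub A j → (O.laurent j).der x f ∈ laurentSub A j :=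
    fun x _ hf => h.laurent_der_mem hA hw x hf
  have ld : ∀ x {f}, f ∈ laurentSub A j → h.lift j ((O.laurent j).der x f) =
      ext (h.delta (b j)) (h.delta x) (h.comm hw x) (h.lift j f) :=
    fun x _ hf => h.lift_der hA hw x hf
  have inj : ∀ {f g}, f ∈ laurentSub A j → g ∈ laurentSub A j → h.lift j f = h.lift j g → f = g :=
    fun hf hg => h.lift_injective hf hg
  have bd : ∀ {f}, f ∈ laurentSub A j → ∃ N, BddDeg N (h.lift j f) := fun hf => h.exists_bddDeg hf
  have sm : ∀ (α : k) {f}, f ∈ laurentSub A j → α • f ∈ laurentSub A j :=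
    fun α _ hf => Submodule.smul_mem _ α hf
  have em := fun {s s'} => h.expand_mul_laurent hA (s := s) (s' := s')
  have ed := fun x {s} => h.expand_der_laurent hA hw hi x (s := s)
  refine
    { coeff_mem := fun a => hle (h.coeff_mem a), mul_mem := mm, der_mem := dm,
      add_mul := ?add_mul, mul_add := ?mul_add, mul_assoc := ?mul_assoc, smul_mul := ?smul_mul,
      mul_smul := ?mul_smul, one_mul := ?one_mul, mul_one := ?mul_one,
      expand_mul := ?expand_mul, der_add := ?der_add, der_smul := ?der_smul,
      der_mul := ?der_mul, der_expand := ?der_expand, der_add_left := ?der_add_left,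
      der_smul_left := ?der_smul_left, der_comm := ?der_comm, bar_mem := ?bar_mem,
      der_bar := ?der_bar }
  case add_mul =>
    intro f g f' hf hg hf'
    obtain ⟨N, hN⟩ := bd hf; obtain ⟨M, hM⟩ := bd hg; obtain ⟨N', hN'⟩ := bd hf'
    refine inj (mm (add_mem hf hg) hf') (add_mem (mm hf hf') (mm hg hf')) ?_
    rw [lm (add_mem hf hg) hf', h.lift_add (mm hf hf') (mm hg hf'), lm hf hf', lm hg hf',
      h.lift_add hf hg, mul_add_left (hN.mono (le_max_left N M)) (hM.mono (le_max_right N M)) hN']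
  case mul_add =>
    intro f g f' hf hg hf'
    obtain ⟨N, hN⟩ := bd hf; obtain ⟨M, hM⟩ := bd hg; obtain ⟨N', hN'⟩ := bd hf'
    refine inj (mm hf (add_mem hg hf')) (add_mem (mm hf hg) (mm hf hf')) ?_
    rw [lm hf (add_mem hg hf'), h.lift_add (mm hf hg) (mm hf hf'), lm hf hg, lm hf hf',
      h.lift_add hg hf', mul_add_right hN (hM.mono (le_max_left M N'))
        (hN'.mono (le_max_right M N'))]
  case mul_assoc =>
    intro f g f' hf hg hf'
    obtain ⟨N, hN⟩ := bd hf; obtain ⟨M, hM⟩ := bd hg; obtain ⟨N', hN'⟩ := bd hf'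
    refine inj (mm (mm hf hg) hf') (mm hf (mm hg hf')) ?_
    rw [lm (mm hf hg) hf', lm hf hg, lm hf (mm hg hf'), lm hg hf', mul_assoc' hδ hN hM hN']
  case smul_mul =>
    intro α f g hf hg
    obtain ⟨N, hN⟩ := bd hf; obtain ⟨M, hM⟩ := bd hg
    refine inj (mm (sm α hf) hg) (sm α (mm hf hg)) ?_
    rw [lm (sm α hf) hg, h.lift_smul α hf, h.lift_smul α (mm hf hg), lm hf hg,
      mul_smul_left _ hN hM]
  case mul_smul =>
    intro α f g hf hg
    obtain ⟨N, hN⟩ := bd hf; obtain ⟨M, hM⟩ := bd hg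
    refine inj (mm hf (sm α hg)) (sm α (mm hf hg)) ?_
    rw [lm hf (sm α hg), h.lift_smul α hg, h.lift_smul α (mm hf hg), lm hf hg,
      mul_smul_right (h.scalar_comm α) hδ (h.delta_scalar _ α) hN hM]
  case one_mul =>
    intro f hf
    obtain ⟨N, hN⟩ := bd hf
    refine inj (mm (hle h.one_mem) hf) hf ?_
    rw [lm (hle h.one_mem) hf, h.lift_one hA, one_mul' hN]
  case mul_one =>
    intro f hf
    obtain ⟨N, hN⟩ := bd hf
    refine inj (mm hf (hle h.one_mem)) hf ?_
    rw [lm hf (hle h.one_mem), h.lift_one hA, mul_one' hδ hN]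
  case expand_mul =>
    intro s s' hs hs'
    have := em hs hs'
    refine inj (mm hs hs') this.1 ?_
    rw [lm hs hs', this.2]
  case der_add =>
    intro x f g hf hg
    obtain ⟨N, hN⟩ := bd hf; obtain ⟨M, hM⟩ := bd hg
    refine inj (dm x (add_mem hf hg)) (add_mem (dm x hf) (dm x hg)) ?_
    rw [ld x (add_mem hf hg), h.lift_add (dm x hf) (dm x hg), ld x hf, ld x hg, h.lift_add hf hg,
      ext_add (hN.mono (le_max_left N M)) (hM.mono (le_max_right N M))]
  case der_smul =>
    intro x α f hf
    obtain ⟨N, hN⟩ := bd hf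
    refine inj (dm x (sm α hf)) (sm α (dm x hf)) ?_
    rw [ld x (sm α hf), h.lift_smul α hf, h.lift_smul α (dm x hf), ld x hf,
      ext_smul (h.delta_mul x) _ hN, h.delta_scalar, zero_smul, add_zero]
  case der_mul =>
    intro x f g hf hg
    obtain ⟨N, hN⟩ := bd hf; obtain ⟨M, hM⟩ := bd hg
    refine inj (dm x (mm hf hg)) (add_mem (mm (dm x hf) hg) (mm hf (dm x hg))) ?_
    rw [ld x (mm hf hg), h.lift_add (mm (dm x hf) hg) (mm hf (dm x hg)), lm (dm x hf) hg,
      lm hf (dm x hg), ld x hf, ld x hg, lm hf hg, ext_mul hδ (h.delta_mul x) (hc x) hN hM]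
  case der_expand =>
    intro x s hs
    have := ed x hs
    refine inj (dm x hs) this.1 ?_
    rw [ld x hs, this.2]
  case der_add_left =>
    intro x y f hf
    obtain ⟨N, hN⟩ := bd hf
    refine inj (dm _ hf) (add_mem (dm x hf) (dm y hf)) ?_
    rw [ld _ hf, h.lift_add (dm x hf) (dm y hf), ld x hf, ld y hf]
    refine ext_add_left hN (fun a => h.val_injective (h.der_add_left x y (h.val_mem a)))
      (h.val_injective ?_)
    change P.expand b _ = P.expand b _ + P.expand b _
    rw [← expand_add, map_add, _root_.add_mul, _root_.mul_add]
    congr 1; abel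
  case der_smul_left =>
    intro α x f hf
    obtain ⟨N, hN⟩ := bd hf
    refine inj (dm _ hf) (sm α (dm x hf)) ?_
    rw [ld _ hf, h.lift_smul α (dm x hf), ld x hf]
    refine ext_smul_left (h.scalar_comm α) hδ (h.delta_scalar _ α) hN
      (fun a => h.val_injective ?_) (h.val_injective ?_)
    · rw [val_scalar_mul]
      exact h.der_smul_left α x (h.val_mem a)
    · rw [val_scalar_mul]
      change P.expand b _ = α • P.expand b _
      rw [← expand_smul, map_smul, smul_mul_assoc, mul_smul_comm, smul_sub]
  case der_comm =>
    intro x y f hf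
    obtain ⟨N, hN⟩ := bd hf
    have ht := h.coeff_mem (P.t x y)
    have ht' := hle ht
    refine inj (sub_mem (dm x (dm y hf)) (dm y (dm x hf)))
      (add_mem (dm _ hf) (sub_mem (mm ht' hf) (mm hf ht'))) ?_
    rw [h.lift_sub (dm x (dm y hf)) (dm y (dm x hf)),
      h.lift_add (dm _ hf) (sub_mem (mm ht' hf) (mm hf ht')), h.lift_sub (mm ht' hf) (mm hf ht'),
      ld x (dm y hf), ld y (dm x hf), ld x hf, ld y hf, ld _ hf, lm ht' hf, lm hf ht',
      h.lift_of_mem hA ht]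
    refine ext_comm (d₃ := h.delta ⁅x, y⁆) (t := h.elt ht) hδ (h.delta_mul x) (hc x)
      (h.delta_mul y) (hc y) (h.delta_mul _) (hc _)
      (fun a => h.val_injective (h.der_comm x y (h.val_mem a))) (h.val_injective ?_) hN
    change O.der x (P.expand b _) - O.der y (P.expand b _) =
      P.expand b _ - O.der (b j) (P.expand b _)
    rw [h.der_expand x (hw y), h.der_expand y (hw x), h.der_expand _ ht, ← expand_sub,
      ← expand_sub, eq_sub_of_add_eq (P.bar_comm x y).symm]
    congr 1
    noncomm_ring
  case bar_mem =>
    rintro c (rfl | hcV)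
    · exact hu.1
    · exact hle (h.bar_mem hcV)
  case der_bar =>
    rintro c hcV f hf
    obtain ⟨N, hN⟩ := bd hf
    rcases hcV with rfl | hcV
    · refine inj (dm _ hf) (sub_mem (mm hu.1 hf) (mm hf hu.1)) ?_
      rw [ld _ hf, h.lift_sub (mm hu.1 hf) (mm hf hu.1), lm hu.1 hf, lm hf hu.1, hu.2]
      have h1 : BddDeg 1 (Pi.single 1 1 : ℤ → h.Elt) := bddDeg_single 1 1
      refine ext_eq_commutator hδ hδ (hc _) h1 (fun a => ?_) ?_ hN
      · rw [single_mul 1 1 (bddDeg_single 0 a), single_mul 0 a h1, twist_one (bddDeg_single 0 a),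
          twist_zero, one_smul, up_single, ← Pi.single_smul, smul_eq_mul, _root_.mul_one, zero_add,
          add_sub_cancel_left]
      · have : h.comm hw (b c) = 0 := h.val_injective (by
          change P.expand b _ = _
          rw [sub_self, expand_zero, map_zero])
        rw [this, sub_self, Pi.single_zero]
    · have hcA := h.bar_mem hcV
      have hcL := hle hcA
      have h0 : BddDeg 0 (Pi.single 0 (h.elt hcA) : ℤ → h.Elt) := bddDeg_single 0 _
      refine inj (dm _ hf) (sub_mem (mm hcL hf) (mm hf hcL)) ?_
      rw [ld _ hf, h.lift_sub (mm hcL hf) (mm hf hcL), lm hcL hf, lm hf hcL, h.lift_of_mem hA hcA]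
      refine ext_eq_commutator hδ (h.delta_mul _) (hc _) h0 (fun a => ?_) ?_ hN
      · rw [single_mul 0 _ (bddDeg_single 0 a), single_mul 0 a h0, twist_zero, twist_zero,
          ← Pi.single_smul, ← Pi.single_smul, ← Pi.single_sub]
        congr 1
        exact h.val_injective (h.der_bar hcV (h.val_mem a))
      · rw [single_mul 0 _ (bddDeg_single 1 1), single_mul 1 1 h0, twist_zero, twist_one h0,
          one_smul, up_single, ← Pi.single_smul, smul_eq_mul, _root_.mul_one, zero_add,
          sub_add_cancel_left, ← Pi.single_neg]
        congr 1
        refine h.val_injective ?_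
        change P.expand b _ = -O.der (b j) (P.expand b _)
        rw [h.der_expand _ hcA, ← expand_neg, neg_sub]

end IsGood

end CrossedProduct

end
noncomputable section

open Module

namespace CrossedProduct

variable {k : Type v} {K : Type w} {H C : Type u} {S : Type w'}
  [Field k] [DivisionRing K] [Algebra k K] [LieRing H] [LieAlgebra k H] [Ring S] [Algebra k S]
  [LinearOrder C] {P : CrossedProduct k K H S} {b : Basis C k H}

namespace IsGood

variable {O : Ops P b} {A : Submodule k (P.Formal b)} {V : Set C}

/-- A directed union of rings is a ring. -/
theorem of_directed
    (hdir : ∀ f ∈ A, ∀ g ∈ A, ∀ g' ∈ A, ∃ A' V', A' ≤ A ∧ IsGood O A' V' ∧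
      f ∈ A' ∧ g ∈ A' ∧ g' ∈ A')
    (hV : ∀ c ∈ V, ∀ f ∈ A, ∃ A' V', A' ≤ A ∧ IsGood O A' V' ∧ f ∈ A' ∧ c ∈ V') :
    IsGood O A V where
  coeff_mem a := by
    obtain ⟨A', V', hle, h, -⟩ := hdir 0 A.zero_mem 0 A.zero_mem 0 A.zero_mem
    exact hle (h.coeff_mem a)
  mul_mem {f g} hf hg := by
    obtain ⟨A', V', hle, h, hf, hg, -⟩ := hdir f hf g hg g hg
    exact hle (h.mul_mem hf hg)
  add_mul {f g g'} hf hg hg' := by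
    obtain ⟨A', V', hle, h, hf, hg, hg'⟩ := hdir f hf g hg g' hg'
    exact h.add_mul hf hg hg'
  mul_add {f g g'} hf hg hg' := by
    obtain ⟨A', V', hle, h, hf, hg, hg'⟩ := hdir f hf g hg g' hg'
    exact h.mul_add hf hg hg'
  mul_assoc {f g g'} hf hg hg' := by
    obtain ⟨A', V', hle, h, hf, hg, hg'⟩ := hdir f hf g hg g' hg'
    exact h.mul_assoc hf hg hg'
  smul_mul α {f g} hf hg := by
    obtain ⟨A', V', hle, h, hf, hg, -⟩ := hdir f hf g hg g hg
    exact h.smul_mul α hf hg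
  mul_smul α {f g} hf hg := by
    obtain ⟨A', V', hle, h, hf, hg, -⟩ := hdir f hf g hg g hg
    exact h.mul_smul α hf hg
  one_mul {f} hf := by
    obtain ⟨A', V', hle, h, hf, -⟩ := hdir f hf f hf f hf
    exact h.one_mul hf
  mul_one {f} hf := by
    obtain ⟨A', V', hle, h, hf, -⟩ := hdir f hf f hf f hf
    exact h.mul_one hf
  expand_mul {s s'} hf hg := by
    obtain ⟨A', V', hle, h, hf, hg, -⟩ := hdir _ hf _ hg _ hg
    exact h.expand_mul hf hg
  der_mem x {f} hf := by
    obtain ⟨A', V', hle, h, hf, -⟩ := hdir f hf f hf f hf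
    exact hle (h.der_mem x hf)
  der_add x {f g} hf hg := by
    obtain ⟨A', V', hle, h, hf, hg, -⟩ := hdir f hf g hg g hg
    exact h.der_add x hf hg
  der_smul x α {f} hf := by
    obtain ⟨A', V', hle, h, hf, -⟩ := hdir f hf f hf f hf
    exact h.der_smul x α hf
  der_mul x {f g} hf hg := by
    obtain ⟨A', V', hle, h, hf, hg, -⟩ := hdir f hf g hg g hg
    exact h.der_mul x hf hg
  der_expand x {s} hf := by
    obtain ⟨A', V', hle, h, hf, -⟩ := hdir _ hf _ hf _ hf
    exact h.der_expand x hf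
  der_add_left x y {f} hf := by
    obtain ⟨A', V', hle, h, hf, -⟩ := hdir f hf f hf f hf
    exact h.der_add_left x y hf
  der_smul_left α x {f} hf := by
    obtain ⟨A', V', hle, h, hf, -⟩ := hdir f hf f hf f hf
    exact h.der_smul_left α x hf
  der_comm x y {f} hf := by
    obtain ⟨A', V', hle, h, hf, -⟩ := hdir f hf f hf f hf
    exact h.der_comm x y hf
  bar_mem {c} hc := by
    obtain ⟨A', V', hle, h, hf, hc⟩ := hV c hc 0 A.zero_mem
    exact hle (h.bar_mem hc)
  der_bar {c} hc {f} hf := by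
    obtain ⟨A', V', hle, h, hf, hc⟩ := hV c hc f hf
    exact h.der_bar hc hf

/-- On constant series the operations of the ring of series are those of the ring of
coefficients. -/
theorem laurent_of_mem (h : IsGood O A V) {j : C} (hA : ∀ f ∈ A, ∀ c, Occurs f c → c < j)
    (hw : ∀ x, P.expand b (P.bar x * P.bar (b j) - P.bar (b j) * P.bar x) ∈ A) :
    (∀ f ∈ A, ∀ g ∈ A, (O.laurent j).mul f g = O.mul f g) ∧
      ∀ x, ∀ f ∈ A, (O.laurent j).der x f = O.der x f := by
  have hle := le_laurentSub hA
  refine ⟨fun f hf g hg => ?_, fun x f hf => ?_⟩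
  · refine h.lift_injective (h.laurent_mul_mem hA (hle hf) (hle hg)) (hle (h.mul_mem hf hg)) ?_
    rw [h.lift_mul hA (hle hf) (hle hg), h.lift_of_mem hA hf, h.lift_of_mem hA hg,
      h.lift_of_mem hA (h.mul_mem hf hg),
      SkewLaurent.single_mul _ _ (SkewLaurent.bddDeg_single 0 _),
      SkewLaurent.twist_zero, ← Pi.single_smul]
    rfl
  · refine h.lift_injective (h.laurent_der_mem hA hw x (hle hf)) (hle (h.der_mem x hf)) ?_
    rw [h.lift_der hA hw x (hle hf), h.lift_of_mem hA hf, h.lift_of_mem hA (h.der_mem x hf),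
      SkewLaurent.ext_single_zero]
    rfl

end IsGood

variable {I : ℕ → LieIdeal k H} {lev : C → ℕ}

/-! ### The operations of the tower of series rings -/

theorem baseOps_mul (s s' : S) :
    (baseOps P b).mul (P.expand b s) (P.expand b s') = P.expand b (s * s') := by
  simp only [baseOps, Function.leftInverse_invFun (P.expand_injective b) _]

theorem baseOps_der (x : H) (s : S) :
    (baseOps P b).der x (P.expand b s) = P.expand b (P.bar x * s - s * P.bar x) := by
  simp only [baseOps, Function.leftInverse_invFun (P.expand_injective b) _]

theorem IsTop.unique {m : ℕ} {f g : P.Formal b} {i i' : C} (h : IsTop lev m f g i)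
    (h' : IsTop lev m f g i') : i = i' := IsGreatest.unique h h'

section Union

variable {m : ℕ} {p : {c // lev c < m} → Prop} {G : ∀ i, p i → Ops P b}

/-- The product in a union is computed in the ring at the greatest variable that occurs. -/
theorem union_of_top {f g : P.Formal b} {i : {c // lev c < m}} (hp : p i)
    (hi : IsTop lev m f g i.1) : (union P lev b m p G).mul f g = (G i hp).mul f g := by
  have hex : ∃ i, p i ∧ IsTop lev m f g i.1 := ⟨i, hp, hi⟩
  simp only [union, dif_pos hex]
  have : ∀ i' (hp' : p i'), i' = i → (G i' hp').mul f g = (G i hp).mul f g := by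
    rintro i' hp' rfl; rfl
  exact this _ _ (Subtype.ext (hex.choose_spec.2.unique hi))

theorem union_der_of_top (x : H) {f : P.Formal b} {i : {c // lev c < m}} (hp : p i)
    (hi : IsTop lev m f f i.1) : (union P lev b m p G).der x f = (G i hp).der x f := by
  have hex : ∃ i, p i ∧ IsTop lev m f f i.1 := ⟨i, hp, hi⟩
  simp only [union, dif_pos hex]
  have : ∀ i' (hp' : p i'), i' = i → (G i' hp').der x f = (G i hp).der x f := by
    rintro i' hp' rfl; rfl
  exact this _ _ (Subtype.ext (hex.choose_spec.2.unique hi))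

theorem union_of_not_top {f g : P.Formal b} (h : ∀ i, ¬ IsTop lev m f g i) :
    (union P lev b m p G).mul f g = (baseOps P b).mul f g := by
  simp only [union]
  rw [dif_neg]
  rintro ⟨i, -, hi⟩
  exact h _ hi

theorem union_der_of_not_top (x : H) {f : P.Formal b} (h : ∀ i, ¬ IsTop lev m f f i) :
    (union P lev b m p G).der x f = (baseOps P b).der x f := by
  simp only [union]
  rw [dif_neg]
  rintro ⟨i, -, hi⟩
  exact h _ hi

end Union

variable (hord : IsCanonicalOrder lev) {m : ℕ}

theorem opsUpTo_eq (j : {c // lev c < m}) : opsUpTo P b hord m j =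
    (union P lev b m (fun i => i.1 < j.1) fun i _ => opsUpTo P b hord m i).laurent j.1 := by
  rw [opsUpTo, WellFounded.fix_eq]

/-- The operations of the union of the rings at the elements less than `j` are restrictions of those
of the whole union. -/
theorem union_lt_eq_ops (j : {c // lev c < m}) {f g : P.Formal b}
    (hf : ∀ c, lev c < m → Occurs f c → c < j.1) (hg : ∀ c, lev c < m → Occurs g c → c < j.1) :
    (union P lev b m (fun i => i.1 < j.1) fun i _ => opsUpTo P b hord m i).mul f g =
      (ops P b hord m).mul f g := by
  by_cases h : ∃ i, IsTop lev m f g i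
  · obtain ⟨i, hi⟩ := h
    have hlt : i < j.1 := hi.1.2.elim (hf i hi.1.1) (hg i hi.1.1)
    rw [ops, union_of_top (i := ⟨i, hi.1.1⟩) hlt hi, union_of_top (i := ⟨i, hi.1.1⟩) trivial hi]
  · have h : ∀ i, ¬ IsTop lev m f g i := fun i hi => h ⟨i, hi⟩
    rw [ops, union_of_not_top h, union_of_not_top h]

theorem union_lt_der_eq_ops (j : {c // lev c < m}) (x : H) {f : P.Formal b}
    (hf : ∀ c, lev c < m → Occurs f c → c < j.1) :
    (union P lev b m (fun i => i.1 < j.1) fun i _ => opsUpTo P b hord m i).der x f =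
      (ops P b hord m).der x f := by
  by_cases h : ∃ i, IsTop lev m f f i
  · obtain ⟨i, hi⟩ := h
    have hlt : i < j.1 := hi.1.2.elim (hf i hi.1.1) (hf i hi.1.1)
    rw [ops, union_der_of_top x (i := ⟨i, hi.1.1⟩) hlt hi,
      union_der_of_top x (i := ⟨i, hi.1.1⟩) trivial hi]
  · have h : ∀ i, ¬ IsTop lev m f f i := fun i hi => h ⟨i, hi⟩
    rw [ops, union_der_of_not_top x h, union_der_of_not_top x h]

/-! ### The elements of the tower of series rings -/

variable (hI : IsRNSeries I) (hb : IsQBasis I lev b)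

theorem MemSeriesAt.zero : MemSeriesAt P I lev b m 0 := by
  rw [← P.expand_zero b]; exact .base 0 (zero_mem _)

include hI hb in
theorem not_occurs_of_mem_sub {s : S} (hs : s ∈ P.sub (I m)) {c : C} (hc : lev c < m) :
    ¬ Occurs (P.expand b s) c := fun h =>
  absurd ((P.mem_inVars_iff).1 ((mem_sub_iff hI hb).1 hs) c h) (not_le.2 hc)

include hI hb in
theorem MemSeriesAt.coef_mem {f : P.Formal b} (hf : MemSeriesAt P I lev b m f) {j : C}
    (hj : lev j < m) (ho : ∀ c, lev c < m → Occurs f c → c ≤ j) :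
    (∀ n, MemSeriesAt P I lev b m (coef j n f)) ∧ ∃ N : ℤ, ∀ n, N < n → coef j n f = 0 := by
  -- the case of `f` in which `j` does not occur
  have const : ∀ {f : P.Formal b}, MemSeriesAt P I lev b m f → ¬ Occurs f j →
      (∀ n, MemSeriesAt P I lev b m (coef j n f)) ∧ ∃ N : ℤ, ∀ n, N < n → coef j n f = 0 := by
    intro f hf hno
    refine ⟨fun n => ?_, 0, fun n hn => ?_⟩
    · rw [coef_of_not_occurs hno]
      split_ifs
      · exact hf
      · exact .zero
    · rw [coef_of_not_occurs hno, if_neg hn.ne']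
  induction hf with
  | base s hs => exact const (.base s hs) (not_occurs_of_mem_sub hI hb hs hj)
  | laurent i f hi hc hlt hN ih =>
    rcases lt_trichotomy i j with h | rfl | h
    · refine const (.laurent i f hi hc hlt hN) fun hoj => ?_
      obtain ⟨n, hn⟩ := hoj.exists_coef h.ne'
      exact lt_asymm h (hlt n j hj hn)
    · exact ⟨hc, hN⟩
    · have hno : ¬ Occurs f i := fun hoi => absurd (ho i hi hoi) (not_le.2 h)
      have e : coef i 0 f = f := by rw [coef_of_not_occurs hno, if_pos rfl]
      have := ih 0 (by rwa [e])
      rwa [e] at this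

/-- Either none of the series variables occurs, or there is a greatest one that does. -/
theorem MemSeriesAt.exists_top {f : P.Formal b}
    (hf : MemSeriesAt P I lev b m f) :
    (∃ s ∈ P.sub (I m), f = P.expand b s) ∨
      ∃ j, lev j < m ∧ Occurs f j ∧ ∀ c, lev c < m → Occurs f c → c ≤ j := by
  induction hf with
  | base s hs => exact Or.inl ⟨s, hs, rfl⟩
  | laurent i f hi hc hlt hN ih =>
    by_cases ho : Occurs f i
    · refine Or.inr ⟨i, hi, ho, fun c hcm hoc => ?_⟩
      rcases eq_or_ne c i with rfl | hne
      · exact le_rfl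
      · obtain ⟨n, hn⟩ := hoc.exists_coef hne
        exact (hlt n c hcm hn).le
    · have e : coef i 0 f = f := by rw [coef_of_not_occurs ho, if_pos rfl]
      have := ih 0
      rwa [e] at this

theorem MemSeriesAt.smul (α : k) {f : P.Formal b} (hf : MemSeriesAt P I lev b m f) :
    MemSeriesAt P I lev b m (α • f) := by
  induction hf with
  | base s hs =>
    rw [← P.expand_smul, Algebra.smul_def, ← P.coeff.commutes]
    exact .base _ (mul_mem (coeff_mem_sub _ _) hs)
  | laurent i f hi hc hlt hN ih =>
    obtain ⟨N, hN⟩ := hN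
    refine .laurent i _ hi (fun n => ?_) (fun n c hcm ho => ?_) ⟨N, fun n hn => ?_⟩
    · rw [coef_smul]; exact ih n
    · rw [coef_smul] at ho; exact hlt n c hcm ho.of_smul
    · rw [coef_smul, hN n hn, smul_zero]

include hord in
theorem MemSeriesAt.add (hI : IsRNSeries I) (hb : IsQBasis I lev b) {f g : P.Formal b}
    (hf : MemSeriesAt P I lev b m f) (hg : MemSeriesAt P I lev b m g) :
    MemSeriesAt P I lev b m (f + g) := by
  -- reduction to the case that the variables of both summands are at most `i`, for `i` as in `Q`
  have red : ∀ {f g : P.Formal b} (Q : C → Prop), MemSeriesAt P I lev b m f →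
      MemSeriesAt P I lev b m g → (∀ c, lev c < m → Occurs f c → Q c) →
      (∀ c, lev c < m → Occurs g c → Q c) →
      (∀ i, lev i < m → Q i → ∀ f g : P.Formal b, MemSeriesAt P I lev b m f →
        MemSeriesAt P I lev b m g → (∀ c, lev c < m → Occurs f c → c ≤ i) →
        (∀ c, lev c < m → Occurs g c → c ≤ i) → MemSeriesAt P I lev b m (f + g)) →
      MemSeriesAt P I lev b m (f + g) := by
    intro f g Q hf hg hfQ hgQ H
    rcases hf.exists_top with ⟨s, hs, rfl⟩ | ⟨j, hj, hoj, hmax⟩ <;>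
    rcases hg.exists_top with ⟨t, ht, rfl⟩ | ⟨j', hj', hoj', hmax'⟩
    · rw [← P.expand_add]; exact .base _ (add_mem hs ht)
    · exact H j' hj' (hgQ j' hj' hoj') _ _ hf hg
        (fun c hc ho => absurd ho (not_occurs_of_mem_sub hI hb hs hc)) hmax'
    · exact H j hj (hfQ j hj hoj) _ _ hf hg hmax
        (fun c hc ho => absurd ho (not_occurs_of_mem_sub hI hb ht hc))
    · rcases le_total j j' with h | h
      · exact H j' hj' (hgQ j' hj' hoj') _ _ hf hg (fun c hc ho => (hmax c hc ho).trans h) hmax'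
      · exact H j hj (hfQ j hj hoj) _ _ hf hg hmax (fun c hc ho => (hmax' c hc ho).trans h)
  refine red (fun _ => True) hf hg (fun _ _ _ => trivial) (fun _ _ _ => trivial) fun i hi _ => ?_
  refine (hord.wf m).induction (C := fun i => ∀ f g : P.Formal b, MemSeriesAt P I lev b m f →
        MemSeriesAt P I lev b m g → (∀ c, lev c < m → Occurs f c → c ≤ i.1) →
        (∀ c, lev c < m → Occurs g c → c ≤ i.1) → MemSeriesAt P I lev b m (f + g)) ⟨i, hi⟩ ?_
  rintro ⟨i, hi⟩ ih f g hf hg hof hog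
  obtain ⟨hcf, N, hN⟩ := hf.coef_mem hI hb hi hof
  obtain ⟨hcg, M, hM⟩ := hg.coef_mem hI hb hi hog
  have lt : ∀ {f : P.Formal b}, (∀ c, lev c < m → Occurs f c → c ≤ i) → ∀ n c, lev c < m →
      Occurs (coef i n f) c → c < i := fun h n c hc ho =>
    lt_of_le_of_ne (h c hc ho.of_coef.2) ho.of_coef.1
  refine .laurent i _ hi (fun n => ?_) (fun n c hc ho => ?_) ⟨max N M, fun n hn => ?_⟩
  · rw [coef_add]
    exact red (· < i) (hcf n) (hcg n) (lt hof n) (lt hog n) fun i' hi' hlt => ih ⟨i', hi'⟩ hlt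
  · rw [coef_add] at ho
    exact ho.of_add.elim (lt hof n c hc) (lt hog n c hc)
  · rw [coef_add, hN n (by omega), hM n (by omega), add_zero]

/-- The elements of `R_m((H / H_m))` whose series variables satisfy `q`. -/
def part (hI : IsRNSeries I) (hb : IsQBasis I lev b) (P : CrossedProduct k K H S) (m : ℕ)
    (q : C → Prop) : Submodule k (P.Formal b) where
  carrier := {f | MemSeriesAt P I lev b m f ∧ ∀ c, lev c < m → Occurs f c → q c}
  zero_mem' := ⟨.zero, fun c _ h => absurd h (not_occurs_zero c)⟩
  add_mem' := fun hf hg => ⟨hf.1.add hord hI hb hg.1, fun c hc ho =>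
    ho.of_add.elim (hf.2 c hc) (hg.2 c hc)⟩
  smul_mem' := fun α _ hf => ⟨hf.1.smul α, fun c hc ho => hf.2 c hc ho.of_smul⟩

/-- The basis elements that belong to `R_m((N))`, for the ideal `N` spanned by the basis elements
satisfying `q`. -/
def vars (lev : C → ℕ) (m : ℕ) (q : C → Prop) : Set C := {c | lev c < m → q c}

theorem part_mono {q q' : C → Prop} (h : ∀ c, q c → q' c) :
    part hord hI hb P m q ≤ part hord hI hb P m q' :=
  fun _ hf => ⟨hf.1, fun c hc ho => h c (hf.2 c hc ho)⟩

theorem mem_part_false {f : P.Formal b} :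
    f ∈ part hord hI hb P m (fun _ => False) ↔ ∃ s ∈ P.sub (I m), f = P.expand b s := by
  constructor
  · rintro ⟨hf, ho⟩
    exact (hf.exists_top).resolve_right fun ⟨j, hj, hoj, _⟩ => ho j hj hoj
  · rintro ⟨s, hs, rfl⟩
    exact ⟨.base s hs, fun c hc => not_occurs_of_mem_sub hI hb hs hc⟩

/-- An element in series variables less than `j` belongs to one of the earlier rings. -/
theorem exists_part {q : C → Prop} {f : P.Formal b} (hf : f ∈ part hord hI hb P m q) :
    f ∈ part hord hI hb P m (fun _ => False) ∨
      ∃ i, lev i < m ∧ q i ∧ f ∈ part hord hI hb P m (· ≤ i) := by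
  rcases hf.1.exists_top with h | ⟨j, hj, hoj, hmax⟩
  · exact Or.inl ((mem_part_false hord hI hb).2 h)
  · exact Or.inr ⟨j, hj, hf.2 j hj hoj, hf.1, hmax⟩

/-- The ring at `j` consists of the series in `ū_j⁻¹` with coefficients in the earlier rings. -/
theorem laurentSub_part {j : C} (hj : lev j < m) :
    laurentSub (part hord hI hb P m (· < j)) j = part hord hI hb P m (· ≤ j) := by
  ext f
  constructor
  · rintro ⟨hf, hN⟩
    refine ⟨.laurent j f hj (fun n => (hf n).1) (fun n => (hf n).2) hN, fun c hc ho => ?_⟩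
    rcases eq_or_ne c j with rfl | hne
    · exact le_rfl
    · obtain ⟨n, hn⟩ := ho.exists_coef hne
      exact ((hf n).2 c hc hn).le
  · rintro ⟨hf, ho⟩
    have := hf.coef_mem hI hb hj ho
    exact ⟨fun n => ⟨this.1 n, fun c hc hoc =>
      lt_of_le_of_ne (ho c hc hoc.of_coef.2) hoc.of_coef.1⟩, this.2⟩

theorem lt_of_occurs_part {j : C} (hj : lev j < m) {f : P.Formal b}
    (hf : f ∈ part hord hI hb P m (· < j)) (c : C) (hc : Occurs f c) : c < j := by
  by_cases h : lev c < m
  · exact hf.2 c h hc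
  · exact hord.lt_of_lev _ _ (by omega)

include hord in
theorem lie_mem_span_vars (hI : IsRNSeries I) (hb : IsQBasis I lev b) (j : C) (x : H) :
    ⁅x, b j⁆ ∈ Submodule.span k (b '' vars lev m (· < j)) := by
  have h : {c | lev j < lev c} ⊆ vars lev m (· < j) := fun _ hc _ => hord.lt_of_lev _ _ hc
  exact Submodule.span_mono (Set.image_mono h) (lie_mem_span hI hb x j)

/-! ### The tower consists of rings -/

/-- The tower begins with the ring `R_m = K * U(H_m)`. -/
theorem isGood_base :
    IsGood (ops P b hord m) (part hord hI hb P m fun _ => False) (vars lev m fun _ => False) := by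
  have hcong : IsGood (baseOps P b) (part hord hI hb P m fun _ => False)
      (vars lev m fun _ => False) := by
    have key : ∀ {f : P.Formal b}, f ∈ part hord hI hb P m (fun _ => False) →
        ∃ s ∈ P.sub (I m), f = P.expand b s := (mem_part_false hord hI hb).1
    have mem : ∀ {s}, s ∈ P.sub (I m) → P.expand b s ∈ part hord hI hb P m (fun _ => False) :=
      fun {s} hs => (mem_part_false hord hI hb).2 ⟨s, hs, rfl⟩
    have hV : ∀ {c}, c ∈ vars lev m (fun _ => False) → P.bar (b c) ∈ P.sub (I m) := fun hc =>
      bar_mem_sub ((hb.basis_mem_iff hI).2 (not_lt.1 hc))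
    refine
      { coeff_mem := fun a => mem (coeff_mem_sub _ a), bar_mem := fun hc => mem (hV hc),
        mul_mem := ?mul_mem, add_mul := ?add_mul, mul_add := ?mul_add, mul_assoc := ?mul_assoc,
        smul_mul := ?smul_mul, mul_smul := ?mul_smul, one_mul := ?one_mul, mul_one := ?mul_one,
        expand_mul := fun _ _ => baseOps_mul _ _, der_mem := ?der_mem, der_add := ?der_add,
        der_smul := ?der_smul, der_mul := ?der_mul, der_expand := fun x _ _ => baseOps_der x _,
        der_add_left := ?der_add_left, der_smul_left := ?der_smul_left, der_comm := ?der_comm,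
        der_bar := ?der_bar }
    case mul_mem =>
      intro f g hf hg
      obtain ⟨s, hs, rfl⟩ := key hf; obtain ⟨t, ht, rfl⟩ := key hg
      rw [baseOps_mul]; exact mem (mul_mem hs ht)
    case der_mem =>
      intro x f hf
      obtain ⟨s, hs, rfl⟩ := key hf
      rw [baseOps_der]; exact mem (commutator_mem_sub x hs)
    case add_mul | mul_add | mul_assoc =>
      intro f g g' hf hg hg'
      obtain ⟨s, hs, rfl⟩ := key hf; obtain ⟨t, ht, rfl⟩ := key hg; obtain ⟨r, hr, rfl⟩ := key hg'
      simp only [← expand_add, baseOps_mul, _root_.add_mul, _root_.mul_add, _root_.mul_assoc]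
    case smul_mul | mul_smul =>
      intro α f g hf hg
      obtain ⟨s, hs, rfl⟩ := key hf; obtain ⟨t, ht, rfl⟩ := key hg
      simp only [← expand_smul, baseOps_mul, smul_mul_assoc, mul_smul_comm]
    case one_mul | mul_one =>
      intro f hf
      obtain ⟨s, hs, rfl⟩ := key hf
      simp only [baseOps_mul, _root_.one_mul, _root_.mul_one]
    case der_add =>
      intro x f g hf hg
      obtain ⟨s, hs, rfl⟩ := key hf; obtain ⟨t, ht, rfl⟩ := key hg
      rw [← expand_add, baseOps_der, baseOps_der, baseOps_der, ← expand_add]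
      congr 1; noncomm_ring
    case der_smul =>
      intro x α f hf
      obtain ⟨s, hs, rfl⟩ := key hf
      rw [← expand_smul, baseOps_der, baseOps_der, ← expand_smul, mul_smul_comm, smul_mul_assoc,
        smul_sub]
    case der_mul =>
      intro x f g hf hg
      obtain ⟨s, hs, rfl⟩ := key hf; obtain ⟨t, ht, rfl⟩ := key hg
      rw [baseOps_mul, baseOps_der, baseOps_der, baseOps_der, baseOps_mul, baseOps_mul,
        ← expand_add]
      congr 1; noncomm_ring
    case der_add_left =>
      intro x y f hf
      obtain ⟨s, hs, rfl⟩ := key hf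
      rw [baseOps_der, baseOps_der, baseOps_der, ← expand_add, map_add]
      congr 1; noncomm_ring
    case der_smul_left =>
      intro α x f hf
      obtain ⟨s, hs, rfl⟩ := key hf
      rw [baseOps_der, baseOps_der, ← expand_smul, map_smul, mul_smul_comm, smul_mul_assoc,
        smul_sub]
    case der_comm =>
      intro x y f hf
      obtain ⟨s, hs, rfl⟩ := key hf
      rw [baseOps_der, baseOps_der, baseOps_der, baseOps_der, baseOps_der, baseOps_mul,
        baseOps_mul, ← expand_sub, ← expand_sub, ← expand_add,
        eq_sub_of_add_eq (P.bar_comm x y).symm]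
      congr 1; noncomm_ring
    case der_bar =>
      intro c hc f hf
      obtain ⟨s, hs, rfl⟩ := key hf
      rw [baseOps_der, baseOps_mul, baseOps_mul, ← expand_sub]
  refine hcong.congr (fun f hf g hg => ?_) fun x f hf => ?_
  · exact union_of_not_top fun i hi => hi.1.2.elim (hf.2 i hi.1.1) (hg.2 i hi.1.1)
  · exact union_der_of_not_top x fun i hi => hi.1.2.elim (hf.2 i hi.1.1) (hf.2 i hi.1.1)

/-- The rings up to the elements satisfying `q` have a union that is a ring. -/
theorem isGood_union {q : C → Prop} (hq : ∀ i, lev i < m → q i →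
      IsGood (ops P b hord m) (part hord hI hb P m (· ≤ i)) (vars lev m (· ≤ i)))
    (hdown : ∀ c d, c ≤ d → q d → q c) :
    IsGood (ops P b hord m) (part hord hI hb P m q) (vars lev m q) := by
  have hle : ∀ {i}, q i → part hord hI hb P m (· ≤ i) ≤ part hord hI hb P m q :=
    fun hi => part_mono hord hI hb fun c hc => hdown _ _ hc hi
  have hF : ∀ q' : C → Prop, part hord hI hb P m (fun _ => False) ≤ part hord hI hb P m q' :=
    fun q' => part_mono hord hI hb fun c hc => hc.elim
  have two : ∀ {i i'}, lev i < m → lev i' < m → q i → q i' → ∃ l, lev l < m ∧ q l ∧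
      part hord hI hb P m (· ≤ i) ≤ part hord hI hb P m (· ≤ l) ∧
      part hord hI hb P m (· ≤ i') ≤ part hord hI hb P m (· ≤ l) := by
    intro i i' hi hi' hqi hqi'
    rcases le_total i i' with h | h
    · exact ⟨i', hi', hqi', part_mono hord hI hb fun c hc => hc.trans h, le_rfl⟩
    · exact ⟨i, hi, hqi, le_rfl, part_mono hord hI hb fun c hc => hc.trans h⟩
  refine IsGood.of_directed ?_ ?_
  · intro f hf g hg g' hg'
    rcases exists_part hord hI hb hf with h1 | ⟨i, hi, hqi, h1⟩ <;>
    rcases exists_part hord hI hb hg with h2 | ⟨i', hi', hqi', h2⟩ <;>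
    rcases exists_part hord hI hb hg' with h3 | ⟨i'', hi'', hqi'', h3⟩
    · exact ⟨_, _, hF q, isGood_base hord hI hb, h1, h2, h3⟩
    · exact ⟨_, _, hle hqi'', hq _ hi'' hqi'', hF _ h1, hF _ h2, h3⟩
    · exact ⟨_, _, hle hqi', hq _ hi' hqi', hF _ h1, h2, hF _ h3⟩
    · obtain ⟨l, hl, hql, e1, e2⟩ := two hi' hi'' hqi' hqi''
      exact ⟨_, _, hle hql, hq _ hl hql, hF _ h1, e1 h2, e2 h3⟩
    · exact ⟨_, _, hle hqi, hq _ hi hqi, h1, hF _ h2, hF _ h3⟩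
    · obtain ⟨l, hl, hql, e1, e2⟩ := two hi hi'' hqi hqi''
      exact ⟨_, _, hle hql, hq _ hl hql, e1 h1, hF _ h2, e2 h3⟩
    · obtain ⟨l, hl, hql, e1, e2⟩ := two hi hi' hqi hqi'
      exact ⟨_, _, hle hql, hq _ hl hql, e1 h1, e2 h2, hF _ h3⟩
    · obtain ⟨l, hl, hql, e1, e2⟩ := two hi hi' hqi hqi'
      obtain ⟨l', hl', hql', e1', e2'⟩ := two hl hi'' hql hqi''
      exact ⟨_, _, hle hql', hq _ hl' hql', e1' (e1 h1), e1' (e2 h2), e2' h3⟩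
  · intro c hc f hf
    by_cases hcm : lev c < m
    · rcases exists_part hord hI hb hf with h1 | ⟨i, hi, hqi, h1⟩
      · exact ⟨_, _, hle (hc hcm), hq c hcm (hc hcm), hF _ h1, fun _ => le_rfl⟩
      · rcases le_total c i with h | h
        · exact ⟨_, _, hle hqi, hq i hi hqi, h1, fun _ => h⟩
        · exact ⟨_, _, hle (hc hcm), hq c hcm (hc hcm),
            part_mono hord hI hb (fun d hd => hd.trans h) h1, fun _ => le_rfl⟩
    · rcases exists_part hord hI hb hf with h1 | ⟨i, hi, hqi, h1⟩
      · exact ⟨_, _, hF q, isGood_base hord hI hb, h1, fun h => absurd h hcm⟩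
      · exact ⟨_, _, hle hqi, hq i hi hqi, h1, fun h => absurd h hcm⟩

theorem commutator_mem_part {j : C}
    (h : IsGood (ops P b hord m) (part hord hI hb P m (· < j)) (vars lev m (· < j))) (x : H) :
    P.expand b (P.bar x * P.bar (b j) - P.bar (b j) * P.bar x) ∈ part hord hI hb P m (· < j) := by
  rw [commutator_eq, expand_add]
  exact add_mem (h.der_span (lie_mem_span_vars hord hI hb j x)).1 (h.coeff_mem _)

/-- On the ring at `j`, the operations of the whole tower are those of the ring of series in
`ū_j⁻¹`. -/
theorem ops_eq_laurent {j : C} (hj : lev j < m)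
    (h : IsGood (ops P b hord m) (part hord hI hb P m (· < j)) (vars lev m (· < j))) :
    (∀ f ∈ part hord hI hb P m (· ≤ j), ∀ g ∈ part hord hI hb P m (· ≤ j),
      (ops P b hord m).mul f g = ((ops P b hord m).laurent j).mul f g) ∧
    ∀ x, ∀ f ∈ part hord hI hb P m (· ≤ j),
      (ops P b hord m).der x f = ((ops P b hord m).laurent j).der x f := by
  have hA := fun f hf => lt_of_occurs_part (P := P) hord hI hb hj (f := f) hf
  have hw := commutator_mem_part hord hI hb h
  have cong := laurent_congr (j := j)
    (O' := union P lev b m (fun i => i.1 < j) fun i _ => opsUpTo P b hord m i)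
    (fun f hf => h.der_mem (b j) hf) hw
    (fun f hf g hg => union_lt_eq_ops hord ⟨j, hj⟩ hf.2 hg.2)
    (fun x f hf => union_lt_der_eq_ops hord ⟨j, hj⟩ x hf.2)
  rw [laurentSub_part hord hI hb hj, ← opsUpTo_eq hord ⟨j, hj⟩] at cong
  have lt : ∀ f ∈ part hord hI hb P m (· ≤ j), ¬ Occurs f j → f ∈ part hord hI hb P m (· < j) :=
    fun f hf hno => ⟨hf.1, fun c hc ho => lt_of_le_of_ne (hf.2 c hc ho) (by
      rintro rfl; exact hno ho)⟩
  have hmem := h.laurent_of_mem hA hw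
  refine ⟨fun f hf g hg => ?_, fun x f hf => ?_⟩
  · by_cases ho : Occurs f j ∨ Occurs g j
    · rw [← cong.1 f hf g hg]
      exact union_of_top (i := ⟨j, hj⟩) trivial
        ⟨⟨hj, ho⟩, fun c hc => hc.2.elim (hf.2 c hc.1) (hg.2 c hc.1)⟩
    · rw [not_or] at ho
      rw [hmem.1 f (lt f hf ho.1) g (lt g hg ho.2)]
  · by_cases ho : Occurs f j
    · rw [← cong.2 x f hf]
      exact union_der_of_top x (i := ⟨j, hj⟩) trivial
        ⟨⟨hj, Or.inl ho⟩, fun c hc => hc.2.elim (hf.2 c hc.1) (hf.2 c hc.1)⟩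
    · rw [hmem.2 x f (lt f hf ho)]

/-- The ring obtained at `j` is good, by transfinite induction on `j`. -/
theorem isGood_le {j : C} (hj : lev j < m) :
    IsGood (ops P b hord m) (part hord hI hb P m (· ≤ j)) (vars lev m (· ≤ j)) := by
  refine (hord.wf m).induction (C := fun j => IsGood (ops P b hord m)
    (part hord hI hb P m (· ≤ j.1)) (vars lev m (· ≤ j.1))) ⟨j, hj⟩ ?_
  rintro ⟨j, hj⟩ ih
  have hlt : IsGood (ops P b hord m) (part hord hI hb P m (· < j)) (vars lev m (· < j)) :=
    isGood_union hord hI hb (fun i hi hij => ih ⟨i, hi⟩ hij) fun c d hcd hd => hcd.trans_lt hd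
  have := hlt.laurent (fun f hf => lt_of_occurs_part hord hI hb hj hf)
    (lie_mem_span_vars hord hI hb j)
  have e := ops_eq_laurent hord hI hb hj hlt
  rw [laurentSub_part hord hI hb hj] at this
  have hv : insert j (vars lev m (· < j)) = vars lev m (· ≤ j) := by
    ext c
    simp only [vars, Set.mem_insert_iff, Set.mem_ofPred_eq, le_iff_lt_or_eq]
    tauto
  rw [hv] at this
  exact this.congr e.1 e.2

theorem isGood_part {q : C → Prop} (hdown : ∀ c d, c ≤ d → q d → q c) :
    IsGood (ops P b hord m) (part hord hI hb P m q) (vars lev m q) :=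
  isGood_union hord hI hb (fun _ hi _ => isGood_le hord hI hb hi) hdown

theorem isGood_lt (j : C) :
    IsGood (ops P b hord m) (part hord hI hb P m (· < j)) (vars lev m (· < j)) :=
  isGood_part hord hI hb fun _ _ hcd hd => hcd.trans_lt hd

end CrossedProduct

end
noncomputable section

open Module

namespace CrossedProduct

variable {k : Type v} {K : Type w} {H C : Type u} {S : Type w'}
  [Field k] [DivisionRing K] [Algebra k K] [LieRing H] [LieAlgebra k H] [Ring S] [Algebra k S]
  [LinearOrder C] {P : CrossedProduct k K H S} {b : Basis C k H}
  {I : ℕ → LieIdeal k H} {lev : C → ℕ}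

/-- A series whose leading coefficient is invertible is invertible. -/
theorem IsGood.exists_inv {O : Ops P b} {A : Submodule k (P.Formal b)} {V : Set C}
    (h : IsGood O A V) {j : C} (hA : ∀ f ∈ A, ∀ c, Occurs f c → c < j) {f a : P.Formal b}
    (hf : f ∈ laurentSub A j) {p : ℤ} (hp : ∀ n, p < n → coef j n f = 0) (ha : a ∈ A)
    (h1 : O.mul (coef j p f) a = P.expand b 1) (h2 : O.mul a (coef j p f) = P.expand b 1) :
    ∃ g ∈ laurentSub A j, (O.laurent j).mul f g = P.expand b 1 ∧
      (O.laurent j).mul g f = P.expand b 1 := by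
  have hlift : SkewLaurent.BddDeg p (h.lift j f) := fun n hn => h.val_injective (by
    rw [h.val_lift_of_mem hf, hp n hn, map_zero])
  obtain ⟨q, G, hG, hfG, hGf⟩ := SkewLaurent.exists_inv (h.delta_mul (b j)) hlift (a := h.elt ha)
    (h.val_injective (by rw [h.val_mul, h.val_lift_of_mem hf]; exact h1))
    (h.val_injective (by rw [h.val_mul, h.val_lift_of_mem hf]; exact h2))
  have hg := h.glue_mem hA hG
  have e1 := le_laurentSub hA h.one_mem
  refine ⟨_, hg, ?_, ?_⟩
  · refine h.lift_injective (h.laurent_mul_mem hA hf hg) e1 ?_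
    rw [h.lift_mul hA hf hg, h.lift_glue hA, hfG, h.lift_one hA]
  · refine h.lift_injective (h.laurent_mul_mem hA hg hf) e1 ?_
    rw [h.lift_mul hA hg hf, h.lift_glue hA, hGf, h.lift_one hA]

variable (hord : IsCanonicalOrder lev) (hI : IsRNSeries I) (hb : IsQBasis I lev b) {m n : ℕ}

/-! ### The direct limit of the rings of the tower -/

theorem isGood_top :
    IsGood (ops P b hord m) (part hord hI hb P m fun _ => True) Set.univ := by
  have := isGood_part (P := P) hord hI hb (m := m) (q := fun _ => True) fun _ _ _ _ => trivial
  have e : vars lev m (fun _ => True) = Set.univ := Set.eq_univ_of_forall fun c _ => trivial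
  rwa [e] at this

theorem mem_part_top {f : P.Formal b} :
    f ∈ part hord hI hb P m (fun _ => True) ↔ MemSeriesAt P I lev b m f :=
  ⟨fun h => h.1, fun h => ⟨h, fun _ _ _ => trivial⟩⟩

section

include hord hI hb

/-- Each of the rings `R_m((H / H_m))` contains `K * U(H)`. -/
theorem memSeriesAt_expand (s : S) : MemSeriesAt P I lev b m (P.expand b s) := by
  have h := isGood_top (P := P) hord hI hb (m := m)
  rw [← mem_part_top hord hI hb]
  have hmul : ∀ {s t : S}, P.expand b s ∈ part hord hI hb P m (fun _ => True) →
      P.expand b t ∈ part hord hI hb P m (fun _ => True) →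
      P.expand b (s * t) ∈ part hord hI hb P m (fun _ => True) := fun hs ht => by
    rw [← h.expand_mul hs ht]; exact h.mul_mem hs ht
  let Y : Submonoid S :=
    { carrier := {s | P.expand b s ∈ part hord hI hb P m (fun _ => True)}
      mul_mem' := hmul
      one_mem' := h.one_mem }
  refine P.monSpan_le (b := b) (E := Set.univ)
    (Y := (part hord hI hb P m (fun _ => True)).toAddSubgroup.comap (P.expandHom b))
    (fun e _ a => ?_) (P.mem_monSpan_univ s)
  refine hmul (h.coeff_mem a) (Submonoid.list_prod_mem Y fun y hy => ?_)
  obtain ⟨c, -, rfl⟩ := List.mem_map.1 hy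
  exact pow_mem (S := Y) (h.bar_mem (Set.mem_univ c)) _

/-- As sets of formal sums, the rings `R_m((H / H_m))` increase with `m`. -/
theorem MemSeriesAt.mono (hmn : m ≤ n) {f : P.Formal b} (hf : MemSeriesAt P I lev b m f) :
    MemSeriesAt P I lev b n f := by
  induction hf with
  | base s hs => exact memSeriesAt_expand hord hI hb s
  | laurent j f hj hc hlt hN ih =>
    refine .laurent j f (by omega) ih (fun l c _ hoc => ?_) hN
    by_cases hcm : lev c < m
    · exact hlt l c hcm hoc
    · exact hord.lt_of_lev _ _ (by omega)

theorem part_le_part (hmn : m ≤ n) {q : C → Prop} (hq : ∀ c, m ≤ lev c → q c) :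
    part hord hI hb P m q ≤ part hord hI hb P n q := fun f hf =>
  ⟨hf.1.mono hord hI hb hmn, fun c _ hoc => by
    by_cases h : lev c < m
    · exact hf.2 c h hoc
    · exact hq c (not_lt.1 h)⟩

/-- If the operations for `m` and `n` agree on the rings at the elements satisfying `q`, then they
agree on the union of these rings. -/
theorem ops_eq_ops_of_forall_le {q : C → Prop}
    (hq : ∀ i, lev i < m → q i →
      (∀ f ∈ part hord hI hb P m (· ≤ i), ∀ g ∈ part hord hI hb P m (· ≤ i),
        (ops P b hord n).mul f g = (ops P b hord m).mul f g) ∧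
      ∀ x, ∀ f ∈ part hord hI hb P m (· ≤ i), (ops P b hord n).der x f = (ops P b hord m).der x f) :
    (∀ f ∈ part hord hI hb P m q, ∀ g ∈ part hord hI hb P m q,
        (ops P b hord n).mul f g = (ops P b hord m).mul f g) ∧
      ∀ x, ∀ f ∈ part hord hI hb P m q, (ops P b hord n).der x f = (ops P b hord m).der x f := by
  have hF : ∀ i, part hord hI hb P m (fun _ => False) ≤ part hord hI hb P m (· ≤ i) :=
    fun i => part_mono hord hI hb fun c hc => hc.elim
  have hm := isGood_top (P := P) hord hI hb (m := m)
  have hn := isGood_top (P := P) hord hI hb (m := n)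
  have mm := fun s => (mem_part_top hord hI hb).2
    (memSeriesAt_expand (m := m) hord hI hb (P := P) s)
  have mn := fun s => (mem_part_top hord hI hb).2
    (memSeriesAt_expand (m := n) hord hI hb (P := P) s)
  refine ⟨fun f hf g hg => ?_, fun x f hf => ?_⟩
  · rcases exists_part hord hI hb hf with h1 | ⟨i, hi, hqi, h1⟩ <;>
    rcases exists_part hord hI hb hg with h2 | ⟨i', hi', hqi', h2⟩
    · obtain ⟨s, -, rfl⟩ := (mem_part_false hord hI hb).1 h1
      obtain ⟨t, -, rfl⟩ := (mem_part_false hord hI hb).1 h2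
      rw [hm.expand_mul (mm s) (mm t), hn.expand_mul (mn s) (mn t)]
    · exact (hq i' hi' hqi').1 f (hF _ h1) g h2
    · exact (hq i hi hqi).1 f h1 g (hF _ h2)
    · rcases le_total i i' with h | h
      · exact (hq i' hi' hqi').1 f (part_mono hord hI hb (fun c hc => hc.trans h) h1) g h2
      · exact (hq i hi hqi).1 f h1 g (part_mono hord hI hb (fun c hc => hc.trans h) h2)
  · rcases exists_part hord hI hb hf with h1 | ⟨i, hi, hqi, h1⟩
    · obtain ⟨s, -, rfl⟩ := (mem_part_false hord hI hb).1 h1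
      rw [hm.der_expand x (mm s), hn.der_expand x (mn s)]
    · exact (hq i hi hqi).2 x f h1

/-- The operations for `m` and `n` agree on the ring at `j`, by transfinite induction on `j`: both
are given by series in `ū_j⁻¹` with coefficients in the earlier rings. -/
theorem ops_eq_ops_le (hmn : m ≤ n) {j : C} (hj : lev j < m) :
    (∀ f ∈ part hord hI hb P m (· ≤ j), ∀ g ∈ part hord hI hb P m (· ≤ j),
        (ops P b hord n).mul f g = (ops P b hord m).mul f g) ∧
      ∀ x, ∀ f ∈ part hord hI hb P m (· ≤ j),
        (ops P b hord n).der x f = (ops P b hord m).der x f := by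
  refine (hord.wf m).induction (C := fun j =>
    (∀ f ∈ part hord hI hb P m (· ≤ j.1), ∀ g ∈ part hord hI hb P m (· ≤ j.1),
        (ops P b hord n).mul f g = (ops P b hord m).mul f g) ∧
      ∀ x, ∀ f ∈ part hord hI hb P m (· ≤ j.1),
        (ops P b hord n).der x f = (ops P b hord m).der x f) ⟨j, hj⟩ ?_
  rintro ⟨j, hj⟩ ih
  have hlt := ops_eq_ops_of_forall_le (P := P) (n := n) hord hI hb (q := (· < j))
    fun i hi hij => ih ⟨i, hi⟩ hij
  have gm := isGood_lt (P := P) (m := m) hord hI hb j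
  have e := ops_eq_laurent hord hI hb hj gm
  have e' := ops_eq_laurent hord hI hb (by omega) (isGood_lt (P := P) (m := n) hord hI hb j)
  have cong := laurent_congr (j := j) (fun f hf => gm.der_mem (b j) hf)
    (commutator_mem_part hord hI hb gm) hlt.1 hlt.2
  rw [laurentSub_part hord hI hb hj] at cong
  have hle := part_le_part (P := P) hord hI hb hmn (q := (· ≤ j))
    fun c hc => (hord.lt_of_lev c j (by omega)).le
  exact ⟨fun f hf g hg => by rw [e'.1 f (hle hf) g (hle hg), e.1 f hf g hg, cong.1 f hf g hg],
    fun x f hf => by rw [e'.2 x f (hle hf), e.2 x f hf, cong.2 x f hf]⟩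

theorem ops_der_eq_of_le (hmn : m ≤ n) (x : H) {f : P.Formal b} (hf : MemSeriesAt P I lev b m f) :
    (ops P b hord n).der x f = (ops P b hord m).der x f :=
  (ops_eq_ops_of_forall_le hord hI hb (q := fun _ => True)
    fun _ hi _ => ops_eq_ops_le hord hI hb hmn hi).2 x _ ((mem_part_top hord hI hb).2 hf)

/-- The inclusions between the rings `R_m((H / H_m))` are homomorphisms. -/
theorem ops_mul_eq_of_le (hmn : m ≤ n) {f g : P.Formal b} (hf : MemSeriesAt P I lev b m f)
    (hg : MemSeriesAt P I lev b m g) : (ops P b hord n).mul f g = (ops P b hord m).mul f g :=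
  (ops_eq_ops_of_forall_le hord hI hb (q := fun _ => True)
    fun _ hi _ => ops_eq_ops_le hord hI hb hmn hi).1 _ ((mem_part_top hord hI hb).2 hf) _
    ((mem_part_top hord hI hb).2 hg)

/-- The product in `K((H))` may be computed in any of the rings `R_m((H / H_m))` that contain both
factors. -/
theorem seriesMul_eq {f g : P.Formal b} (hf : MemSeriesAt P I lev b m f)
    (hg : MemSeriesAt P I lev b m g) : seriesMul P I b hord f g = (ops P b hord m).mul f g := by
  have hmem : m ∈ {m | MemSeriesAt P I lev b m f ∧ MemSeriesAt P I lev b m g} := ⟨hf, hg⟩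
  have hs := Nat.sInf_mem ⟨m, hmem⟩
  exact (ops_mul_eq_of_le hord hI hb (Nat.sInf_le hmem) hs.1 hs.2).symm

end

variable (P b I) in
/-- The operations on `K((H))`: those of any of the rings `R_m((H / H_m))` which contain the
operands. -/
def limitOps (hord : IsCanonicalOrder lev) : Ops P b where
  mul := seriesMul P I b hord
  der x f := (ops P b hord (sInf {m | MemSeriesAt P I lev b m f})).der x f

include hI hb in
theorem limitOps_der_eq (x : H) {f : P.Formal b} (hf : MemSeriesAt P I lev b m f) :
    (limitOps P b I hord).der x f = (ops P b hord m).der x f := by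
  have hmem : m ∈ {m | MemSeriesAt P I lev b m f} := hf
  exact (ops_der_eq_of_le hord hI hb (Nat.sInf_le hmem) x (Nat.sInf_mem ⟨m, hmem⟩)).symm

/-- The elements of `K((H))`. -/
def series (hI : IsRNSeries I) (hb : IsQBasis I lev b) (P : CrossedProduct k K H S) :
    Submodule k (P.Formal b) where
  carrier := {f | MemSeries P I lev b f}
  zero_mem' := ⟨0, .zero⟩
  add_mem' := by
    rintro f g ⟨m, hf⟩ ⟨n, hg⟩
    exact ⟨max m n, (hf.mono hord hI hb (le_max_left _ _)).add hord hI hb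
      (hg.mono hord hI hb (le_max_right _ _))⟩
  smul_mem' := fun α _ ⟨m, hf⟩ => ⟨m, hf.smul α⟩

/-- `K((H))` is the union of the good rings `R_m((H / H_m))`. -/
theorem isGood_series : IsGood (limitOps P b I hord) (series hord hI hb P) Set.univ := by
  have hm : ∀ m, IsGood (limitOps P b I hord) (part hord hI hb P m fun _ => True) Set.univ :=
    fun m => (isGood_top hord hI hb).congr (fun f hf g hg => seriesMul_eq hord hI hb hf.1 hg.1)
      fun x f hf => limitOps_der_eq hord hI hb x hf.1
  have hle : ∀ m, part hord hI hb P m (fun _ => True) ≤ series hord hI hb P :=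
    fun m f hf => ⟨m, hf.1⟩
  have mem : ∀ {m n : ℕ} {f : P.Formal b}, MemSeriesAt P I lev b m f → m ≤ n →
      f ∈ part hord hI hb P n (fun _ => True) := fun hf h =>
    (mem_part_top hord hI hb).2 (hf.mono hord hI hb h)
  refine IsGood.of_directed ?_ fun c hc f ⟨m, hf⟩ => ⟨_, _, hle m, hm m, mem hf le_rfl, trivial⟩
  rintro f ⟨m, hf⟩ g ⟨n, hg⟩ h ⟨l, hh⟩
  exact ⟨_, _, hle (max m (max n l)), hm _, mem hf (by omega), mem hg (by omega),
    mem hh (by omega)⟩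

/-! ### Inverses -/

/-- The formal sum `f` has an inverse in one of the rings `R_n((H / H_n))`, `n ≥ m`, in which all
variables are bounded by those of `f`. -/
def HasInv (hord : IsCanonicalOrder lev) (I : ℕ → LieIdeal k H) (m : ℕ) (f : P.Formal b) : Prop :=
  ∃ n g, m ≤ n ∧ MemSeriesAt P I lev b n g ∧ (ops P b hord n).mul f g = P.expand b 1 ∧
    (ops P b hord n).mul g f = P.expand b 1 ∧
    ∀ i, (∀ c, Occurs f c → c < i) → ∀ c, Occurs g c → c < i

/-- The leading coefficients reduce the existence of inverses to elements of `K * U(H_m)`. -/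
theorem MemSeriesAt.hasInv_of_base (hI : IsRNSeries I) (hb : IsQBasis I lev b) (Z : Set C)
    (hbase : ∀ s ∈ P.sub (I m), s ≠ 0 → (∀ c, Occurs (P.expand b s) c → c ∈ Z) →
      HasInv hord I m (P.expand b s)) {f : P.Formal b} (hf : MemSeriesAt P I lev b m f)
    (h0 : f ≠ 0) (hZ : ∀ c, Occurs f c → c ∈ Z) : HasInv hord I m f := by
  induction hf with
  | base s hs => exact hbase s hs (by rintro rfl; exact h0 (P.expand_zero b)) hZ
  | laurent j f hj hc hlt hN ih =>
    by_cases ho : Occurs f j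
    swap
    · have e : coef j 0 f = f := by rw [coef_of_not_occurs ho, if_pos rfl]
      have := ih 0
      rw [e] at this
      exact this h0 hZ
    obtain ⟨N, hN⟩ := hN
    obtain ⟨p, hp, hmax⟩ : ∃ p, coef j p f ≠ 0 ∧ ∀ n, coef j n f ≠ 0 → n ≤ p := by
      refine Int.exists_greatest_of_bdd ⟨N, fun n hn => ?_⟩ ?_
      · by_contra h; exact hn (hN n (not_le.1 h))
      · by_contra! h
        exact h0 (ext_coef (j := j) fun n => by rw [h n, coef_zero])
    obtain ⟨n, a, hmn, ha, h1, h2, hao⟩ := ih p hp fun c hoc => hZ c hoc.of_coef.2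
    have hjn : lev j < n := by omega
    have hlt' : ∀ l c, Occurs (coef j l f) c → c < j := fun l c hoc => by
      by_cases hcm : lev c < m
      · exact hlt l c hcm hoc
      · exact hord.lt_of_lev _ _ (by omega)
    have haj := hao j (hlt' p)
    have hg := isGood_lt (P := P) (m := n) hord hI hb j
    have hfl : f ∈ laurentSub (part hord hI hb P n (· < j)) j :=
      ⟨fun l => ⟨(hc l).mono hord hI hb hmn, fun c _ => hlt' l c⟩, N, hN⟩
    obtain ⟨g, hgl, hfg, hgf⟩ := hg.exists_inv
      (fun f hf => lt_of_occurs_part hord hI hb hjn hf) hfl (p := p)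
      (fun l hl => by by_contra h; exact absurd (hmax l h) (not_le.2 hl))
      (a := a) ⟨ha, fun c _ => haj c⟩ h1 h2
    rw [laurentSub_part hord hI hb hjn] at hfl hgl
    have e := ops_eq_laurent hord hI hb hjn hg
    refine ⟨n, g, hmn, hgl.1, by rw [e.1 f hfl g hgl, hfg], by rw [e.1 g hgl f hfl, hgf],
      fun i hi c hoc => lt_of_le_of_lt ?_ (hi j ho)⟩
    by_cases hcn : lev c < n
    · exact hgl.2 c hcn hoc
    · exact (hord.lt_of_lev _ _ (by omega)).le

/-- An element in which no variable occurs belongs to `K`. -/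
theorem exists_eq_coeff {s : S} (h : ∀ c, ¬ Occurs (P.expand b s) c) : ∃ a, s = P.coeff a := by
  classical
  refine ⟨P.expand b s 0, P.expand_injective b ?_⟩
  rw [expand_coeff]
  funext e
  by_cases he : e = 0
  · rw [he, Pi.single_eq_same]
  · rw [Pi.single_eq_of_ne he]
    by_contra hne
    obtain ⟨c, hc⟩ := Finsupp.ne_iff.1 he
    exact h c ⟨e, hne, hc⟩

/-- Only finitely many variables occur in an element of `K * U(H)`. -/
theorem exists_level_bound (s : S) : ∃ n, ∀ c, Occurs (P.expand b s) c → lev c < n := by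
  classical
  have hfin : {c | Occurs (P.expand b s) c}.Finite := by
    refine (((P.coord b s).support.biUnion fun e => e.support).finite_toSet).subset ?_
    rintro c ⟨e, he, hc⟩
    obtain ⟨e', rfl⟩ : ∃ e', e = natExp e' := by
      obtain ⟨e', h, -⟩ := P.expand_ne_zero b he
      exact ⟨e', h⟩
    rw [expand_natExp] at he
    simp only [Finset.coe_biUnion, Set.mem_iUnion, Finset.mem_coe]
    refine ⟨e', Finsupp.mem_support_iff.2 he, Finsupp.mem_support_iff.2 ?_⟩
    simpa using hc
  obtain ⟨n, hn⟩ := (hfin.image lev).bddAbove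
  exact ⟨n + 1, fun c hc => Nat.lt_succ_of_le (hn ⟨c, hc, rfl⟩)⟩

include hI hb in
/-- The nonzero elements of `R_m((H / H_m))` are invertible in `K((H))`: the leading coefficient in
the smallest variables becomes invertible once its own variables are series variables. -/
theorem MemSeriesAt.hasInv {f : P.Formal b} (hf : MemSeriesAt P I lev b m f) (h0 : f ≠ 0) :
    HasInv hord I m f := by
  have bounded : ∀ n, ∀ f : P.Formal b, MemSeriesAt P I lev b n f → f ≠ 0 →
      (∀ c, Occurs f c → lev c < n) → HasInv hord I n f := fun n f hf h0 hlev => by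
    refine hf.hasInv_of_base hord hI hb {c | lev c < n} (fun s hs hs0 hZ => ?_) h0 hlev
    have hno : ∀ c, ¬ Occurs (P.expand b s) c := fun c hc =>
      not_occurs_of_mem_sub hI hb hs (hZ c hc) hc
    obtain ⟨a, rfl⟩ := exists_eq_coeff hno
    have ha : a ≠ 0 := by rintro rfl; exact hs0 (map_zero _)
    have g := isGood_top (P := P) hord hI hb (m := n)
    refine ⟨n, P.expand b (P.coeff a⁻¹), le_rfl, (g.coeff_mem _).1, ?_, ?_, fun i _ c hc => ?_⟩
    · rw [g.expand_mul (g.coeff_mem _) (g.coeff_mem _), ← map_mul, mul_inv_cancel₀ ha, map_one]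
    · rw [g.expand_mul (g.coeff_mem _) (g.coeff_mem _), ← map_mul, inv_mul_cancel₀ ha, map_one]
    · obtain ⟨e, he, hec⟩ := hc
      rw [expand_coeff, Pi.single_apply] at he
      split_ifs at he with h
      · rw [h] at hec; exact absurd rfl hec
      · exact absurd rfl he
  refine hf.hasInv_of_base hord hI hb Set.univ (fun s hs hs0 _ => ?_) h0 fun _ _ => trivial
  obtain ⟨n, hn⟩ := exists_level_bound (lev := lev) (P := P) (b := b) s
  obtain ⟨N, g, hN, h⟩ := bounded (max m n) _ (memSeriesAt_expand hord hI hb s)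
    (fun h => hs0 (P.expand_injective b (h.trans (P.expand_zero b).symm)))
    fun c hc => (hn c hc).trans_le (le_max_right _ _)
  exact ⟨N, g, (le_max_left _ _).trans hN, h⟩

/-- The embedding of `K * U(H)` in `K((H))`. -/
def toSeries (hI : IsRNSeries I) (hb : IsQBasis I lev b) (P : CrossedProduct k K H S) :
    S →+* (isGood_series (P := P) hord hI hb).Elt :=
  have hmem : ∀ s, P.expand b s ∈ series hord hI hb P := fun s =>
    ⟨0, memSeriesAt_expand hord hI hb s⟩
  { toFun := fun s => (isGood_series hord hI hb).elt (hmem s)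
    map_zero' := Subtype.ext (P.expand_zero b)
    map_one' := rfl
    map_add' := fun s t => Subtype.ext (P.expand_add b s t)
    map_mul' := fun s t => Subtype.ext
      ((isGood_series hord hI hb).expand_mul (hmem s) (hmem t)).symm }

/-- `K((H))` is a division ring. -/
theorem exists_mul_eq_one (f : (isGood_series (P := P) hord hI hb).Elt) (h0 : f ≠ 0) :
    ∃ g, f * g = 1 ∧ g * f = 1 := by
  obtain ⟨f, m, hf⟩ := f
  obtain ⟨n, g, hmn, hg, h1, h2, -⟩ := hf.hasInv hord hI hb fun h => h0 (Subtype.ext h)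
  have hf := hf.mono hord hI hb hmn
  exact ⟨⟨g, n, hg⟩, Subtype.ext ((seriesMul_eq hord hI hb hf hg).trans h1),
    Subtype.ext ((seriesMul_eq hord hI hb hg hf).trans h2)⟩

end CrossedProduct

end
noncomputable section

open Module

/-! ### Ore domains in division rings -/

section Ore

variable {D : Type*} [DivisionRing D]

/-- A subring of a division ring satisfies the left Ore condition. -/
def IsLeftOre (A : Subring D) : Prop :=
  ∀ a ∈ A, ∀ c ∈ A, c ≠ 0 → ∃ a' ∈ A, ∃ c' ∈ A, c' ≠ 0 ∧ c' * a = a' * c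

namespace IsLeftOre

/-- The division ring of left fractions `c⁻¹ a` with `a`, `c` in a left Ore subring. -/
def fractions {A : Subring D} (hA : IsLeftOre A) : Subfield D where
  carrier := {d | ∃ c ∈ A, c ≠ 0 ∧ c * d ∈ A}
  zero_mem' := ⟨1, one_mem A, one_ne_zero, by rw [mul_zero]; exact zero_mem A⟩
  one_mem' := ⟨1, one_mem A, one_ne_zero, by rw [mul_one]; exact one_mem A⟩
  neg_mem' := by
    rintro d ⟨c, hc, h0, hd⟩
    exact ⟨c, hc, h0, by rw [mul_neg]; exact neg_mem hd⟩
  add_mem' := by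
    rintro d e ⟨c, hc, hc0, hd⟩ ⟨c', hc', hc0', he⟩
    obtain ⟨a, ha, a', ha', h0, h⟩ := hA c hc c' hc' hc0'
    refine ⟨a' * c, mul_mem ha' hc, mul_ne_zero h0 hc0, ?_⟩
    rw [mul_add, mul_assoc, h, mul_assoc]
    exact add_mem (mul_mem ha' hd) (mul_mem ha he)
  mul_mem' := by
    rintro d e ⟨c, hc, hc0, hd⟩ ⟨c', hc', hc0', he⟩
    obtain ⟨a, ha, a', ha', h0, h⟩ := hA (c * d) hd c' hc' hc0'
    refine ⟨a' * c, mul_mem ha' hc, mul_ne_zero h0 hc0, ?_⟩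
    rw [← mul_assoc, mul_assoc a' c d, h, mul_assoc]
    exact mul_mem ha he
  inv_mem' := by
    rintro d ⟨c, hc, hc0, hd⟩
    rcases eq_or_ne d 0 with rfl | h0
    · exact ⟨1, one_mem A, one_ne_zero, by rw [inv_zero, mul_zero]; exact zero_mem A⟩
    · exact ⟨c * d, hd, mul_ne_zero hc0 h0, by rwa [mul_inv_cancel_right₀ h0]⟩

variable {A : Subring D}

theorem mem_fractions (hA : IsLeftOre A) {d : D} :
    d ∈ hA.fractions ↔ ∃ c ∈ A, c ≠ 0 ∧ c * d ∈ A := Iff.rfl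

theorem le_fractions (hA : IsLeftOre A) {a : D} (ha : a ∈ A) : a ∈ hA.fractions :=
  ⟨1, one_mem A, one_ne_zero, by rwa [one_mul]⟩

/-- Finitely many fractions have a common denominator. -/
theorem exists_common_denominator (hA : IsLeftOre A) {ι : Type*} (s : Finset ι) (d : ι → D)
    (hd : ∀ i ∈ s, d i ∈ hA.fractions) : ∃ c ∈ A, c ≠ 0 ∧ ∀ i ∈ s, c * d i ∈ A := by
  classical
  induction s using Finset.induction_on with
  | empty => exact ⟨1, one_mem A, one_ne_zero, by simp⟩
  | insert i s _ ih =>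
    obtain ⟨c, hc, hc0, h⟩ := ih fun j hj => hd j (Finset.mem_insert_of_mem hj)
    obtain ⟨c', hc', hc0', h'⟩ := hA.mem_fractions.1
      (mul_mem (hA.le_fractions hc) (hd i (Finset.mem_insert_self _ _)))
    refine ⟨c' * c, mul_mem hc' hc, mul_ne_zero hc0' hc0, fun j hj => ?_⟩
    rw [mul_assoc]
    rcases Finset.mem_insert.1 hj with rfl | hj
    · exact h'
    · exact mul_mem hc' (h j hj)

/-- Commutation with `u` extends from `A` to its fractions. -/
theorem commutator_mem_fractions (hA : IsLeftOre A) {u : D} (hu : ∀ a ∈ A, u * a - a * u ∈ A)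
    {d : D} (hd : d ∈ hA.fractions) : u * d - d * u ∈ hA.fractions := by
  obtain ⟨c, hc, hc0, h⟩ := hd
  have e : u * d - d * u = c⁻¹ * (u * (c * d) - c * d * u - (u * c - c * u) * d) := by
    rw [eq_inv_mul_iff_mul_eq₀ hc0]; noncomm_ring
  rw [e]
  exact mul_mem (inv_mem (hA.le_fractions hc)) (sub_mem (hA.le_fractions (hu _ h))
    (mul_mem (hA.le_fractions (hu c hc)) ⟨c, hc, hc0, h⟩))

end IsLeftOre

/-- The left span of `1, u, …, u ^ n` over a division subring. -/
def powSpan (F : Subfield D) (u : D) (n : ℕ) : Submodule F D :=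
  Submodule.span F ((fun i : ℕ => u ^ i) '' Set.Iic n)

section PowSpan

variable {F : Subfield D} {u : D}

instance (n : ℕ) : FiniteDimensional F (powSpan F u n) :=
  FiniteDimensional.span_of_finite F ((Set.finite_Iic n).image _)

theorem pow_mem_powSpan {i n : ℕ} (h : i ≤ n) : u ^ i ∈ powSpan F u n :=
  Submodule.subset_span ⟨i, h, rfl⟩

theorem powSpan_mono {n n' : ℕ} (h : n ≤ n') : powSpan F u n ≤ powSpan F u n' :=
  Submodule.span_mono (Set.image_mono fun _ hi => le_trans hi h)

theorem finrank_powSpan_add_le (n d : ℕ) :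
    finrank F (powSpan F u (n + d)) ≤ finrank F (powSpan F u n) + d := by
  induction d with
  | zero => exact le_rfl
  | succ d ih =>
    have e : powSpan F u (n + (d + 1)) =
        powSpan F u (n + d) ⊔ Submodule.span F {u ^ (n + d + 1)} := by
      rw [powSpan, powSpan, ← Submodule.span_union, ← Set.image_singleton (f := fun i : ℕ => u ^ i),
        ← Set.image_union]
      congr 2
      ext i
      simp only [Set.mem_Iic, Set.mem_union, Set.mem_singleton_iff]
      omega
    have h1 : finrank F (Submodule.span F {u ^ (n + d + 1)}) ≤ 1 := by
      simpa using finrank_span_le_card (R := F) {u ^ (n + d + 1)}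
    rw [e]
    exact (Submodule.finrank_add_le_finrank_add_finrank _ _).trans (by omega)

variable (hu : ∀ d ∈ F, u * d - d * u ∈ F)
include hu

theorem mul_mem_powSpan {n : ℕ} {x : D} (hx : x ∈ powSpan F u n) : u * x ∈ powSpan F u (n + 1) := by
  induction hx using Submodule.span_induction with
  | mem x hx =>
    obtain ⟨i, hi, rfl⟩ := hx
    change u * u ^ i ∈ _
    rw [← pow_succ']
    exact pow_mem_powSpan (Nat.succ_le_succ hi)
  | zero => rw [mul_zero]; exact zero_mem _
  | add x y _ _ h1 h2 => rw [mul_add]; exact add_mem h1 h2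
  | smul a x hx h =>
    have e : u * a • x = a • (u * x) + (⟨_, hu a a.2⟩ : F) • x := by
      simp only [Subfield.smul_def, smul_eq_mul]; noncomm_ring
    rw [e]
    exact add_mem (Submodule.smul_mem _ _ h)
      (Submodule.smul_mem _ _ (powSpan_mono (Nat.le_succ n) hx))

theorem pow_mul_mem_powSpan {n : ℕ} (i : ℕ) {x : D} (hx : x ∈ powSpan F u n) :
    u ^ i * x ∈ powSpan F u (i + n) := by
  induction i with
  | zero => simpa using hx
  | succ i ih =>
    rw [pow_succ', mul_assoc, show i + 1 + n = i + n + 1 by omega]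
    exact mul_mem_powSpan hu ih

theorem powSpan_map_le {n d : ℕ} {f : D} (hf : f ∈ powSpan F u d) :
    (powSpan F u n).map (LinearMap.mulRight F f) ≤ powSpan F u (n + d) := by
  rw [powSpan, Submodule.map_span_le]
  rintro _ ⟨i, hi, rfl⟩
  exact powSpan_mono (Nat.add_le_add_right hi d) (pow_mul_mem_powSpan hu i hf)

/-- The polynomials in `u` over a division ring satisfy the left Ore condition: the dimensions of
the spaces of polynomials of bounded degree grow too slowly for two left ideals to have
intersection zero. -/
theorem exists_common_multiple {d : ℕ} {f g : D} (hf : f ∈ powSpan F u d) (hg : g ∈ powSpan F u d)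
    (hf0 : f ≠ 0) (hg0 : g ≠ 0) :
    ∃ n, ∃ p ∈ powSpan F u n, ∃ q ∈ powSpan F u n, q ≠ 0 ∧ q * f = p * g := by
  by_contra! h
  let r := fun n => finrank F (powSpan F u n)
  have dim : ∀ {f : D}, f ≠ 0 → ∀ n,
      finrank F ((powSpan F u n).map (LinearMap.mulRight F f)) = r n := fun {f} hf0 n =>
    (LinearEquiv.finrank_eq (Submodule.equivMapOfInjective _ (mul_left_injective₀ hf0) _)).symm
  have h2 : ∀ n, 2 * r n ≤ r (n + d) := fun n => by
    have := Submodule.finrank_sup_add_finrank_inf_eq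
      ((powSpan F u n).map (LinearMap.mulRight F f)) ((powSpan F u n).map (LinearMap.mulRight F g))
    have hbot : (powSpan F u n).map (LinearMap.mulRight F f) ⊓
        (powSpan F u n).map (LinearMap.mulRight F g) = ⊥ := by
      rw [eq_bot_iff]
      rintro x ⟨⟨q, hq, rfl⟩, ⟨p, hp, hpq⟩⟩
      have hq0 : q = 0 := by
        by_contra hq0
        exact h n p hp q hq hq0 hpq.symm
      rw [hq0, map_zero]; exact zero_mem _
    rw [hbot, finrank_bot, add_zero, dim hf0, dim hg0] at this
    have le := Submodule.finrank_mono (sup_le (powSpan_map_le hu (n := n) hf)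
      (powSpan_map_le hu (n := n) hg))
    rw [this] at le
    change _ ≤ r (n + d) at le
    omega
  have hpos : 1 ≤ r 0 := by
    have : Nontrivial (powSpan F u 0) :=
      ⟨⟨⟨u ^ 0, pow_mem_powSpan le_rfl⟩, 0, fun e => one_ne_zero
        (α := D) (by simpa using congrArg Subtype.val e)⟩⟩
    exact Module.finrank_pos
  have grow : ∀ i, i + 1 ≤ r (i * d) := fun i => by
    induction i with
    | zero => simpa using hpos
    | succ i ih =>
      have := h2 (i * d)
      rw [Nat.succ_mul]
      omega
  have h3 : r (d * d + d) ≤ r (d * d) + d := finrank_powSpan_add_le (d * d) d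
  have := grow d
  have := h2 (d * d)
  omega

end PowSpan

/-- If the elements of `A'` are polynomials in `u` over a left Ore domain `A` which is stable under
commutation with `u`, then `A'` is a left Ore domain. -/
theorem IsLeftOre.of_adjoin {A A' : Subring D} {u : D} (hA : IsLeftOre A)
    (hu : ∀ a ∈ A, u * a - a * u ∈ A) (hle : A ≤ A') (hu' : u ∈ A')
    (hgen : ∀ s ∈ A', ∃ n, s ∈ powSpan hA.fractions u n) : IsLeftOre A' := by
  intro f hf g hg hg0
  rcases eq_or_ne f 0 with rfl | hf0
  · exact ⟨0, zero_mem _, 1, one_mem _, one_ne_zero, by simp⟩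
  have hF := fun d hd => hA.commutator_mem_fractions hu (d := d) hd
  obtain ⟨n, hfn⟩ := hgen f hf
  obtain ⟨n', hgn⟩ := hgen g hg
  obtain ⟨l, p, hp, q, hq, hq0, h⟩ := exists_common_multiple hF
    (powSpan_mono (le_max_left n n') hfn) (powSpan_mono (le_max_right n n') hgn) hf0 hg0
  -- polynomials over the fractions have common denominators
  have clear : ∀ {p}, p ∈ powSpan hA.fractions u l → ∃ c ∈ A, c ≠ 0 ∧
      ∀ a ∈ A, a * c * p ∈ A' := fun {p} hp => by
    obtain ⟨t, ht, w, hw⟩ := (Submodule.mem_span_image_iff_exists_fun _).1 hp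
    obtain ⟨c, hc, hc0, h⟩ := hA.exists_common_denominator Finset.univ (fun i => (w i : D))
      fun i _ => (w i).2
    refine ⟨c, hc, hc0, fun a ha => ?_⟩
    rw [← hw, mul_assoc, Finset.mul_sum]
    refine mul_mem (hle ha) (sum_mem fun i hi => ?_)
    rw [Subfield.smul_def, smul_eq_mul, ← mul_assoc]
    exact mul_mem (hle (h i hi)) (pow_mem hu' _)
  obtain ⟨c, hc, hc0, h1⟩ := clear hp
  obtain ⟨c', hc', hc0', h2⟩ := clear hq
  obtain ⟨a, ha, a', ha', ha0, e⟩ := hA c hc c' hc' hc0'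
  refine ⟨_, h1 a' ha', a' * c * q, ?_, mul_ne_zero (mul_ne_zero ha0 hc0) hq0, ?_⟩
  · rw [e]; exact h2 a ha
  · rw [mul_assoc, h, mul_assoc]
    noncomm_ring

/-- The union of a chain of left Ore domains is a left Ore domain. -/
theorem IsLeftOre.sSup {T : Set (Subring D)} (hne : T.Nonempty) (hdir : DirectedOn (· ≤ ·) T)
    (h : ∀ A ∈ T, IsLeftOre A) : IsLeftOre (sSup T) := by
  intro a ha c hc hc0
  obtain ⟨A, hA, ha⟩ := (Subring.mem_sSup_of_directedOn hne hdir).1 ha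
  obtain ⟨A', hA', hc⟩ := (Subring.mem_sSup_of_directedOn hne hdir).1 hc
  obtain ⟨B, hB, hle, hle'⟩ := hdir A hA A' hA'
  obtain ⟨a', ha', c', hc', h0, e⟩ := h B hB a (hle ha) c (hle' hc) hc0
  exact ⟨a', le_sSup hB ha', c', le_sSup hB hc', h0, e⟩

theorem isLeftOre_subfield (F : Subfield D) : IsLeftOre F.toSubring := fun a ha c hc hc0 =>
  ⟨a * c⁻¹, mul_mem ha (inv_mem (S := Subfield D) hc), 1, one_mem _, one_ne_zero, by simp [hc0]⟩

theorem Subfield.commutator_mem_closure {s : Set D} {u : D}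
    (h : ∀ x ∈ s, u * x - x * u ∈ Subfield.closure s) {x : D} (hx : x ∈ Subfield.closure s) :
    u * x - x * u ∈ Subfield.closure s := by
  induction hx using Subfield.closure_induction with
  | mem x hx => exact h x hx
  | one => simp [zero_mem]
  | add x y _ _ h1 h2 =>
    rw [show u * (x + y) - (x + y) * u = (u * x - x * u) + (u * y - y * u) by noncomm_ring]
    exact add_mem h1 h2
  | neg x _ h1 =>
    rw [show u * -x - -x * u = -(u * x - x * u) by noncomm_ring]; exact neg_mem h1
  | inv x hx h1 =>
    rcases eq_or_ne x 0 with rfl | h0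
    · simp [zero_mem]
    · have e : u * x⁻¹ - x⁻¹ * u = -(x⁻¹ * (u * x - x * u) * x⁻¹) := by
        rw [mul_sub, sub_mul, ← mul_assoc x⁻¹ u, mul_inv_cancel_right₀ h0,
          inv_mul_cancel_left₀ h0, neg_sub]
      rw [e]
      exact neg_mem (mul_mem (mul_mem (inv_mem hx) h1) (inv_mem hx))
  | mul x y hx hy h1 h2 =>
    rw [show u * (x * y) - x * y * u = (u * x - x * u) * y + x * (u * y - y * u) by noncomm_ring]
    exact add_mem (mul_mem h1 hy) (mul_mem hx h2)

theorem Subring.commutator_mem_closure {s : Set D} {u : D}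
    (h : ∀ x ∈ s, u * x - x * u ∈ Subring.closure s) {x : D} (hx : x ∈ Subring.closure s) :
    u * x - x * u ∈ Subring.closure s := by
  induction hx using Subring.closure_induction with
  | mem x hx => exact h x hx
  | zero => simp [zero_mem]
  | one => simp [zero_mem]
  | add x y _ _ h1 h2 =>
    rw [show u * (x + y) - (x + y) * u = (u * x - x * u) + (u * y - y * u) by noncomm_ring]
    exact add_mem h1 h2
  | neg x _ h1 =>
    rw [show u * -x - -x * u = -(u * x - x * u) by noncomm_ring]; exact neg_mem h1
  | mul x y hx hy h1 h2 =>
    rw [show u * (x * y) - x * y * u = (u * x - x * u) * y + x * (u * y - y * u) by noncomm_ring]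
    exact add_mem (mul_mem h1 hy) (mul_mem hx h2)

/-- The left Ore condition passes to the ring generated by `A` and `u`, which consists of
polynomials in `u`. -/
theorem IsLeftOre.closure_insert {A A' : Subring D} {u : D} (hA : IsLeftOre A)
    (hu : ∀ a ∈ A, u * a - a * u ∈ A) (hle : A ≤ A') (hu' : u ∈ A')
    (hgen : A' ≤ Subring.closure (insert u (A : Set D))) : IsLeftOre A' := by
  have hF := fun d hd => hA.commutator_mem_fractions hu (d := d) hd
  refine hA.of_adjoin hu hle hu' fun s hs => ?_
  -- left multiplication by `s` preserves the set of polynomials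
  have key : ∀ y, (∃ n, y ∈ powSpan hA.fractions u n) → ∃ n, s * y ∈ powSpan hA.fractions u n := by
    replace hs := hgen hs
    clear hu'
    induction hs using Subring.closure_induction with
    | mem s hs =>
      rintro y ⟨n, hy⟩
      rcases hs with rfl | hs
      · exact ⟨n + 1, mul_mem_powSpan hF hy⟩
      · exact ⟨n, Submodule.smul_mem _ (⟨s, hA.le_fractions hs⟩ : hA.fractions) hy⟩
    | zero => exact fun y _ => ⟨0, by rw [zero_mul]; exact zero_mem _⟩
    | one => exact fun y hy => by rwa [one_mul]
    | add s t _ _ h1 h2 =>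
      intro y hy
      obtain ⟨n, hn⟩ := h1 y hy
      obtain ⟨n', hn'⟩ := h2 y hy
      refine ⟨max n n', ?_⟩
      rw [add_mul]
      exact add_mem (powSpan_mono (le_max_left _ _) hn) (powSpan_mono (le_max_right _ _) hn')
    | neg s _ h =>
      intro y hy
      obtain ⟨n, hn⟩ := h y hy
      exact ⟨n, by rw [neg_mul]; exact neg_mem hn⟩
    | mul s t _ _ h1 h2 => intro y hy; rw [mul_assoc]; exact h1 _ (h2 y hy)
  have := key 1 ⟨0, by simpa using pow_mem_powSpan (F := hA.fractions) (u := u) (le_refl 0)⟩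
  rwa [mul_one] at this

end Ore

end
noncomputable section

open Module

namespace CrossedProduct

variable {k : Type v} {K : Type w} {H C : Type u} {S : Type w'}
  [Field k] [DivisionRing K] [Algebra k K] [LieRing H] [LieAlgebra k H] [Ring S] [Algebra k S]
  {P : CrossedProduct k K H S} {b : Basis C k H}
  {I : ℕ → LieIdeal k H} {lev : C → ℕ} {D : Type*} [DivisionRing D] (ι : S →+* D) {m : ℕ}

/-! ### The field of fractions as a field of left fractions -/

variable (P I m) in
/-- The subfield of `D` generated by `K * U(H_m)`. -/
abbrev subfield : Subfield D := Subfield.closure (ι '' (P.sub (I m) : Set S))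

variable (P I lev b m) in
/-- The subring of `D` generated by `subfield P I ι m` and the variables of level less than `m` that
satisfy `q`. -/
def subringOf (q : C → Prop) : Subring D :=
  Subring.closure ((subfield P I ι m : Set D) ∪ (fun c => ι (P.bar (b c))) '' {c | lev c < m ∧ q c})

theorem mem_subfield {s : S} (hs : s ∈ P.sub (I m)) : ι s ∈ subfield P I ι m :=
  Subfield.subset_closure ⟨s, hs, rfl⟩

theorem commutator_mem_subfield (x : H) {d : D} (hd : d ∈ subfield P I ι m) :
    ι (P.bar x) * d - d * ι (P.bar x) ∈ subfield P I ι m := by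
  refine Subfield.commutator_mem_closure ?_ hd
  rintro _ ⟨s, hs, rfl⟩
  rw [← map_mul, ← map_mul, ← map_sub]
  exact mem_subfield ι (commutator_mem_sub x hs)

theorem mem_subringOf_of_mem {q : C → Prop} {d : D} (hd : d ∈ subfield P I ι m) :
    d ∈ subringOf P b I lev ι m q := Subring.subset_closure (Or.inl hd)

theorem bar_mem_subringOf {q : C → Prop} {c : C} (hc : lev c < m) (hq : q c) :
    ι (P.bar (b c)) ∈ subringOf P b I lev ι m q :=
  Subring.subset_closure (Or.inr ⟨c, ⟨hc, hq⟩, rfl⟩)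

theorem subringOf_mono {q q' : C → Prop} (h : ∀ c, q c → q' c) :
    subringOf P b I lev ι m q ≤ subringOf P b I lev ι m q' :=
  Subring.closure_mono (Set.union_subset_union_right _
    (Set.image_mono fun c hc => ⟨hc.1, h c hc.2⟩))

theorem bar_mem_subringOf_of_span (hI : IsRNSeries I) (hb : IsQBasis I lev b) {q : C → Prop}
    {V : Set C} (hV : ∀ c ∈ V, lev c < m → q c) {x : H} (hx : x ∈ Submodule.span k (b '' V)) :
    ι (P.bar x) ∈ subringOf P b I lev ι m q := by
  induction hx using Submodule.span_induction with
  | mem x hx =>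
    obtain ⟨c, hc, rfl⟩ := hx
    by_cases h : lev c < m
    · exact bar_mem_subringOf ι h (hV c hc h)
    · exact mem_subringOf_of_mem ι (mem_subfield ι
        (bar_mem_sub ((hb.basis_mem_iff hI).2 (not_lt.1 h))))
  | zero => rw [map_zero, map_zero]; exact zero_mem _
  | add x y _ _ h1 h2 => rw [map_add, map_add]; exact add_mem h1 h2
  | smul α x _ h =>
    rw [map_smul, Algebra.smul_def, ← P.coeff.commutes, map_mul]
    exact mul_mem (mem_subringOf_of_mem ι (mem_subfield ι (coeff_mem_sub _ _))) h

variable [LinearOrder C]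

/-- The union of the rings at the elements satisfying `q` is a left Ore domain if these rings are.
-/
theorem isLeftOre_of_forall_le {q : C → Prop} (hdown : ∀ c d, c ≤ d → q d → q c)
    (h : ∀ i, lev i < m → q i → IsLeftOre (subringOf P b I lev ι m (· ≤ i))) :
    IsLeftOre (subringOf P b I lev ι m q) := by
  let T : Set (Subring D) := insert (subfield P I ι m).toSubring
    ((fun i => subringOf P b I lev ι m (· ≤ i)) '' {i | lev i < m ∧ q i})
  have hne : T.Nonempty := ⟨_, Set.mem_insert _ _⟩
  have hbase : ∀ A ∈ T, (subfield P I ι m).toSubring ≤ A := by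
    rintro A (rfl | ⟨i, -, rfl⟩)
    · exact le_rfl
    · exact fun d hd => mem_subringOf_of_mem ι hd
  have hdir : DirectedOn (· ≤ ·) T := by
    rintro A hA A' hA'
    rcases hA with rfl | ⟨i, hi, rfl⟩
    · exact ⟨A', hA', hbase A' hA', le_rfl⟩
    rcases hA' with rfl | ⟨i', hi', rfl⟩
    · exact ⟨_, Or.inr ⟨i, hi, rfl⟩, le_rfl, hbase _ (Or.inr ⟨i, hi, rfl⟩)⟩
    rcases le_total i i' with hle | hle
    · exact ⟨_, Or.inr ⟨i', hi', rfl⟩, subringOf_mono ι fun c hc => hc.trans hle, le_rfl⟩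
    · exact ⟨_, Or.inr ⟨i, hi, rfl⟩, le_rfl, subringOf_mono ι fun c hc => hc.trans hle⟩
  have e : subringOf P b I lev ι m q = sSup T := by
    refine le_antisymm (Subring.closure_le.2 ?_) (sSup_le ?_)
    · rintro d (hd | ⟨c, hc, rfl⟩)
      · exact le_sSup (a := (subfield P I ι m).toSubring) (Set.mem_insert _ _) hd
      · exact le_sSup (a := subringOf P b I lev ι m (· ≤ c)) (Or.inr ⟨c, hc, rfl⟩)
          (bar_mem_subringOf ι hc.1 le_rfl)
    · rintro A (rfl | ⟨i, hi, rfl⟩)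
      · exact fun d hd => mem_subringOf_of_mem ι hd
      · exact subringOf_mono ι fun c hc => hdown c i hc hi.2
  rw [e]
  refine IsLeftOre.sSup hne hdir ?_
  rintro A (rfl | ⟨i, hi, rfl⟩)
  · exact isLeftOre_subfield _
  · exact h i hi.1 hi.2

/-- Transfinite induction on `j`: the ring at `j` is generated by `ū_j` and the union of the earlier
rings, which is stable under commutators with `ū_j`. -/
theorem isLeftOre_le (hord : IsCanonicalOrder lev) (hI : IsRNSeries I) (hb : IsQBasis I lev b)
    {j : C} (hj : lev j < m) : IsLeftOre (subringOf P b I lev ι m (· ≤ j)) := by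
  refine (hord.wf m).induction
    (C := fun j => IsLeftOre (subringOf P b I lev ι m (· ≤ j.1))) ⟨j, hj⟩ ?_
  rintro ⟨j, hj⟩ ih
  have hlt : IsLeftOre (subringOf P b I lev ι m (· < j)) :=
    isLeftOre_of_forall_le ι (fun c d hcd hd => hcd.trans_lt hd) fun i hi hij => ih ⟨i, hi⟩ hij
  refine hlt.closure_insert (u := ι (P.bar (b j))) (fun d hd => ?_)
    (subringOf_mono ι fun c hc => hc.le) (bar_mem_subringOf ι hj le_rfl)
    (Subring.closure_le.2 ?_)
  · refine Subring.commutator_mem_closure ?_ hd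
    rintro d (hd | ⟨c, hc, rfl⟩)
    · exact mem_subringOf_of_mem ι (commutator_mem_subfield ι _ hd)
    · simp only [← map_mul ι, ← map_sub ι]
      rw [commutator_eq, map_add]
      refine add_mem (bar_mem_subringOf_of_span ι hI hb ?_ (lie_mem_span hI hb _ _))
        (mem_subringOf_of_mem ι (mem_subfield ι (coeff_mem_sub _ _)))
      exact fun d hd _ => (hord.lt_of_lev _ _ hd).trans hc.2
  · rintro d (hd | ⟨c, hc, rfl⟩)
    · exact Subring.subset_closure (Or.inr (mem_subringOf_of_mem ι hd))
    · rcases hc.2.eq_or_lt with rfl | h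
      · exact Subring.subset_closure (Or.inl rfl)
      · exact Subring.subset_closure (Or.inr (bar_mem_subringOf ι hc.1 h))

theorem isLeftOre_top (hord : IsCanonicalOrder lev) (hI : IsRNSeries I) (hb : IsQBasis I lev b) :
    IsLeftOre (subringOf P b I lev ι m fun _ => True) :=
  isLeftOre_of_forall_le ι (fun _ _ _ _ => trivial) fun _ hi _ => isLeftOre_le ι hord hI hb hi

theorem map_mem_subringOf (hord : IsCanonicalOrder lev) (hI : IsRNSeries I) (hb : IsQBasis I lev b)
    (s : S) : ι s ∈ subringOf P b I lev ι m fun _ => True := by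
  set Z := (subringOf P b I lev ι m fun _ => True).comap ι
  refine sub_mon_induction (P := P) hI hb hord m (Y := Z.toAddSubgroup) (fun r hr e he => ?_) s
  refine Z.mul_mem (mem_subringOf_of_mem ι (mem_subfield ι hr)) (Z.list_prod_mem fun y hy => ?_)
  obtain ⟨c, hc, rfl⟩ := List.mem_map.1 hy
  have : ι (P.bar (b c)) ∈ subringOf P b I lev ι m fun _ => True :=
    bar_mem_subringOf ι (he c ((Finset.mem_sort _).1 hc)) trivial
  exact Z.pow_mem this _

/-- A field of fractions of `K * U(H)` consists of left fractions of its subring generated by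
`K * U(H)` and the subfield generated by `K * U(H_m)`. -/
theorem mem_fractions_subringOf (hord : IsCanonicalOrder lev) (hI : IsRNSeries I)
    (hb : IsQBasis I lev b) (hι : IsFieldOfFractions ι) (d : D) :
    d ∈ (isLeftOre_top (P := P) (m := m) ι hord hI hb).fractions := by
  have : Subfield.closure (Set.range ι) ≤
      (isLeftOre_top (P := P) (m := m) ι hord hI hb).fractions := by
    rw [Subfield.closure_le]
    rintro _ ⟨s, rfl⟩
    exact IsLeftOre.le_fractions _ (map_mem_subringOf ι hord hI hb s)
  rw [hι.generates] at this
  exact this (Subfield.mem_top d)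

/-- The ring generated by `K * U(H)` and the subfield `D_m` generated by `K * U(H_m)` is spanned
over `D_m` by the standard monomials in the variables of level less than `m`. -/
theorem subringOf_le_span (hord : IsCanonicalOrder lev) (hI : IsRNSeries I) (hb : IsQBasis I lev b)
    {d : D} (hd : d ∈ subringOf P b I lev ι m fun _ => True) :
    d ∈ Submodule.span (subfield P I ι m)
      (Set.range fun e : {e : C →₀ ℕ // ∀ c ∈ e.support, lev c < m} => ι (P.mon b e)) := by
  set Y := Submodule.span (subfield P I ι m)
    (Set.range fun e : {e : C →₀ ℕ // ∀ c ∈ e.support, lev c < m} => ι (P.mon b e)) with hY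
  have hmap : ∀ s, ι s ∈ Y := sub_mon_induction (P := P) hI hb hord m
    (Y := Y.toAddSubgroup.comap (ι : S →+ D)) fun r hr e he => by
      change ι (r * P.mon b e) ∈ Y
      rw [map_mul]
      exact Y.smul_mem (⟨_, mem_subfield ι hr⟩ : subfield P I ι m)
        (Submodule.subset_span ⟨⟨e, he⟩, rfl⟩)
  have hmem : ∀ {d y}, d ∈ subfield P I ι m → y ∈ Y → d * y ∈ Y := fun {d y} hd hy =>
    Y.smul_mem (⟨d, hd⟩ : subfield P I ι m) hy
  -- left multiplication by `d` preserves the span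
  have key : ∀ y ∈ Y, d * y ∈ Y := by
    induction hd using Subring.closure_induction with
    | mem d hd =>
      rcases hd with hd | ⟨c, hc, rfl⟩
      · exact fun y hy => hmem hd hy
      · intro y hy
        change ι (P.bar (b c)) * y ∈ Y
        induction hy using Submodule.span_induction with
        | mem y hy =>
          obtain ⟨e, rfl⟩ := hy
          simp only [← map_mul]
          exact hmap _
        | zero => rw [mul_zero]; exact zero_mem _
        | add x y _ _ h1 h2 => rw [mul_add]; exact add_mem h1 h2
        | smul a y hy h =>
          have e : ι (P.bar (b c)) * a • y = a * (ι (P.bar (b c)) * y) +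
              (ι (P.bar (b c)) * a - a * ι (P.bar (b c))) * y := by
            rw [Subfield.smul_def, smul_eq_mul]; noncomm_ring
          rw [e]
          exact add_mem (hmem a.2 h) (hmem (commutator_mem_subfield ι _ a.2) hy)
    | zero => intro y _; rw [zero_mul]; exact zero_mem _
    | one => intro y hy; rwa [one_mul]
    | add s t _ _ h1 h2 => intro y hy; rw [add_mul]; exact add_mem (h1 y hy) (h2 y hy)
    | neg s _ h => intro y hy; rw [neg_mul]; exact neg_mem (h y hy)
    | mul s t _ _ h1 h2 => intro y hy; rw [mul_assoc]; exact h1 _ (h2 y hy)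
  have := key 1 (by rw [← map_one ι]; exact hmap 1)
  rwa [mul_one] at this

end CrossedProduct

end
noncomputable section

open Module

/-! ### Functionals that are linear over a common subring -/

section Functional

variable {S L D : Type*} [Ring S] [Ring L] [DivisionRing D] (σ : S →+* L) (ι : S →+* D)

/-- Relations that define the left `D`-space `D ⊗_S M`, for a left `S`-submodule `M` of `L`, in the
`D`-space with basis `L`. -/
def tensorRel (M : AddSubgroup L) : Set (L →₀ D) :=
  {v | ∃ f ∈ M, ∃ g ∈ M,
    v = Finsupp.single (f + g) 1 - Finsupp.single f 1 - Finsupp.single g 1} ∪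
  {v | ∃ s : S, ∃ f ∈ M, v = Finsupp.single (σ s * f) 1 - Finsupp.single f (ι s)}

theorem tensorRel_mono {M M' : AddSubgroup L} (h : M ≤ M') :
    tensorRel σ ι M ⊆ tensorRel σ ι M' := by
  rintro v (⟨f, hf, g, hg, rfl⟩ | ⟨s, f, hf, rfl⟩)
  · exact Or.inl ⟨f, h hf, g, h hg, rfl⟩
  · exact Or.inr ⟨s, f, h hf, rfl⟩

/-- If `1 ⊗ 1 ≠ 0` in `D ⊗_S L`, then there is a left `S`-linear map `L → D` with value `1` at `1`.
-/
theorem exists_functional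
    (h : Finsupp.single (1 : L) (1 : D) ∉ Submodule.span D (tensorRel σ ι ⊤)) :
    ∃ ψ : L →+ D, (∀ s f, ψ (σ s * f) = ι s * ψ f) ∧ ψ 1 = 1 := by
  set N := Submodule.span D (tensorRel σ ι ⊤)
  have h0 : N.mkQ (Finsupp.single 1 1) ≠ 0 := by
    rwa [Ne, Submodule.mkQ_apply, Submodule.Quotient.mk_eq_zero]
  obtain ⟨φ, hφ⟩ := LinearMap.exists_extend
    (LinearEquiv.toSpanNonzeroSingleton D _ _ h0).symm.toLinearMap
  have hφ1 : φ (N.mkQ (Finsupp.single 1 1)) = 1 := by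
    have := LinearMap.congr_fun hφ
      ⟨N.mkQ (Finsupp.single 1 1), Submodule.mem_span_singleton_self _⟩
    refine this.trans ?_
    rw [LinearEquiv.coe_coe, LinearEquiv.symm_apply_eq, LinearEquiv.toSpanNonzeroSingleton_one]
  have hN : ∀ v ∈ tensorRel σ ι (⊤ : AddSubgroup L), φ (N.mkQ v) = 0 := fun v hv => by
    rw [Submodule.mkQ_apply, (Submodule.Quotient.mk_eq_zero N).2 (Submodule.subset_span hv),
      map_zero]
  refine ⟨AddMonoidHom.mk' (fun f => φ (N.mkQ (Finsupp.single f 1))) fun f g => ?_,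
    fun s f => ?_, hφ1⟩
  · have := hN _ (Or.inl ⟨f, trivial, g, trivial, rfl⟩)
    rw [map_sub, map_sub, map_sub, map_sub, sub_sub, sub_eq_zero] at this
    exact this
  · have := hN _ (Or.inr ⟨s, f, trivial, rfl⟩)
    rw [map_sub, map_sub, sub_eq_zero] at this
    refine this.trans ?_
    have e : Finsupp.single f (ι s) = ι s • Finsupp.single f (1 : D) := by
      rw [Finsupp.smul_single, smul_eq_mul, mul_one]
    rw [e, map_smul, map_smul, smul_eq_mul]
    rfl

/-- Tensor products commute with increasing unions. -/
theorem single_one_notMem_span (M : ℕ → AddSubgroup L) (hM : Monotone M)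
    (hex : ∀ f, ∃ n, f ∈ M n)
    (h : ∀ n, Finsupp.single (1 : L) (1 : D) ∉ Submodule.span D (tensorRel σ ι (M n))) :
    Finsupp.single (1 : L) (1 : D) ∉ Submodule.span D (tensorRel σ ι ⊤) := by
  intro hmem
  have hle : tensorRel σ ι (⊤ : AddSubgroup L) ⊆ ⋃ n, tensorRel σ ι (M n) := by
    rintro v (⟨f, -, g, -, rfl⟩ | ⟨s, f, -, rfl⟩)
    · obtain ⟨n, hn⟩ := hex f
      obtain ⟨n', hn'⟩ := hex g
      exact Set.mem_iUnion.2 ⟨max n n', Or.inl ⟨f, hM (le_max_left _ _) hn, g,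
        hM (le_max_right _ _) hn', rfl⟩⟩
    · obtain ⟨n, hn⟩ := hex f
      exact Set.mem_iUnion.2 ⟨n, Or.inr ⟨s, f, hn, rfl⟩⟩
  have := Submodule.span_mono hle hmem
  rw [Submodule.span_iUnion, Submodule.mem_iSup_of_directed] at this
  · obtain ⟨n, hn⟩ := this
    exact h n hn
  · exact (monotone_nat_of_le_succ fun n =>
      Submodule.span_mono (tensorRel_mono σ ι (hM n.le_succ))).directed_le

/-- Let `D` consist of left fractions of a subring `Q` that is spanned by the image of `S` over a
subfield `F`. Families of `F`-linear forms `B i f` on `D` that are balanced over `S` define forms on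
`Q ⊗_S M`, and if the forms `B i 1` separate the points of `Q`, then `q ⊗ 1 ≠ 0` for `0 ≠ q ∈ Q`; by
clearing denominators `1 ⊗ 1 ≠ 0` in `D ⊗_S M`. -/
theorem single_one_notMem_span_of_forms {F : Subfield D} {Q : Subring D} (hQ : IsLeftOre Q)
    (hfrac : ∀ d, d ∈ hQ.fractions) (hspan : ∀ q ∈ Q, q ∈ Submodule.span F (Set.range ι))
    {M : AddSubgroup L} (hM : ∀ s, ∀ f ∈ M, σ s * f ∈ M) {Λ : Type*}
    {c : Λ → L → D} (hc : ∀ i, ∀ f ∈ M, ∀ g ∈ M, c i (f + g) = c i f + c i g)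
    {B : Λ → L → D →ₗ[F] D} (hB : ∀ i, ∀ f ∈ M, ∀ s, B i f (ι s) = c i (σ s * f))
    (hsep : ∀ q ∈ Q, (∀ i, B i 1 q = 0) → q = 0) :
    Finsupp.single (1 : L) (1 : D) ∉ Submodule.span D (tensorRel σ ι M) := by
  let β : Λ → (L →₀ D) →+ D := fun i => Finsupp.liftAddHom fun f => (B i f).toAddMonoidHom
  have hβ : ∀ i f d, β i (Finsupp.single f d) = B i f d := fun i f d =>
    Finsupp.liftAddHom_apply_single _ _ _
  have eqOn : ∀ {Φ Ψ : D →ₗ[F] D}, (∀ s, Φ (ι s) = Ψ (ι s)) → ∀ q ∈ Q, Φ q = Ψ q :=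
    fun {Φ Ψ} h q hq => LinearMap.eqOn_span (f := Φ) (g := Ψ) (s := Set.range ι)
      (by rintro _ ⟨s, rfl⟩; exact h s) (hspan q hq)
  have hrel : ∀ v ∈ tensorRel σ ι M, ∀ q ∈ Q, ∀ i, β i (q • v) = 0 := by
    rintro v (⟨f, hf, g, hg, rfl⟩ | ⟨s, f, hf, rfl⟩) q hq i
    · simp only [smul_sub, Finsupp.smul_single, smul_eq_mul, mul_one, map_sub, hβ]
      have := eqOn (Φ := B i (f + g)) (Ψ := B i f + B i g) (fun s => by
        rw [LinearMap.add_apply, hB i f hf, hB i g hg, hB i _ (add_mem hf hg), mul_add,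
          hc i _ (hM s f hf) _ (hM s g hg)]) q hq
      rw [this, LinearMap.add_apply]
      abel
    · simp only [smul_sub, Finsupp.smul_single, smul_eq_mul, mul_one, map_sub, hβ]
      have := eqOn (Φ := B i (σ s * f)) (Ψ := B i f ∘ₗ LinearMap.mulRight F (ι s)) (fun t => by
        rw [LinearMap.comp_apply, LinearMap.mulRight_apply, ← map_mul, hB i _ (hM s f hf),
          hB i f hf, map_mul, mul_assoc]) q hq
      rw [this, LinearMap.comp_apply, LinearMap.mulRight_apply, sub_self]
  have key : ∀ v ∈ Submodule.span D (tensorRel σ ι M),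
      ∃ q ∈ Q, q ≠ 0 ∧ ∀ a ∈ Q, ∀ i, β i ((a * q) • v) = 0 := by
    intro v hv
    induction hv using Submodule.span_induction with
    | mem v hv => exact ⟨1, one_mem Q, one_ne_zero, fun a ha i => by
        rw [mul_one]; exact hrel v hv a ha i⟩
    | zero => exact ⟨1, one_mem Q, one_ne_zero, fun a ha i => by rw [smul_zero, map_zero]⟩
    | add v w _ _ h1 h2 =>
      obtain ⟨q, hq, hq0, h1⟩ := h1
      obtain ⟨q', hq', hq0', h2⟩ := h2
      obtain ⟨a', ha', c', hc', hc0, e⟩ := hQ q hq q' hq' hq0'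
      refine ⟨c' * q, mul_mem hc' hq, mul_ne_zero hc0 hq0, fun a ha i => ?_⟩
      have h1 := h1 (a * c') (mul_mem ha hc') i
      have h2 := h2 (a * a') (mul_mem ha ha') i
      rw [mul_assoc] at h1 h2
      rw [smul_add, map_add, h1, e, h2, add_zero]
    | smul d v _ h =>
      obtain ⟨q, hq, hq0, h⟩ := h
      obtain ⟨c', hc', hc0, hcd⟩ := hfrac (d * q⁻¹)
      refine ⟨c', hc', hc0, fun a ha i => ?_⟩
      have := h (a * (c' * (d * q⁻¹))) (mul_mem ha hcd) i
      rwa [mul_assoc, mul_assoc, inv_mul_cancel_right₀ hq0, ← mul_assoc, mul_smul] at this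
  intro hmem
  obtain ⟨q, hq, hq0, h⟩ := key _ hmem
  refine hq0 (hsep q hq fun i => ?_)
  have := h 1 (one_mem Q) i
  rwa [one_mul, Finsupp.smul_single, smul_eq_mul, mul_one, hβ] at this

end Functional

/-! ### The correspondence defined by the functionals -/

section Correspondence

variable {S L D : Type*} [Ring S] [Ring L] [DivisionRing D] (σ : S →+* L) (ι : S →+* D)

/-- The pairs `(d, f)` with `1 ⊗ f = d ⊗ 1` in `D ⊗_S L`: every left `S`-linear map `ψ : L → D`
satisfies `ψ f = d * ψ 1`. -/
def corr : Subring (D × L) where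
  carrier := {p | ∀ ψ : L →+ D, (∀ s f, ψ (σ s * f) = ι s * ψ f) → ψ p.2 = p.1 * ψ 1}
  zero_mem' := fun ψ _ => by simp
  one_mem' := fun ψ _ => by simp
  add_mem' := fun {p q} hp hq ψ hψ => by
    rw [Prod.snd_add, Prod.fst_add, map_add, hp ψ hψ, hq ψ hψ, add_mul]
  neg_mem' := fun {p} hp ψ hψ => by
    rw [Prod.snd_neg, Prod.fst_neg, map_neg, hp ψ hψ, neg_mul]
  mul_mem' := fun {p q} hp hq ψ hψ => by
    -- right translates of `ψ` are left `S`-linear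
    have h1 := hp (ψ.comp (AddMonoidHom.mulRight q.2)) fun s f => by
      simp only [AddMonoidHom.comp_apply, AddMonoidHom.mulRight_apply]
      rw [mul_assoc, hψ]
    simp only [AddMonoidHom.comp_apply, AddMonoidHom.mulRight_apply, one_mul] at h1
    rw [Prod.snd_mul, Prod.fst_mul, h1, hq ψ hψ, mul_assoc]

theorem map_mem_corr (s : S) : (ι s, σ s) ∈ corr σ ι := fun ψ hψ => by
  have := hψ s 1
  rwa [mul_one] at this

variable {σ ι} (hψ : ∃ ψ : L →+ D, (∀ s f, ψ (σ s * f) = ι s * ψ f) ∧ ψ 1 = 1)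
include hψ

theorem eq_zero_of_mem_corr {d : D} (h : (d, (0 : L)) ∈ corr σ ι) : d = 0 := by
  obtain ⟨ψ, hψ, h1⟩ := hψ
  have := h ψ hψ
  rw [h1, mul_one, map_zero] at this
  exact this.symm

theorem ne_zero_of_mem_corr {d : D} {f g : L} (h : (d, f) ∈ corr σ ι) (hfg : f * g = 1) :
    d ≠ 0 := by
  rintro rfl
  obtain ⟨ψ, hψ, h1⟩ := hψ
  have := h (ψ.comp (AddMonoidHom.mulRight g)) fun s f => by
    simp only [AddMonoidHom.comp_apply, AddMonoidHom.mulRight_apply]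
    rw [mul_assoc, hψ]
  simp only [AddMonoidHom.comp_apply, AddMonoidHom.mulRight_apply, hfg, h1, zero_mul] at this
  exact one_ne_zero this

theorem inv_mem_corr {d : D} {f g : L} (h : (d, f) ∈ corr σ ι) (hfg : f * g = 1) :
    (d⁻¹, g) ∈ corr σ ι := fun ψ hψ' => by
  have h0 := ne_zero_of_mem_corr hψ h hfg
  have := h (ψ.comp (AddMonoidHom.mulRight g)) fun s f => by
    simp only [AddMonoidHom.comp_apply, AddMonoidHom.mulRight_apply]
    rw [mul_assoc, hψ']
  simp only [AddMonoidHom.comp_apply, AddMonoidHom.mulRight_apply, hfg, one_mul] at this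
  rw [this, inv_mul_cancel_left₀ h0]

end Correspondence

end
noncomputable section

open Module

namespace CrossedProduct

variable {k : Type v} {K : Type w} {H C : Type u} {S : Type w'}
  [Field k] [DivisionRing K] [Algebra k K] [LieRing H] [LieAlgebra k H] [Ring S] [Algebra k S]
  {P : CrossedProduct k K H S} {b : Basis C k H} {I : ℕ → LieIdeal k H} {lev : C → ℕ} {m : ℕ}

/-! ### Coefficients of series with respect to the variables of level less than `m` -/

open scoped Classical in
variable (lev m) in
/-- The coefficient in `R_m` of the monomial with exponent `e`, for `e` concentrated on the
variables of level less than `m`. -/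
def slice (e : C →₀ ℤ) (f : P.Formal b) : P.Formal b := fun e' =>
  if ∀ c, lev c < m → e' c = 0 then f (e' + e) else 0

theorem slice_add (e : C →₀ ℤ) (f g : P.Formal b) :
    slice lev m e (f + g) = slice lev m e f + slice lev m e g := by
  funext e'
  simp only [slice, Pi.add_apply]
  split_ifs <;> simp

theorem slice_eq_slice_coef {j : C} (hj : lev j < m) (e : C →₀ ℤ) (f : P.Formal b) :
    slice lev m e f = slice lev m (e.erase j) (coef j (e j) f) := by
  funext e'
  simp only [slice]
  split_ifs with h
  · rw [coef, if_pos (by simp [h j hj]), add_assoc, Finsupp.erase_add_single]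
  · rfl

theorem slice_expand_mon [LinearOrder C] [DecidableEq (C →₀ ℕ)] {e e' : C →₀ ℕ}
    (he : ∀ c ∈ e.support, lev c < m) (he' : ∀ c ∈ e'.support, lev c < m) :
    slice lev m (natExp e) (P.expand b (P.mon b e')) =
      if e' = e then P.expand b 1 else 0 := by
  classical
  have h1 := P.expand_mon b 1 e'
  rw [map_one, one_mul] at h1
  rw [h1, expand_one]
  -- an exponent without variables of level less than `m` is determined by those of higher level
  have hzero : ∀ x : C →₀ ℤ, (∀ c, lev c < m → x c = 0) → x + natExp e = natExp e' →
      x = 0 := fun x hx h => by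
    ext c
    by_cases hc : lev c < m
    · exact hx c hc
    · have h1 : e c = 0 := by by_contra h; exact hc (he c (Finsupp.mem_support_iff.2 h))
      have h2 : e' c = 0 := by by_contra h; exact hc (he' c (Finsupp.mem_support_iff.2 h))
      have := DFunLike.congr_fun h c
      simpa [h1, h2] using this
  funext x
  simp only [slice, Pi.single_apply]
  split_ifs with hx h h' h''
  · simp [hzero x hx h]
  · exact absurd (natExp_injective (by rw [← h, hzero x hx h, zero_add])) h'
  · rw [Pi.single_apply, if_neg]
    rintro rfl
    exact h (by rw [zero_add, h''])
  · rfl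
  · rw [Pi.single_apply, if_neg]
    rintro rfl
    exact hx fun _ _ => rfl
  · rfl

variable [LinearOrder C] (hord : IsCanonicalOrder lev) (hI : IsRNSeries I) (hb : IsQBasis I lev b)

include hI hb in
theorem slice_expand [DecidableEq (C →₀ ℤ)] {s : S} (hs : s ∈ P.sub (I m)) {e : C →₀ ℤ}
    (he : ∀ c ∈ e.support, lev c < m) :
    slice lev m e (P.expand b s) = if e = 0 then P.expand b s else 0 := by
  have hno : ∀ x : C →₀ ℤ, (∃ c, lev c < m ∧ x c ≠ 0) → P.expand b s x = 0 := by
    rintro x ⟨c, hc, hx⟩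
    by_contra h
    exact not_occurs_of_mem_sub hI hb hs hc ⟨x, h, hx⟩
  funext x
  simp only [slice]
  split_ifs with hx h h
  · rw [h, add_zero]
  · obtain ⟨c, hc⟩ := Finsupp.ne_iff.1 h
    have hcm := he c (Finsupp.mem_support_iff.2 hc)
    exact hno _ ⟨c, hcm, by simpa [hx c hcm] using hc⟩
  · push Not at hx
    exact (hno x hx).symm
  · rfl

/-- Left multiplication by a coefficient is applied coefficientwise. -/
theorem IsGood.coef_mul {O : Ops P b} {A : Submodule k (P.Formal b)} {V : Set C}
    (h : IsGood O A V) {j : C} (hA : ∀ f ∈ A, ∀ c, Occurs f c → c < j) {a f : P.Formal b}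
    (ha : a ∈ A) (hf : f ∈ laurentSub A j) (n : ℤ) :
    coef j n ((O.laurent j).mul a f) = O.mul a (coef j n f) := by
  have ha' := le_laurentSub hA ha
  rw [← h.val_lift_of_mem (h.laurent_mul_mem hA ha' hf), h.lift_mul hA ha' hf, h.lift_of_mem hA ha,
    SkewLaurent.single_mul _ _ (h.exists_bddDeg hf).choose_spec, SkewLaurent.twist_zero,
    ← h.val_lift_of_mem hf]
  rfl

/-- The coefficients of elements of `R_m((H / H_m))` belong to `R_m` and are left `R_m`-linear. -/
theorem slice_mem_and_mul {f : P.Formal b} (hf : MemSeriesAt P I lev b m f) :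
    ∀ e : C →₀ ℤ, (∀ c ∈ e.support, lev c < m) →
      slice lev m e f ∈ part hord hI hb P m (fun _ => False) ∧
      ∀ r ∈ P.sub (I m), slice lev m e ((ops P b hord m).mul (P.expand b r) f) =
        (ops P b hord m).mul (P.expand b r) (slice lev m e f) := by
  classical
  have hF := isGood_base (P := P) (m := m) hord hI hb
  have hmem : ∀ {s}, s ∈ P.sub (I m) → P.expand b s ∈ part hord hI hb P m (fun _ => False) :=
    fun {s} hs => (mem_part_false hord hI hb).2 ⟨s, hs, rfl⟩
  induction hf with
  | base s hs =>
    intro e he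
    rw [slice_expand hI hb hs he]
    refine ⟨?_, fun r hr => ?_⟩
    · split_ifs
      · exact hmem hs
      · exact zero_mem _
    · rw [hF.expand_mul (hmem hr) (hmem hs), slice_expand hI hb (mul_mem hr hs) he]
      split_ifs
      · rw [hF.expand_mul (hmem hr) (hmem hs)]
      · rw [← P.expand_zero b, hF.expand_mul (hmem hr) (hmem (zero_mem _)), mul_zero]
  | laurent j f hj hc hlt hN ih =>
    intro e he
    have he' : ∀ c ∈ (e.erase j).support, lev c < m := fun c hc => by
      rw [Finsupp.support_erase] at hc
      exact he c (Finset.mem_of_mem_erase hc)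
    obtain ⟨h1, h2⟩ := ih (e j) (e.erase j) he'
    refine ⟨by rwa [slice_eq_slice_coef hj], fun r hr => ?_⟩
    have hg := isGood_lt (P := P) (m := m) hord hI hb j
    have hfl : f ∈ laurentSub (part hord hI hb P m (· < j)) j := ⟨fun n => ⟨hc n, hlt n⟩, hN⟩
    have hrj : P.expand b r ∈ part hord hI hb P m (· < j) :=
      part_mono hord hI hb (fun _ h => h.elim) (hmem hr)
    have hA := fun f hf => lt_of_occurs_part (P := P) hord hI hb hj (f := f) hf
    have hr' := IsGood.le_laurentSub hA hrj
    have e1 := hg.coef_mul hA hrj hfl (e j)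
    rw [laurentSub_part hord hI hb hj] at hfl hr'
    rw [slice_eq_slice_coef hj, slice_eq_slice_coef hj e f,
      (ops_eq_laurent hord hI hb hj hg).1 _ hr' _ hfl, e1, h2 r hr]

section Coefficients

variable {D : Type*} [DivisionRing D] (ι : S →+* D)

variable (lev m) in
/-- The image in `D` of the coefficient in `R_m` of the monomial with exponent `e`. -/
def coeffAt (e : C →₀ ℕ) (f : P.Formal b) : D :=
  ι (Function.invFun (P.expand b) (slice lev m (natExp e) f))

omit [LinearOrder C] in
theorem natExp_support {e : C →₀ ℕ} (he : ∀ c ∈ e.support, lev c < m) :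
    ∀ c ∈ (natExp e).support, lev c < m := fun c hc => he c (by
  rw [Finsupp.mem_support_iff] at hc ⊢
  simpa using hc)

theorem invFun_expand (s : S) : Function.invFun (P.expand b) (P.expand b s) = s :=
  Function.leftInverse_invFun (P.expand_injective b) s

include hord hI hb

theorem coeffAt_add {e : C →₀ ℕ} (he : ∀ c ∈ e.support, lev c < m) {f g : P.Formal b}
    (hf : MemSeriesAt P I lev b m f) (hg : MemSeriesAt P I lev b m g) :
    coeffAt lev m ι e (f + g) = coeffAt lev m ι e f + coeffAt lev m ι e g := by
  obtain ⟨s, -, hs⟩ := (mem_part_false hord hI hb).1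
    (slice_mem_and_mul hord hI hb hf _ (natExp_support he)).1
  obtain ⟨t, -, ht⟩ := (mem_part_false hord hI hb).1
    (slice_mem_and_mul hord hI hb hg _ (natExp_support he)).1
  rw [coeffAt, coeffAt, coeffAt, slice_add, hs, ht, ← expand_add, invFun_expand, invFun_expand,
    invFun_expand, map_add]

theorem coeffAt_mul {e : C →₀ ℕ} (he : ∀ c ∈ e.support, lev c < m) {f : P.Formal b}
    (hf : MemSeriesAt P I lev b m f) {r : S} (hr : r ∈ P.sub (I m)) :
    coeffAt lev m ι e ((ops P b hord m).mul (P.expand b r) f) = ι r * coeffAt lev m ι e f := by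
  obtain ⟨h1, h2⟩ := slice_mem_and_mul hord hI hb hf _ (natExp_support he)
  obtain ⟨s, hs', hs⟩ := (mem_part_false hord hI hb).1 h1
  rw [coeffAt, coeffAt, h2 r hr, hs, (isGood_base hord hI hb).expand_mul
    ((mem_part_false hord hI hb).2 ⟨r, hr, rfl⟩) ((mem_part_false hord hI hb).2 ⟨s, hs', rfl⟩),
    invFun_expand, invFun_expand, map_mul]

omit hord hI hb in
theorem coeffAt_mon [DecidableEq (C →₀ ℕ)] {e e' : C →₀ ℕ} (he : ∀ c ∈ e.support, lev c < m)
    (he' : ∀ c ∈ e'.support, lev c < m) :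
    coeffAt lev m ι e (P.expand b (P.mon b e')) = if e' = e then 1 else 0 := by
  rw [coeffAt, slice_expand_mon he he']
  split_ifs
  · rw [invFun_expand, map_one]
  · rw [← P.expand_zero b, invFun_expand, map_zero]

end Coefficients

variable {D : Type*} [DivisionRing D] {ι : S →+* D}

/-- The elements of `R_m((H / H_m))`, inside the ring `K((H))`. -/
def seriesAt (hI : IsRNSeries I) (hb : IsQBasis I lev b) (P : CrossedProduct k K H S) (m : ℕ) :
    AddSubgroup (isGood_series (P := P) hord hI hb).Elt :=
  (part hord hI hb P m fun _ => True).toAddSubgroup.comap (isGood_series hord hI hb).val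

theorem mem_seriesAt {f : (isGood_series (P := P) hord hI hb).Elt} :
    f ∈ seriesAt hord hI hb P m ↔ MemSeriesAt P I lev b m ((isGood_series hord hI hb).val f) :=
  mem_part_top hord hI hb

theorem val_mul_eq {f g : (isGood_series (P := P) hord hI hb).Elt}
    (hf : f ∈ seriesAt hord hI hb P m) (hg : g ∈ seriesAt hord hI hb P m) :
    (isGood_series hord hI hb).val (f * g) = (ops P b hord m).mul
      ((isGood_series hord hI hb).val f) ((isGood_series hord hI hb).val g) :=
  seriesMul_eq hord hI hb ((mem_seriesAt hord hI hb).1 hf) ((mem_seriesAt hord hI hb).1 hg)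

theorem toSeries_mem (s : S) : toSeries hord hI hb P s ∈ seriesAt hord hI hb P m :=
  (mem_seriesAt hord hI hb).2 (memSeriesAt_expand hord hI hb s)

theorem mul_mem_seriesAt {f g : (isGood_series (P := P) hord hI hb).Elt}
    (hf : f ∈ seriesAt hord hI hb P m) (hg : g ∈ seriesAt hord hI hb P m) :
    f * g ∈ seriesAt hord hI hb P m := by
  rw [seriesAt, AddSubgroup.mem_comap, val_mul_eq hord hI hb hf hg]
  exact (isGood_top hord hI hb).mul_mem hf hg

/-- Since the standard monomials are independent over the subfield `D_m` of `D`, the coefficients of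
the elements `s * f` of `R_m((H / H_m))` depend `D_m`-linearly on the image of `s` in `D`. -/
theorem exists_form
    (hind : LinearIndependent (subfield P I ι m)
      fun e : {e : C →₀ ℕ // ∀ c ∈ e.support, lev c < m} => ι (P.mon b e))
    (e : {e : C →₀ ℕ // ∀ c ∈ e.support, lev c < m})
    {f : (isGood_series (P := P) hord hI hb).Elt} (hf : f ∈ seriesAt hord hI hb P m) :
    ∃ B : D →ₗ[subfield P I ι m] D, ∀ s, B (ι s) = coeffAt lev m ι e.1
      ((isGood_series hord hI hb).val (toSeries hord hI hb P s * f)) := by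
  let c : S → D := fun s => coeffAt lev m ι e.1
    ((isGood_series hord hI hb).val (toSeries hord hI hb P s * f))
  have hmul : ∀ s, toSeries hord hI hb P s * f ∈ seriesAt hord hI hb P m := fun s =>
    mul_mem_seriesAt hord hI hb (toSeries_mem hord hI hb s) hf
  have hadd : ∀ s t, c (s + t) = c s + c t := fun s t => by
    simp only [c, map_add, add_mul]
    exact coeffAt_add hord hI hb ι e.2 ((mem_seriesAt hord hI hb).1 (hmul s))
      ((mem_seriesAt hord hI hb).1 (hmul t))
  obtain ⟨B, hB⟩ := LinearMap.exists_extend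
    ((Basis.span hind).constr ℕ fun e' => c (P.mon b e'.1))
  have hmon : ∀ e' : {e : C →₀ ℕ // ∀ c ∈ e.support, lev c < m},
      B (ι (P.mon b e')) = c (P.mon b e'.1) := fun e' => by
    have := LinearMap.congr_fun hB (Basis.span hind e')
    rw [Basis.constr_basis, LinearMap.comp_apply, Submodule.subtype_apply, Basis.span_apply] at this
    exact this
  refine ⟨B, fun s => ?_⟩
  have := sub_mon_induction (P := P) hI hb hord m
    (Y := ((B.toAddMonoidHom.comp (ι : S →+ D)) - AddMonoidHom.mk' c hadd).ker)
    (fun r hr e' he' => ?_) s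
  · exact sub_eq_zero.1 this
  · change B (ι (r * P.mon b e')) - c (r * P.mon b e') = 0
    rw [sub_eq_zero, map_mul]
    have h1 : B (ι r * ι (P.mon b e')) = ι r * B (ι (P.mon b e')) :=
      B.map_smul (⟨_, mem_subfield ι hr⟩ : subfield P I ι m) _
    rw [h1, hmon ⟨e', he'⟩]
    simp only [c]
    rw [map_mul (toSeries hord hI hb P), mul_assoc,
      val_mul_eq hord hI hb (toSeries_mem hord hI hb r) (hmul _)]
    exact (coeffAt_mul hord hI hb ι e.2 ((mem_seriesAt hord hI hb).1 (hmul _)) hr).symm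

/-- `1 ⊗ 1 ≠ 0` in the tensor product of `D` and `R_m((H / H_m))` over `K * U(H)`. -/
theorem single_one_notMem_span_seriesAt (hι : IsFieldOfFractions ι)
    (hind : LinearIndependent (subfield P I ι m)
      fun e : {e : C →₀ ℕ // ∀ c ∈ e.support, lev c < m} => ι (P.mon b e)) :
    Finsupp.single (1 : (isGood_series (P := P) hord hI hb).Elt) (1 : D) ∉ Submodule.span D
      (tensorRel (toSeries hord hI hb P) ι (seriesAt hord hI hb P m)) := by
  classical
  let c : {e : C →₀ ℕ // ∀ c ∈ e.support, lev c < m} →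
      (isGood_series (P := P) hord hI hb).Elt → D := fun e f =>
    coeffAt lev m ι e.1 ((isGood_series hord hI hb).val f)
  have hex : ∀ (e : {e : C →₀ ℕ // ∀ c ∈ e.support, lev c < m})
      (f : (isGood_series (P := P) hord hI hb).Elt), ∃ B : D →ₗ[subfield P I ι m] D,
      f ∈ seriesAt hord hI hb P m → ∀ s, B (ι s) = c e (toSeries hord hI hb P s * f) :=
      fun e f => by
    by_cases hf : f ∈ seriesAt hord hI hb P m
    · obtain ⟨B, hB⟩ := exists_form hord hI hb hind e hf
      exact ⟨B, fun _ => hB⟩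
    · exact ⟨0, fun h => absurd h hf⟩
  choose B hB using hex
  have h1 : (1 : (isGood_series (P := P) hord hI hb).Elt) ∈ seriesAt hord hI hb P m := by
    rw [← map_one (toSeries hord hI hb P)]; exact toSeries_mem hord hI hb 1
  have hQ := isLeftOre_top (P := P) (m := m) ι hord hI hb
  have hfrac : ∀ d, d ∈ hQ.fractions := mem_fractions_subringOf ι hord hI hb hι
  have hspan : ∀ q ∈ subringOf P b I lev ι m fun _ => True,
      q ∈ Submodule.span (subfield P I ι m) (Set.range ι) := fun q hq => by
    refine Submodule.span_mono ?_ (subringOf_le_span ι hord hI hb hq)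
    rintro _ ⟨e, rfl⟩
    exact ⟨_, rfl⟩
  have hcs : ∀ e s, c e (toSeries hord hI hb P s) = coeffAt lev m ι e.1 (P.expand b s) :=
    fun _ _ => rfl
  have hsep : ∀ q ∈ subringOf P b I lev ι m fun _ => True, (∀ e, B e 1 q = 0) → q = 0 := by
    intro q hq h0
    obtain ⟨a, rfl⟩ := Finsupp.mem_span_range_iff_exists_finsupp.1
      (subringOf_le_span ι hord hI hb hq)
    have ha : a = 0 := by
      ext e
      have := h0 e
      rw [Finsupp.sum, map_sum, Finset.sum_eq_single e] at this
      · rw [map_smul, hB e 1 h1, mul_one, hcs, coeffAt_mon ι e.2 e.2, if_pos rfl,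
          Subfield.smul_def, smul_eq_mul, mul_one] at this
        exact this
      · intro e' _ hne
        rw [map_smul, hB e 1 h1, mul_one, hcs, coeffAt_mon ι e.2 e'.2,
          if_neg fun h => hne (Subtype.ext h), smul_zero]
      · intro he
        rw [Finsupp.notMem_support_iff.1 he, zero_smul, map_zero]
    rw [ha, Finsupp.sum_zero_index]
  have hc : ∀ e, ∀ f ∈ seriesAt hord hI hb P m, ∀ g ∈ seriesAt hord hI hb P m,
      c e (f + g) = c e f + c e g := fun e f hf g hg => by
    simp only [c]
    rw [map_add]
    exact coeffAt_add hord hI hb ι e.2 ((mem_seriesAt hord hI hb).1 hf)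
      ((mem_seriesAt hord hI hb).1 hg)
  exact single_one_notMem_span_of_forms (toSeries hord hI hb P) ι hQ hfrac hspan
    (fun s f hf => mul_mem_seriesAt hord hI hb (toSeries_mem hord hI hb s) hf)
    (c := c) hc hB hsep

end CrossedProduct

end
noncomputable section

open Module

namespace CrossedProduct

variable {k : Type v} {K : Type w} {H C : Type u} {S : Type w'}
  [Field k] [DivisionRing K] [Algebra k K] [LieRing H] [LieAlgebra k H] [Ring S] [Algebra k S]
  [LinearOrder C] {P : CrossedProduct k K H S} {b : Basis C k H} {I : ℕ → LieIdeal k H}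
  {lev : C → ℕ} (hord : IsCanonicalOrder lev) (hI : IsRNSeries I) (hb : IsQBasis I lev b)
  {D : Type*} [DivisionRing D] {ι : S →+* D}

/-! ### The isomorphism -/

include hord hI hb in
theorem MemKH.memSeries {f : P.Formal b} (hf : MemKH P I b hord f) : MemSeries P I lev b f := by
  induction hf with
  | of s => exact ⟨0, memSeriesAt_expand hord hI hb s⟩
  | add _ _ h1 h2 => exact (series hord hI hb P).add_mem h1 h2
  | neg _ h => exact (series hord hI hb P).neg_mem h
  | mul _ _ h1 h2 => exact (isGood_series hord hI hb).mul_mem h1 h2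
  | inv _ hg _ _ _ => exact hg

/-- An element of `K(H)`, as an element of `K((H))`. -/
def KH.toElt (f : KH P I b hord) : (isGood_series (P := P) hord hI hb).Elt :=
  ⟨f.1, f.2.memSeries hord hI hb⟩

/-- Every element of `K(H)` corresponds to an element of `D`. -/
theorem exists_mem_corr
    (hψ : ∃ ψ : (isGood_series (P := P) hord hI hb).Elt →+ D,
      (∀ s f, ψ (toSeries hord hI hb P s * f) = ι s * ψ f) ∧ ψ 1 = 1)
    {f : P.Formal b} (hf : MemKH P I b hord f) :
    ∃ d, (d, KH.toElt hord hI hb ⟨f, hf⟩) ∈ corr (toSeries hord hI hb P) ι := by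
  induction hf with
  | of s => exact ⟨ι s, map_mem_corr _ _ s⟩
  | add hf hg h1 h2 =>
    obtain ⟨d, h1⟩ := h1
    obtain ⟨e, h2⟩ := h2
    exact ⟨d + e, add_mem h1 h2⟩
  | neg hf h =>
    obtain ⟨d, h⟩ := h
    exact ⟨-d, neg_mem h⟩
  | mul hf hg h1 h2 =>
    obtain ⟨d, h1⟩ := h1
    obtain ⟨e, h2⟩ := h2
    exact ⟨d * e, mul_mem h1 h2⟩
  | inv hf hg hfg hgf h =>
    obtain ⟨d, h⟩ := h
    exact ⟨d⁻¹, inv_mem_corr hψ h (Subtype.ext hfg)⟩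

/-- Every element of `D` corresponds to an element of `K(H)`. -/
theorem exists_KH_mem_corr (hι : IsFieldOfFractions ι)
    (hψ : ∃ ψ : (isGood_series (P := P) hord hI hb).Elt →+ D,
      (∀ s f, ψ (toSeries hord hI hb P s * f) = ι s * ψ f) ∧ ψ 1 = 1) (d : D) :
    ∃ f : KH P I b hord, (d, f.toElt hord hI hb) ∈ corr (toSeries hord hI hb P) ι := by
  have hd : d ∈ Subfield.closure (Set.range ι) := hι.generates ▸ Subfield.mem_top d
  induction hd using Subfield.closure_induction with
  | mem d hd =>
    obtain ⟨s, rfl⟩ := hd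
    exact ⟨toKH P I b hord s, map_mem_corr _ _ s⟩
  | one => exact ⟨toKH P I b hord 1, one_mem (corr (toSeries hord hI hb P) ι)⟩
  | add d e _ _ h1 h2 =>
    obtain ⟨f, h1⟩ := h1
    obtain ⟨g, h2⟩ := h2
    exact ⟨f + g, add_mem h1 h2⟩
  | neg d _ h =>
    obtain ⟨f, h⟩ := h
    exact ⟨⟨-f.1, f.2.neg⟩, neg_mem h⟩
  | inv d _ h =>
    obtain ⟨f, h⟩ := h
    by_cases h0 : f.toElt hord hI hb = 0
    · rw [h0] at h
      rw [eq_zero_of_mem_corr hψ h, inv_zero, ← map_zero ι]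
      exact ⟨toKH P I b hord 0, map_mem_corr _ _ 0⟩
    · obtain ⟨g, hfg, hgf⟩ := exists_mul_eq_one hord hI hb _ h0
      exact ⟨⟨(isGood_series hord hI hb).val g, f.2.inv ((isGood_series hord hI hb).val_mem g)
        (congrArg Subtype.val hfg) (congrArg Subtype.val hgf)⟩, inv_mem_corr hψ h hfg⟩
  | mul d e _ _ h1 h2 =>
    obtain ⟨f, h1⟩ := h1
    obtain ⟨g, h2⟩ := h2
    exact ⟨f * g, mul_mem h1 h2⟩

/-- If `1 ⊗ 1 ≠ 0` in `D ⊗ K((H))`, then `K(H)` and `D` are isomorphic fields of fractions. -/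
theorem exists_ringEquiv (hι : IsFieldOfFractions ι)
    (hψ : ∃ ψ : (isGood_series (P := P) hord hI hb).Elt →+ D,
      (∀ s f, ψ (toSeries hord hI hb P s * f) = ι s * ψ f) ∧ ψ 1 = 1) :
    ∃ φ : KH P I b hord ≃+* D, ∀ s : S, φ (toKH P I b hord s) = ι s := by
  set R := corr (toSeries hord hI hb P) ι
  -- the correspondence is the graph of a bijection
  have hfun : ∀ {d e x}, (d, x) ∈ R → (e, x) ∈ R → d = e := fun {d e x} h1 h2 => by
    have := sub_mem h1 h2
    rw [Prod.mk_sub_mk, sub_self] at this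
    exact sub_eq_zero.1 (eq_zero_of_mem_corr hψ this)
  have hinj : ∀ {d x y}, (d, x) ∈ R → (d, y) ∈ R → x = y := fun {d x y} h1 h2 => by
    have := sub_mem h1 h2
    rw [Prod.mk_sub_mk, sub_self] at this
    by_contra hne
    obtain ⟨g, hg, -⟩ := exists_mul_eq_one hord hI hb _ (sub_ne_zero.2 hne)
    exact ne_zero_of_mem_corr hψ this hg rfl
  choose φ hφ using fun f : KH P I b hord => exists_mem_corr hord hI hb hψ f.2
  have hbij : Function.Bijective φ := by
    refine ⟨fun f g h => ?_, fun d => ?_⟩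
    · have := hφ g
      rw [← h] at this
      exact Subtype.ext (congrArg (isGood_series hord hI hb).val (hinj (hφ f) this))
    · obtain ⟨f, hf⟩ := exists_KH_mem_corr hord hI hb hι hψ d
      exact ⟨f, hfun (hφ f) hf⟩
  exact ⟨{ Equiv.ofBijective φ hbij with
      map_mul' := fun f g => hfun (hφ (f * g)) (mul_mem (hφ f) (hφ g))
      map_add' := fun f g => hfun (hφ (f + g)) (add_mem (hφ f) (hφ g)) },
    fun s => hfun (hφ (toKH P I b hord s)) (map_mem_corr _ _ s)⟩

/-- Independence of the standard monomials over the fields `D_m` implies that `1 ⊗ 1 ≠ 0` in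
`D ⊗ K((H))`, in the form of an `S`-linear map with value `1` at `1`. -/
theorem exists_series_functional (hι : IsFieldOfFractions ι)
    (hind : ∀ m : ℕ, LinearIndependent (subfield P I ι m)
      fun e : {e : C →₀ ℕ // ∀ c ∈ e.support, lev c < m} => ι (P.mon b e)) :
    ∃ ψ : (isGood_series (P := P) hord hI hb).Elt →+ D,
      (∀ s f, ψ (toSeries hord hI hb P s * f) = ι s * ψ f) ∧ ψ 1 = 1 := by
  refine exists_functional _ _ (single_one_notMem_span _ _ (seriesAt hord hI hb P)
    (fun m n hmn f hf => ?_) (fun f => ?_) fun m =>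
      single_one_notMem_span_seriesAt hord hI hb hι (hind m))
  · exact (mem_seriesAt hord hI hb).2 (((mem_seriesAt hord hI hb).1 hf).mono hord hI hb hmn)
  · obtain ⟨m, hm⟩ := (isGood_series hord hI hb).val_mem f
    exact ⟨m, (mem_seriesAt hord hI hb).2 hm⟩

end CrossedProduct

end

theorem mainTheorem6 {k K S D : Type*} {H C : Type u}
    [Field k] [DivisionRing K] [Algebra k K] [LieRing H] [LieAlgebra k H]
    [Ring S] [Algebra k S] [DivisionRing D] [LinearOrder C]
    (I : ℕ → LieIdeal k H) (hI : IsRNSeries I)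
    (lev : C → ℕ) (b : Module.Basis C k H) (hb : IsQBasis I lev b) (hord : IsCanonicalOrder lev)
    (P : CrossedProduct k K H S) (ι : S →+* D) (hι : IsFieldOfFractions ι)
    (hind : ∀ m : ℕ, LinearIndependent (Subfield.closure (ι '' (P.sub (I m) : Set S)))
      fun e : {e : C →₀ ℕ // ∀ c ∈ e.support, lev c < m} => ι (P.mon b e)) :
    ∃ φ : CrossedProduct.KH P I b hord ≃+* D,
      ∀ s : S, φ (CrossedProduct.toKH P I b hord s) = ι s :=
  CrossedProduct.exists_ringEquiv hord hI hb hι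
    (CrossedProduct.exists_series_functional hord hI hb hι hind)
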